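/- **Conventions.** A rank-$3$ simple matroid $M$ is a matroid of rank $3$ on a finite set $E$ without loops or parallel elements. For a commutative ring $A$, a realization of $M$ over $A$ is a family $(p_e)_{e\in E}$ of points of $\mathbb P^2(A)$ such that for all $a,b,c\in E$ the determinant of $p_a,p_b,p_c$ is zero if $\{a,b,c\}$ is not a basis of $M$ (that is, if $a,b,c$ lie on a common rank-$2$ flat), and is nowhere zero on $\operatorname{Spec} A$ if $\{a,b,c\}$ is a basis. This defines a locally closed subscheme of $(\mathbb P^2_{\mathbb Z})^E$. If the group scheme $\mathrm{PGL}_3$ over $\mathbb Z$ acts freely on it, the quotient by $\mathrm{PGL}_3$ (the quotient sheaf for the Zariski topology) is called the realization space of $M$. Let $S_n=\mathbb Z[y_1,\dots,y_n]$. An elementary monic representation consists of elements $x_0=t$, $x_l=y_l+t$ for $1\le l\le n$ (the $n$ free variables), and finitely many further elements $x_{n+1},\dots,x_{n+r}$ of $S_n[t]$, each monic as a polynomial in $t$ and each defined as $x_l=x_j+x_k$ (an addition), $x_l=x_jx_k$ (a multiplication) or $x_l=x_j+1$ (an increment) with $j,k<l$, together with finite sets $E$ (equalities) and $I$ (inequalities)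 of pairs $(j,k)$ of indices in $\{0,\dots,n+r\}$ such that $x_j-x_k\in S_n$. It is an elementary monic representation of every ring isomorphic to $$S_n\big[(x_j-x_k)^{-1}\big]_{(j,k)\in I}\big/\langle x_j-x_k \mid (j,k)\in E\rangle .$$ **Theorem 5.3 (Mnëv universality).** Let $R$ be a commutative $\mathbb Z$-algebra of finite type. Then there exist an integer $N\ge 0$ and a rank-$3$ simple matroid $M$ such that $\mathrm{PGL}_3$ acts freely on the realizations of $M$ and the realization space of $M$ is isomorphic to an open subscheme $U\subset\mathbb A^N\times\operatorname{Spec}R$ for which the projection $U\to\operatorname{Spec}R$ is surjective. Moreover, for every elementary monic representation of $R$ with $n$ free variables, $a$ additions, $m$ multiplications, $o$ increments, $e$ equalities and $i$ inequalities, there is such a matroid $M$ with exactly $$3n+7a+7o+6m+5e+6i+6$$ elements, for which one can take $$N=3(n+a+o+m+e+i)+1 .$$ -/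

import Mathlib

open CategoryTheory AlgebraicGeometry

universe u

namespace Mnev

/-! ### Points of the projective plane over a ring -/

section Plane

/-- `ℙ²(A)` for a commutative ring `A`: the submodules `L ⊆ A³` such that `A³ ⧸ L` is
projective of rank two, i.e. the locally direct summands of `A³` of rank one. -/
abbrev Plane (A : Type u) [CommRing A] : Type u :=
  Module.Grassmannian A (Fin 3 → A) 2

variable {A B : Type u} [CommRing A] [CommRing B]

/-- The extension of scalars of a submodule of `A³` along `f : A → B`: the `B`-submodule of `B³`
generated by its image. -/
def extendScalars (f : A →+* B) (L : Submodule A (Fin 3 → A)) : Submodule B (Fin 3 → B) :=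
  Submodule.span B ((fun v : Fin 3 → A => f ∘ v) '' L)

open TensorProduct in
theorem exists_quotient_equiv [Algebra A B] (L : Submodule A (Fin 3 → A)) :
    Nonempty (((Fin 3 → B) ⧸ extendScalars (algebraMap A B) L) ≃ₗ[B]
      B ⊗[A] ((Fin 3 → A) ⧸ L)) := by
  let e := TensorProduct.piScalarRight A B B (Fin 3)
  have h : (LinearMap.range (AlgebraTensorModule.lTensor B B (L.subtype))).map
      (e : B ⊗[A] (Fin 3 → A) →ₗ[B] (Fin 3 → B)) = extendScalars (algebraMap A B) L := by
    have h1 : LinearMap.range (AlgebraTensorModule.lTensor B B (L.subtype)) = L.baseChange B := by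
      rfl
    rw [h1, Submodule.baseChange_eq_span, Submodule.map_span, extendScalars]
    congr 1
    ext v
    constructor
    · rintro ⟨_, ⟨x, hx, rfl⟩, rfl⟩
      refine ⟨x, hx, ?_⟩
      ext i
      simp [e, Algebra.smul_def]
    · rintro ⟨x, hx, rfl⟩
      refine ⟨1 ⊗ₜ x, ⟨x, hx, rfl⟩, ?_⟩
      ext i
      simp [e, Algebra.smul_def]
  exact ⟨(Submodule.Quotient.equiv _ _ e h).symm ≪≫ₗ
    (AlgebraTensorModule.tensorQuotientEquiv (R := A) B A B L).symm⟩

/-- The map `ℙ²(A) → ℙ²(B)` induced by a ring homomorphism `A → B`. -/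
def Plane.map (f : A →+* B) (L : Plane A) : Plane B :=
  letI : Algebra A B := f.toAlgebra
  { toSubmodule := extendScalars f L.toSubmodule
    finite_quotient :=
      Module.Finite.equiv (exists_quotient_equiv (B := B) L.toSubmodule).some.symm
    projective_quotient :=
      Module.Projective.of_equiv (exists_quotient_equiv (B := B) L.toSubmodule).some.symm
    rankAtStalk_eq := fun p =>
      (congrFun (Module.rankAtStalk_eq_of_equiv
        (exists_quotient_equiv (B := B) L.toSubmodule).some) p).trans
        ((Module.rankAtStalk_baseChange p).trans (L.rankAtStalk_eq _)) }

/-- The ideal generated by all the determinants with rows in `L₁`, `L₂`, `L₃`. It is the ideal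
of the determinant of three points of the projective plane: it vanishes if and only if the
points are collinear, and it is the unit ideal if and only if the points are non-collinear on all
fibres. -/
def detIdeal (L₁ L₂ L₃ : Submodule A (Fin 3 → A)) : Ideal A :=
  Ideal.span {d | ∃ x ∈ L₁, ∃ y ∈ L₂, ∃ z ∈ L₃, d = (Matrix.of ![x, y, z]).det}

theorem detIdeal_extendScalars (f : A →+* B) (L₁ L₂ L₃ : Submodule A (Fin 3 → A)) :
    detIdeal (extendScalars f L₁) (extendScalars f L₂) (extendScalars f L₃) =
      (detIdeal L₁ L₂ L₃).map f := by
  apply le_antisymm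
  · rw [detIdeal, Ideal.span_le]
    rintro _ ⟨x, hx, y, hy, z, hz, rfl⟩
    rw [SetLike.mem_coe]
    induction hx using Submodule.span_induction with
    | zero => simp [Matrix.det_fin_three]
    | add x x' _ _ h h' =>
      convert Ideal.add_mem _ h h' using 1
      simp [Matrix.det_fin_three]; ring
    | smul c x _ h =>
      convert Ideal.mul_mem_left _ c h using 1
      simp [Matrix.det_fin_three]; ring
    | mem x hx =>
    induction hy using Submodule.span_induction with
    | zero => simp [Matrix.det_fin_three]
    | add y y' _ _ h h' =>
      convert Ideal.add_mem _ h h' using 1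
      simp [Matrix.det_fin_three]; ring
    | smul c y _ h =>
      convert Ideal.mul_mem_left _ c h using 1
      simp [Matrix.det_fin_three]; ring
    | mem y hy =>
    induction hz using Submodule.span_induction with
    | zero => simp [Matrix.det_fin_three]
    | add z z' _ _ h h' =>
      convert Ideal.add_mem _ h h' using 1
      simp [Matrix.det_fin_three]; ring
    | smul c z _ h =>
      convert Ideal.mul_mem_left _ c h using 1
      simp [Matrix.det_fin_three]; ring
    | mem z hz =>
    obtain ⟨x, hx, rfl⟩ := hx
    obtain ⟨y, hy, rfl⟩ := hy
    obtain ⟨z, hz, rfl⟩ := hz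
    have : (Matrix.of ![f ∘ x, f ∘ y, f ∘ z]).det = f (Matrix.of ![x, y, z]).det := by
      simp [Matrix.det_fin_three]
    rw [this]
    exact Ideal.mem_map_of_mem f (Ideal.subset_span ⟨x, hx, y, hy, z, hz, rfl⟩)
  · rw [detIdeal, Ideal.map_span, Ideal.span_le]
    rintro _ ⟨_, ⟨x, hx, y, hy, z, hz, rfl⟩, rfl⟩
    refine Ideal.subset_span ⟨f ∘ x, Submodule.subset_span ⟨x, hx, rfl⟩, f ∘ y,
      Submodule.subset_span ⟨y, hy, rfl⟩, f ∘ z, Submodule.subset_span ⟨z, hz, rfl⟩, ?_⟩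
    simp [Matrix.det_fin_three]

end Plane

/-! ### Rank three simple matroids and their realization spaces -/

section Realization

variable {α : Type}

/-- `M` is a simple matroid of rank three whose set of elements is the whole of `α`: there are no
loops and no two elements are parallel. -/
structure IsSimpleRankThree (M : Matroid α) : Prop where
  ground : M.E = Set.univ
  rank : M.eRank = 3
  simple : ∀ a b : α, M.Indep {a, b}

/-- The `A`-valued points of the subscheme of `(ℙ²)^α` cut out by a rank three matroid `M`:
families of points of `ℙ²` indexed by the elements, with the triples which are not bases
(they lie on a common rank two flat) collinear, and with the bases nowhere collinear. -/
structure Realization (M : Matroid α) (A : Type u) [CommRing A] where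
  point : α → Plane A
  collinear : ∀ a b c : α, ¬ M.IsBase {a, b, c} →
    detIdeal (point a).toSubmodule (point b).toSubmodule (point c).toSubmodule = ⊥
  noncollinear : ∀ a b c : α, M.IsBase {a, b, c} →
    detIdeal (point a).toSubmodule (point b).toSubmodule (point c).toSubmodule = ⊤

variable {M : Matroid α} {A B : Type u} [CommRing A] [CommRing B]

/-- The functoriality in `A` of the set of `A`-valued realizations. -/
def Realization.map (f : A →+* B) (x : Realization M A) : Realization M B where
  point a := (x.point a).map f
  collinear a b c h := by
    rw [Plane.map, Plane.map, Plane.map, detIdeal_extendScalars, x.collinear a b c h,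
      Ideal.map_bot]
  noncollinear a b c h := by
    rw [Plane.map, Plane.map, Plane.map, detIdeal_extendScalars, x.noncollinear a b c h,
      Ideal.map_top]

/-- The linear automorphism `g` of `A³` takes the realization `x` to the realization `y`. -/
def Realization.Moves (g : GL (Fin 3) A) (x y : Realization M A) : Prop :=
  ∀ a, (x.point a).toSubmodule.map (Matrix.mulVecLin (g : Matrix (Fin 3) (Fin 3) A)) =
    (y.point a).toSubmodule

/-- Two realizations over `A` are in the same orbit of the group scheme `PGL₃`, Zariski locally on
`Spec A`. (Sections of `PGL₃` are Zariski locally given by invertible matrices.) -/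
def Realization.LocallyEquivalent (x y : Realization M A) : Prop :=
  ∃ s : Set A, Ideal.span s = ⊤ ∧ ∀ f ∈ s, ∃ g : GL (Fin 3) (Localization.Away f),
    Realization.Moves g (x.map (algebraMap A (Localization.Away f)))
      (y.map (algebraMap A (Localization.Away f)))

/-- The group scheme `PGL₃` acts freely on the realizations of `M`: a linear automorphism of `A³`
which fixes a realization is a scalar. -/
def ActsFreely (M : Matroid α) : Prop :=
  ∀ (A : Type u) [CommRing A] (x : Realization M A) (g : GL (Fin 3) A),
    Realization.Moves g x x → ∃ c : A, (g : Matrix (Fin 3) (Fin 3) A) = Matrix.scalar (Fin 3) c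

/-- A presentation of the scheme `X` as the quotient of the scheme of realizations of `M` by
`PGL₃`, i.e. an identification of the functor of points of `X` (on affine schemes) with the
Zariski sheaf quotient of the functor of realizations: a natural map from realizations
to points of `X`, which identifies precisely the realizations that are locally in the same orbit,
and such that every point of `X` locally comes from a realization. -/
structure RealizationQuotient (M : Matroid α) (X : Scheme.{u}) where
  toHom : ∀ (A : Type u) [CommRing A], Realization M A → (Spec (CommRingCat.of A) ⟶ X)
  naturality : ∀ (A B : Type u) [CommRing A] [CommRing B] (f : A →+* B) (x : Realization M A),
    toHom B (x.map f) = Spec.map (CommRingCat.ofHom f) ≫ toHom A x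
  toHom_eq_iff : ∀ (A : Type u) [CommRing A] (x y : Realization M A),
    toHom A x = toHom A y ↔ x.LocallyEquivalent y
  locally_surjective : ∀ (A : Type u) [CommRing A] (φ : Spec (CommRingCat.of A) ⟶ X),
    ∃ s : Set A, Ideal.span s = ⊤ ∧ ∀ f ∈ s, ∃ x : Realization M (Localization.Away f),
      toHom (Localization.Away f) x =
        Spec.map (CommRingCat.ofHom (algebraMap A (Localization.Away f))) ≫ φ

/-- `X` is the realization space of `M`: the action of `PGL₃` on realizations is free, and `X` is
the quotient. -/
def IsRealizationSpace (M : Matroid α) (X : Scheme.{u}) : Prop :=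
  ActsFreely.{u} M ∧ Nonempty (RealizationQuotient M X)

end Realization

/-! ### Elementary monic representations -/

section ElementaryMonic

/-- The three ways of defining a new variable from variables with indices in `ι`. -/
inductive Operation (ι : Type)
  | addition (j k : ι)
  | multiplication (j k : ι)
  | increment (j : ι)

namespace Operation

variable {ι : Type}

/-- The operation only uses variables whose index is less than `i`. -/
def UsesOnlyBelow [LT ι] (i : ι) : Operation ι → Prop
  | addition j k => j < i ∧ k < i
  | multiplication j k => j < i ∧ k < i
  | increment j => j < i

/-- The result of the operation. -/
def result {P : Type} [CommRing P] (x : ι → P) : Operation ι → P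
  | addition j k => x j + x k
  | multiplication j k => x j * x k
  | increment j => x j + 1

def isAddition : Operation ι → Bool
  | addition _ _ => true
  | _ => false

def isMultiplication : Operation ι → Bool
  | multiplication _ _ => true
  | _ => false

def isIncrement : Operation ι → Bool
  | increment _ => true
  | _ => false

end Operation

open Polynomial in
/-- The data of an elementary monic representation, with `n` free variables and `r` operations.
The variables `x₀, …, x_{n + r}` lie in `S[t]` with `S = ℤ[y₁, …, yₙ]`. -/
structure ElementaryMonicRep where
  n : ℕ
  r : ℕ
  x : Fin (n + 1 + r) → (MvPolynomial (Fin n) ℤ)[X]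
  op : Fin r → Operation (Fin (n + 1 + r))
  eqs : Finset (Fin (n + 1 + r) × Fin (n + 1 + r))
  ineqs : Finset (Fin (n + 1 + r) × Fin (n + 1 + r))
  x_zero : x (Fin.castAdd r 0) = X
  x_free : ∀ i : Fin n, x (Fin.castAdd r i.succ) = C (MvPolynomial.X i) + X
  op_below : ∀ k : Fin r, (op k).UsesOnlyBelow (Fin.natAdd (n + 1) k)
  x_op : ∀ k : Fin r, x (Fin.natAdd (n + 1) k) = (op k).result x
  monic : ∀ k : Fin r, (x (Fin.natAdd (n + 1) k)).Monic
  eqs_const : ∀ p ∈ eqs, ∃ c : MvPolynomial (Fin n) ℤ, x p.1 - x p.2 = C c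
  ineqs_const : ∀ p ∈ ineqs, ∃ c : MvPolynomial (Fin n) ℤ, x p.1 - x p.2 = C c

namespace ElementaryMonicRep

variable (D : ElementaryMonicRep)

/-- The number of additions. -/
def a : ℕ := (Finset.univ.filter fun k => (D.op k).isAddition).card

/-- The number of multiplications. -/
def m : ℕ := (Finset.univ.filter fun k => (D.op k).isMultiplication).card

/-- The number of increments. -/
def o : ℕ := (Finset.univ.filter fun k => (D.op k).isIncrement).card

/-- The number of equalities. -/
def e : ℕ := D.eqs.card

/-- The number of inequalities. -/
def i : ℕ := D.ineqs.card

/-- The difference `x_j - x_k`, as an element of `S`. (For pairs which occur in an equality or an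
inequality, `x_j - x_k` is constant in `t`, so it equals its constant coefficient.) -/
noncomputable def diff (p : Fin (D.n + 1 + D.r) × Fin (D.n + 1 + D.r)) :
    MvPolynomial (Fin D.n) ℤ :=
  (D.x p.1 - D.x p.2).coeff 0

/-- The ring `S[(x_j - x_k)⁻¹]`, with `(j, k)` running over the inequalities. -/
abbrev Localized : Type :=
  Localization (Submonoid.closure (D.diff '' (D.ineqs : Set _)))

/-- The ideal generated by `x_j - x_k`, with `(j, k)` running over the equalities. -/
noncomputable def eqsIdeal : Ideal D.Localized :=
  Ideal.span ((fun p => algebraMap (MvPolynomial (Fin D.n) ℤ) D.Localized (D.diff p)) ''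
    (D.eqs : Set _))

/-- The algebra with the elementary monic representation `D`. -/
abbrev algebra : Type := D.Localized ⧸ D.eqsIdeal

end ElementaryMonicRep

end ElementaryMonic

/-- The matroid `M` has as its realization space
an open subscheme `U` of `𝔸^N × Spec R` which projects surjectively onto `Spec R`. -/
def HasOpenRealizationSpace {α : Type} (M : Matroid α) (N : ℕ) (R : Type u) [CommRing R] : Prop :=
  ∃ U : (𝔸(ULift.{u} (Fin N); Spec (CommRingCat.of R))).Opens,
    IsRealizationSpace M (U : Scheme.{u}) ∧
    Surjective (U.ι ≫ (𝔸(ULift.{u} (Fin N); Spec (CommRingCat.of R)) ↘ Spec (CommRingCat.of R)))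

end Mnev

/-!
# Universality of realization spaces of matroids of rank three

A representation of `R` is turned into a program whose lines stand for the variables `x l`, the
equalities and the inequalities. Let `p 0, p 1, p 2, …` be linearly independent vectors. The line
`l` of the program contributes a block of vectors: the marks `p l`, `p l + p 0` and
`p l + x l • p 0`, whose cross ratio with `p 0` is `x l`, and a few auxiliary vectors, which carry
the marks of earlier blocks over by projection from points such as `p l - p j` (`Gadget`, `vec`). The
elements of the matroid are all these vectors, and its bases are the independent triples of their
images under a generic projection to dimension three. A generic projection keeps independent triples
independent (`exists_points_det3_ne_zero`), so the matroid can be computed before the projection,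
where each element involves at most four of the base vectors.

The matroid must not depend on the point of `Spec R` over which the variables are evaluated, i.e.
there must be no accidental dependences. Here the monic variables enter: over each field the `x l`
are monic polynomials in `t` of positive degree, a sum has summands of different degrees, and the two
sides of an inequality have equal degrees. An inspection of the elements in the span of `p 0`, of
`p 0, p j` and of `p 0, p j, p k` (`hit_point`, `hit_line`, `hit_center`) shows that each dependence
of three elements over some field is a consequence of the equations of the program, and holds
identically over all rings (`related_of_dep`). Hence collinearity in the matroid is the relation
`Related`, and it agrees with linear dependence over each field (`related_iff_dep`).

Conversely, each realization arises in this way. The marks of its blocks define vectors `p l` and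
values `x l`, the auxiliary elements are found by intersecting lines, and the collinearities force
the `x l` to satisfy the relations of the program (`IsRealized.exists_vec`). An automorphism of the
plane makes `p 0, p 1, p 2` the coordinate points, which leaves only scalars. The remaining parameters
are `t`, a point of `Spec R`, and three coordinates of each other `p l`, and they are determined by
the realization (`eq_of_mulVec_eq`). They are subject only to the condition that the determinants of
the bases are invertible, which defines an open subscheme of an affine space over `R`; its fibres are
nonempty as none of these determinants vanishes identically on a fibre
(`IsPresentation.hasOpenRealizationSpace`). That such a universal family represents the quotient by
`PGL₃` is a gluing argument (`IsUniversalConfig.isRealizationSpace`).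

If `R` is the zero ring, then the argument has no field to start from. In this case a matroid without
realizations is required, and a non-Pappus configuration with further points in general position is
one (`hasOpenRealizationSpace_of_subsingleton`).

It remains to find a representation of each ring of finite type (`exists_elementaryMonicRep`). The
elements of `ℤ[y₁, …, yₙ]` which are differences of two polynomials obtained from `t` and `yᵢ + t` by
monic operations form a ring, since sums become monic when a power of `t` of high degree is added to
both terms of the difference; so each relation of `R` can be written as an equality.
-/

namespace Mnev

/-! ### Programs and the vectors of their elements -/

/-- The instruction carried by a line of a program. The line `l` of a program `G : ℕ → Gadget`
stands for a variable, or for a relation between variables of earlier lines, and it contributes a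
block of `(G l).size` elements `(l, 0), (l, 1), …` to the matroid of the program. All the blocks but
the first have the marks `p l` and `p l + p 0`, where `p l` is a vector of its own and `p 0` is
common to all the blocks; the block of a variable `x l` also has the mark `p l + x l • p 0`. The
further elements, listed below, force the relation. -/
inductive Gadget
  /-- The point `p 0`, common to the lines of all the other blocks. -/
  | pole
  /-- The variable with the value `1`; its mark coincides with `p l + p 0`. -/
  | frame
  /-- A variable without a condition. -/
  | free
  /-- The sum of the variables `j` and `k`. Further elements: `p l - p j`, `p l - p j + x k • p 0`
  and, in general, `p l - p k`, `p l - p j - p k`. If the block `k` contains `p k - p j`, then in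
  characteristic two, and only there, this would be collinear with `p l` and `p l - p j - p k`; in
  this case the last two elements are replaced by `p l - p j + p k + p 0`,
  `p l - p j + p k + x k • p 0`. -/
  | add (j k : ℕ)
  /-- The product of the variables `j` and `k`. Further elements: `p l - p k`, `p l + x k • p 0`,
  `p l - x k • p j`. -/
  | mul (j k : ℕ)
  /-- The equation between the variables `j` and `k`. Further elements: `p l + x j • p 0`,
  `p l - p j`, `p l - p k`. The equation with the frame, `k = 1`, has the same elements but imposes
  nothing. -/
  | eq (j k : ℕ)
  /-- The condition that the variables `j` and `k` are different. Further elements: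
  `p l + x j • p 0`, `p l - p j`, `p l - p k`, `p l + x k • p 0`. -/
  | ineq (j k : ℕ)

namespace Gadget

/-- The number of elements of the block. -/
def size : Gadget → ℕ
  | pole => 1
  | frame => 2
  | free => 3
  | add _ _ => 7
  | mul _ _ => 6
  | eq _ _ => 5
  | ineq _ _ => 6

/-- The line of the first operand; `0` if there is none. -/
def src₁ : Gadget → ℕ
  | add j _ => j
  | mul j _ => j
  | eq j _ => j
  | ineq j _ => j
  | _ => 0

/-- The line of the second operand; `0` if there is none. -/
def src₂ : Gadget → ℕ
  | add _ k => k
  | mul _ k => k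
  | eq _ k => k
  | ineq _ k => k
  | _ => 0

/-- The block of the gadget, on the line `l`, has `p l - p j` as its element number `3`: the centre
of the perspectivity which takes the marks of the block `j` to those of the block `l`. Equations and
inequalities, whose blocks are not used by later ones, are disregarded. -/
def hasCenter (j : ℕ) : Gadget → Bool
  | add j' _ => j' = j
  | mul _ k' => k' = j
  | _ => false

/-- The gadget is a variable other than the frame. -/
def IsNonconst : Gadget → Prop
  | free => True
  | add _ _ => True
  | mul _ _ => True
  | _ => False

/-- The gadget is a variable, possibly the frame. -/
def IsVal : Gadget → Prop
  | frame => True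
  | g => g.IsNonconst

variable {A : Type*} [CommRing A]

/-- The coefficient of `p (src₁)` in the element number `i` of the block of a gadget, for the values
`x` of the variables. The parameter `lk` tells whether an addition is of the special kind. -/
def coeff₁ (lk : Bool) (x : ℕ → A) : Gadget → ℕ → A
  | add _ _, 3 => -1
  | add _ _, 4 => -1
  | add _ _, 5 => if lk then -1 else 0
  | add _ _, 6 => -1
  | mul _ k, 5 => - x k
  | eq _ _, 3 => -1
  | ineq _ _, 3 => -1
  | _, _ => 0

/-- The coefficient of `p (src₂)` in the element number `i` of the block of a gadget. -/
def coeff₂ (lk : Bool) : Gadget → ℕ → A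
  | add _ _, 5 => if lk then 1 else -1
  | add _ _, 6 => if lk then 1 else -1
  | mul _ _, 3 => -1
  | eq _ _, 4 => -1
  | ineq _ _, 4 => -1
  | _, _ => 0

/-- The coefficient of `p 0` in the element number `i` of the block of a gadget, on the line `l`. -/
def coeff₀ (lk : Bool) (x : ℕ → A) (l : ℕ) : Gadget → ℕ → A
  | pole, _ => 0
  | _, 0 => 0
  | _, 1 => 1
  | free, 2 => x l
  | add _ _, 2 => x l
  | add _ k, 4 => x k
  | add _ _, 5 => if lk then 1 else 0
  | add _ k, 6 => if lk then x k else 0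
  | mul _ _, 2 => x l
  | mul _ k, 4 => x k
  | eq j _, 2 => x j
  | ineq j _, 2 => x j
  | ineq _ k, 5 => x k
  | _, _ => 0

end Gadget

section
open Gadget Polynomial

variable (G : ℕ → Gadget)

/-- The block of the second operand of the line `l` has the centre of the perspectivity from the
block of the first operand. For an addition, this decides which auxiliary elements it has. -/
def linked (l : ℕ) : Bool := (G (G l).src₂).hasCenter (G l).src₁

section Vec
variable {A : Type*} [CommRing A] {V : Type*} [AddCommGroup V] [Module A V]

/-- The vector of the element `e = (l, i)`, number `i` of the block `l`, for the values `x` of the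
variables and the base vectors `p`. -/
def vec (x : ℕ → A) (p : ℕ → V) (e : ℕ × ℕ) : V :=
  p e.1 + (G e.1).coeff₁ (linked G e.1) x e.2 • p (G e.1).src₁
    + ((G e.1).coeff₂ (linked G e.1) e.2 : A) • p (G e.1).src₂
    + (G e.1).coeff₀ (linked G e.1) x e.1 e.2 • p 0

/-- The program starts with the pole and the frame, each line refers to earlier lines only, and the
operands are variables as required by the constructions. -/
structure WellFormed : Prop where
  pole_iff : ∀ l, G l = pole ↔ l = 0
  frame_iff : ∀ l, G l = frame ↔ l = 1
  add : ∀ l j k, G l = add j k → j < l ∧ k < l ∧ j ≠ k ∧ (G j).IsVal ∧ (G k).IsNonconst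
  mul : ∀ l j k, G l = mul j k → j < l ∧ k < l ∧ (G j).IsNonconst ∧ (G k).IsNonconst
  eq : ∀ l j k, G l = eq j k → j < l ∧ k < l ∧ j ≠ k ∧ (G j).IsNonconst ∧ (G k).IsVal
  ineq : ∀ l j k, G l = ineq j k → j < l ∧ k < l ∧ j ≠ k ∧ (G j).IsNonconst ∧ (G k).IsNonconst

/-- The values `x` obey the additions and multiplications of the program. -/
structure Computes (x : ℕ → A) : Prop where
  one : x 1 = 1
  add : ∀ l j k, G l = add j k → x l = x j + x k
  mul : ∀ l j k, G l = mul j k → x l = x j * x k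

/-- The values `x` obey the additions, multiplications and equations of the program; the equations
with the frame do not count. -/
structure SatisfiesEqs (x : ℕ → A) : Prop extends Computes G x where
  eq : ∀ l j k, G l = eq j k → k ≠ 1 → x j = x k

/-- The values are polynomials in `t` over a field which obey the program, and whose degrees exclude
accidental coincidences: variables are monic of positive degree, in a sum the second summand has the
larger degree, and the two sides of an inequality are different of the same degree. -/
structure Admissible {K : Type*} [Field K] (x : ℕ → K[X]) : Prop extends SatisfiesEqs G x where
  monic : ∀ l, (G l).IsNonconst → (x l).Monic
  one_le : ∀ l, (G l).IsNonconst → 1 ≤ (x l).natDegree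
  add_lt : ∀ l j k, G l = Gadget.add j k → (x j).natDegree < (x k).natDegree
  ineq_deg : ∀ l j k, G l = ineq j k → (x j).natDegree = (x k).natDegree
  ineq_ne : ∀ l j k, G l = ineq j k → x j ≠ x k

end Vec

section Coord
variable {D : Type*} [CommRing D]

/-- The Kronecker symbol, with values in `D`. -/
def kron (n m : ℕ) : D := if n = m then 1 else 0

@[simp] lemma kron_self (n : ℕ) : (kron n n : D) = 1 := by simp [kron]
lemma kron_ne {n m : ℕ} (h : n ≠ m) : (kron n m : D) = 0 := by simp [kron, h]
lemma kron_ne' {n m : ℕ} (h : m ≠ n) : (kron n m : D) = 0 := by simp [kron, h.symm]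

/-- The coefficient of `p n` in `vec G x p e`: the coordinates of the element `e` for linearly
independent base vectors. -/
def co (x : ℕ → D) (e : ℕ × ℕ) (n : ℕ) : D :=
  kron n e.1 + (G e.1).coeff₁ (linked G e.1) x e.2 * kron n (G e.1).src₁
    + (G e.1).coeff₂ (linked G e.1) e.2 * kron n (G e.1).src₂
    + (G e.1).coeff₀ (linked G e.1) x e.1 e.2 * kron n 0

/-- The vectors of three elements are linearly dependent, for linearly independent base vectors. -/
def Dep (x : ℕ → D) (e₁ e₂ e₃ : ℕ × ℕ) : Prop :=
  ∃ c₁ c₂ c₃ : D, (c₁ ≠ 0 ∨ c₂ ≠ 0 ∨ c₃ ≠ 0) ∧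
    ∀ n, c₁ * co G x e₁ n + c₂ * co G x e₂ n + c₃ * co G x e₃ n = 0

end Coord

variable {G}

lemma Gadget.IsNonconst.isVal {g : Gadget} (h : g.IsNonconst) : g.IsVal := by
  cases g <;> simp_all [IsVal, IsNonconst]

namespace WellFormed
variable (w : WellFormed G)
include w

lemma src_lt (l : ℕ) (hl : 2 ≤ l) : (G l).src₁ < l ∧ (G l).src₂ < l := by
  rcases h : G l with _ | _ | _ | ⟨j, k⟩ | ⟨j, k⟩ | ⟨j, k⟩ | ⟨j, k⟩ <;> simp only [src₁, src₂]
  · omega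
  · omega
  · omega
  · have := w.add _ _ _ h; tauto
  · have := w.mul _ _ _ h; tauto
  · have := w.eq _ _ _ h; tauto
  · have := w.ineq _ _ _ h; tauto

lemma G_zero : G 0 = pole := (w.pole_iff 0).2 rfl
lemma G_one : G 1 = frame := (w.frame_iff 1).2 rfl

lemma pos_of_isVal {l : ℕ} (h : (G l).IsVal) : 1 ≤ l := by
  by_contra! h'
  obtain rfl : l = 0 := by omega
  rw [w.G_zero] at h
  exact h

lemma two_le_of_isNonconst {l : ℕ} (h : (G l).IsNonconst) : 2 ≤ l := by
  by_contra! h'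
  obtain rfl | rfl : l = 0 ∨ l = 1 := by omega
  · rw [w.G_zero] at h; exact h
  · rw [w.G_one] at h; exact h

variable {D : Type*} [CommRing D]

lemma co_zero (x : ℕ → D) (i n : ℕ) : co G x (0, i) n = kron n 0 := by
  simp [co, w.G_zero, coeff₁, coeff₂, coeff₀]

lemma co_one (x : ℕ → D) (i n : ℕ) (hi : i < 2) :
    co G x (1, i) n = kron n 1 + (if i = 0 then 0 else 1) * kron n 0 := by
  interval_cases i <;> simp [co, w.G_one, coeff₁, coeff₂, coeff₀]

lemma co_self (x : ℕ → D) (l i : ℕ) : co G x (l, i) l = 1 := by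
  rcases l with _ | _ | l
  · simp [w.co_zero]
  · simp [co, w.G_one, coeff₁, coeff₂, src₁, src₂, kron]
  · have := w.src_lt (l + 2) (by omega)
    simp [co, kron_ne' this.1.ne, kron_ne' this.2.ne, kron_ne (show l + 2 ≠ 0 by omega)]

lemma co_above (x : ℕ → D) (l i n : ℕ) (h : l < n) : co G x (l, i) n = 0 := by
  rcases l with _ | _ | l
  · simp [w.co_zero, kron_ne h.ne']
  · simp [co, w.G_one, coeff₁, coeff₂, src₁, src₂, kron_ne h.ne', kron_ne (show n ≠ 0 by omega)]
  · have := w.src_lt (l + 2) (by omega)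
    simp [co, kron_ne' (this.1.trans h).ne, kron_ne' (this.2.trans h).ne, kron_ne h.ne',
      kron_ne (show n ≠ 0 by omega)]

end WellFormed

/-! ### The elements in subspaces spanned by few base vectors -/

lemma ne_zero_of_one_le_natDegree {R : Type*} [Semiring R] {f : R[X]}
    (h : 1 ≤ f.natDegree) : f ≠ 0 := by
  rintro rfl
  simp at h

lemma ne_one_of_one_le_natDegree {R : Type*} [Semiring R] {f : R[X]}
    (h : 1 ≤ f.natDegree) : f ≠ 1 := by
  rintro rfl
  simp at h

section
variable {K : Type*} [Field K] {x : ℕ → K[X]} (w : WellFormed G) (a : Admissible G x)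
include w a

namespace Admissible

lemma val_cases {j : ℕ} (h : (G j).IsVal) : j = 1 ∧ x j = 1 ∨ (G j).IsNonconst := by
  rcases h' : G j with _ | _ | _ | _ | _ | _ | _
  case frame =>
    obtain rfl := (w.frame_iff _).1 h'
    exact Or.inl ⟨rfl, a.one⟩
  all_goals
    rw [h'] at h
    exact Or.inr h

lemma monic_val {j : ℕ} (h : (G j).IsVal) : (x j).Monic := by
  rcases a.val_cases w h with h | h
  · rw [h.2]; exact monic_one
  · exact a.monic _ h

omit w in
lemma natDegree_add {l j k : ℕ} (h : G l = Gadget.add j k) :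
    (x l).natDegree = (x k).natDegree := by
  rw [a.add _ _ _ h, natDegree_add_eq_right_of_natDegree_lt (a.add_lt _ _ _ h)]

lemma natDegree_mul {l j k : ℕ} (h : G l = Gadget.mul j k) :
    (x l).natDegree = (x j).natDegree + (x k).natDegree := by
  rw [a.mul _ _ _ h, (a.monic _ (w.mul _ _ _ h).2.2.1).natDegree_mul
    (a.monic _ (w.mul _ _ _ h).2.2.2)]

omit a in
/-- The only element on the point `p 0` is the pole. -/
lemma hit_point {m i : ℕ} {c γ : K[X]} (hc : c ≠ 0)
    (h : ∀ n, c * co G x (m, i) n = γ * kron n 0) : m = 0 := by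
  by_contra hm
  have := h m
  rw [w.co_self, kron_ne hm] at this
  simp_all

/-- The elements on the line through `p j` and `p 0`, for a variable `j`, are the three marks and,
if `j` is a product, one auxiliary element. -/
lemma hit_line {m i j : ℕ} (hi : i < (G m).size) {c α γ : K[X]} (hα : α ≠ 0) (hj : (G j).IsVal)
    (h : ∀ n, c * co G x (m, i) n = α * kron n j + γ * kron n 0) :
    m = j ∧ (i = 0 ∧ γ = 0 ∨ i = 1 ∧ γ = α ∨ i = 2 ∧ (G j).IsNonconst ∧ γ = α * x j ∨
      i = 4 ∧ (∃ j' k', G j = Gadget.mul j' k' ∧ γ = α * x k')) := by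
  have hj1 := w.pos_of_isVal hj
  have hmj : m = j := by
    by_contra hm
    have h1 := h m
    have h2 := h j
    rw [w.co_self, kron_ne hm] at h1
    rw [kron_self, kron_ne (show j ≠ 0 by omega)] at h2
    by_cases h0 : m = 0
    · subst h0
      rw [w.co_zero, kron_ne (show j ≠ 0 by omega)] at h2
      simp_all
    · rw [kron_ne h0] at h1
      simp_all
  subst hmj
  refine ⟨rfl, ?_⟩
  have hm0 : m ≠ 0 := by omega
  have hcα : c = α := by simpa [w.co_self, kron_ne hm0] using h m
  subst hcα
  have h0 := h 0
  rw [kron_self, kron_ne hm0.symm] at h0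
  rcases hG : G m with _ | _ | _ | ⟨j', k'⟩ | ⟨j', k'⟩ | ⟨j', k'⟩ | ⟨j', k'⟩
  · rw [hG] at hj; exact hj.elim
  · rw [hG] at hi
    change i < 2 at hi
    obtain rfl := (w.frame_iff _).1 hG
    interval_cases i <;> simp_all [co, coeff₀, coeff₁, coeff₂, kron_ne, src₁, src₂]
  · rw [hG] at hi
    change i < 3 at hi
    interval_cases i <;> simp_all [co, coeff₀, coeff₁, coeff₂, src₁, src₂, kron_ne', IsNonconst]
  · rw [hG] at hi
    change i < 7 at hi
    obtain ⟨hj', hk', hjk, vj, vk⟩ := w.add _ _ _ hG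
    have hj0 := (w.pos_of_isVal vj)
    have hk0 := (w.two_le_of_isNonconst vk)
    have e1 := h j'
    have e2 := h k'
    simp only [co, hG, src₁, src₂, kron_self, kron_ne hjk, kron_ne hjk.symm,
      kron_ne (show j' ≠ 0 by omega), kron_ne (show k' ≠ 0 by omega), kron_ne hj'.ne,
      kron_ne hk'.ne, kron_ne' (show j' ≠ 0 by omega),
      kron_ne' (show k' ≠ 0 by omega), kron_ne' (show m ≠ 0 by omega)] at e1 e2 h0
    interval_cases i <;> cases linked G m <;> simp_all [coeff₀, coeff₁, coeff₂, IsNonconst]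
  · rw [hG] at hi
    change i < 6 at hi
    obtain ⟨hj', hk', vj, vk⟩ := w.mul _ _ _ hG
    have hj0 := (w.two_le_of_isNonconst vj)
    have hk0 := (w.two_le_of_isNonconst vk)
    have e1 := h j'
    have e2 := h k'
    have := (a.monic _ vk).ne_zero
    simp only [co, hG, src₁, src₂, kron_self,
      kron_ne (show j' ≠ 0 by omega), kron_ne (show k' ≠ 0 by omega), kron_ne hj'.ne,
      kron_ne hk'.ne, kron_ne' (show j' ≠ 0 by omega),
      kron_ne' (show k' ≠ 0 by omega), kron_ne' (show m ≠ 0 by omega)] at e1 e2 h0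
    interval_cases i <;> simp_all [coeff₀, coeff₁, coeff₂, IsNonconst]
  all_goals (rw [hG] at hj; exact hj.elim)

/-- A point `p j + z • p 0` such that `z` is of positive degree at least that of `x j`, and
different from `x j`, is not an element. -/
lemma hit_line_never {m i j : ℕ} (hi : i < (G m).size) {c α z : K[X]} (hα : α ≠ 0)
    (hj : (G j).IsVal) (hz : 1 ≤ z.natDegree) (hz' : (x j).natDegree ≤ z.natDegree)
    (hz'' : z ≠ x j)
    (h : ∀ n, c * co G x (m, i) n = α * kron n j + α * z * kron n 0) : False := by
  rcases (a.hit_line w hi hα hj h).2 with h | h | h | ⟨-, j', k', hG, h⟩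
  · exact (mul_ne_zero hα (ne_zero_of_one_le_natDegree hz)) h.2
  · exact ne_one_of_one_le_natDegree hz (mul_left_cancel₀ hα (h.2.trans (mul_one α).symm))
  · exact hz'' (mul_left_cancel₀ hα h.2.2)
  · have := mul_left_cancel₀ hα h
    rw [this, a.natDegree_mul w hG] at hz'
    have := a.one_le _ (w.mul _ _ _ hG).2.2.1
    omega

lemma hit_line_zero {m i j : ℕ} (hi : i < (G m).size) {c α : K[X]} (hα : α ≠ 0)
    (hj : (G j).IsVal) (h : ∀ n, c * co G x (m, i) n = α * kron n j) : m = j ∧ i = 0 := by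
  have := a.hit_line w (γ := 0) hi hα hj (by simpa using h)
  refine ⟨this.1, ?_⟩
  rcases this.2 with h | h | h | ⟨-, j', k', hG, h⟩
  · exact h.1
  · exact (hα h.2.symm).elim
  · exact (mul_ne_zero hα (a.monic_val w hj).ne_zero h.2.2.symm).elim
  · exact (mul_ne_zero hα (a.monic _ (w.mul _ _ _ hG).2.2.2).ne_zero h.symm).elim

lemma hit_line_one {m i j : ℕ} (hi : i < (G m).size) {c α : K[X]} (hα : α ≠ 0)
    (hj : (G j).IsVal) (h : ∀ n, c * co G x (m, i) n = α * kron n j + α * kron n 0) :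
    m = j ∧ i = 1 := by
  have := a.hit_line w hi hα hj h
  refine ⟨this.1, ?_⟩
  rcases this.2 with h | h | h | ⟨-, j', k', hG, h⟩
  · exact (hα h.2).elim
  · exact h.1
  · exact (ne_one_of_one_le_natDegree (a.one_le _ h.2.1)
      (mul_left_cancel₀ hα (h.2.2.symm.trans (mul_one α).symm))).elim
  · exact (ne_one_of_one_le_natDegree (a.one_le _ (w.mul _ _ _ hG).2.2.2)
      (mul_left_cancel₀ hα (h.symm.trans (mul_one α).symm))).elim

lemma hit_line_val {m i j : ℕ} (hi : i < (G m).size) {c α : K[X]} (hα : α ≠ 0)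
    (hj : (G j).IsVal) (h : ∀ n, c * co G x (m, i) n = α * kron n j + α * x j * kron n 0) :
    m = j ∧ (i = 1 ∧ j = 1 ∨ i = 2 ∧ (G j).IsNonconst) := by
  have := a.hit_line w hi hα hj h
  refine ⟨this.1, ?_⟩
  rcases this.2 with h | h | h | ⟨-, j', k', hG, h⟩
  · exact (mul_ne_zero hα (a.monic_val w hj).ne_zero h.2).elim
  · rcases a.val_cases w hj with h' | h'
    · exact Or.inl ⟨h.1, h'.1⟩
    · exact (ne_one_of_one_le_natDegree (a.one_le _ h')
        (mul_left_cancel₀ hα (h.2.trans (mul_one α).symm))).elim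
  · exact Or.inr ⟨h.1, h.2.1⟩
  · have := congrArg natDegree (mul_left_cancel₀ hα h)
    rw [a.natDegree_mul w hG] at this
    have := a.one_le _ (w.mul _ _ _ hG).2.2.1
    omega

/-- The element number `i` of the block `k` is `p k + s • p j + e • p 0`. The four clauses are the
elements of this shape for variables `j ≠ k`, with `s ≠ 0`, that come from an addition, with `j` the
first or the second operand, or from a multiplication, with `j` the second or the first. -/
def _root_.Mnev.IsCenter (G : ℕ → Gadget) (x : ℕ → K[X]) (k i j : ℕ) (s e : K[X]) : Prop :=
  (∃ k', G k = Gadget.add j k' ∧ (i = 3 ∧ s = -1 ∧ e = 0 ∨ i = 4 ∧ s = -1 ∧ e = x k')) ∨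
  (∃ j', G k = Gadget.add j' j ∧ linked G k = false ∧ i = 5 ∧ s = -1 ∧ e = 0) ∨
  (∃ j', G k = Gadget.mul j' j ∧ i = 3 ∧ s = -1 ∧ e = 0) ∨
  (∃ k', G k = Gadget.mul j k' ∧ i = 5 ∧ s = - x k' ∧ e = 0)

omit a in
lemma isCenter_of {m i n : ℕ} (hm : (G m).IsVal) (hn : (G n).IsVal) (hi : i < (G m).size)
    (hmn : m ≠ n) {c β γ : K[X]} (hc : c ≠ 0) (hβ : β ≠ 0)
    (h : ∀ r, c * co G x (m, i) r = c * kron r m + β * kron r n + γ * kron r 0) :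
    ∃ s e, IsCenter G x m i n s e ∧ β = c * s ∧ γ = c * e := by
  have hm0 := w.pos_of_isVal hm
  have hn0 := w.pos_of_isVal hn
  have h0 := (h 0).symm
  have hn' := (h n).symm
  rw [kron_self, kron_ne (show 0 ≠ m by omega), kron_ne (show 0 ≠ n by omega)] at h0
  rw [kron_self, kron_ne hmn.symm, kron_ne (show n ≠ 0 by omega)] at hn'
  rcases hG : G m with _ | _ | _ | ⟨j', k'⟩ | ⟨j', k'⟩ | ⟨j', k'⟩ | ⟨j', k'⟩
  · rw [hG] at hm; exact hm.elim
  · simp [co, hG, src₁, src₂, coeff₁, coeff₂, kron_ne hmn.symm,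
      kron_ne (show n ≠ 0 by omega)] at hn'
    exact (hβ hn').elim
  · simp [co, hG, src₁, src₂, coeff₁, coeff₂, kron_ne hmn.symm,
      kron_ne (show n ≠ 0 by omega)] at hn'
    exact (hβ hn').elim
  · rw [hG] at hi
    change i < 7 at hi
    obtain ⟨hj', hk', hjk, vj, vk⟩ := w.add _ _ _ hG
    have hj0 := (w.pos_of_isVal vj)
    have hk0 := (w.two_le_of_isNonconst vk)
    have e1 := (h j').symm
    have e2 := (h k').symm
    simp only [co, hG, src₁, src₂, kron_self, kron_ne hjk, kron_ne hjk.symm, kron_ne hmn.symm,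
      kron_ne (show j' ≠ 0 by omega), kron_ne (show k' ≠ 0 by omega), kron_ne hj'.ne,
      kron_ne hk'.ne, kron_ne' (show j' ≠ 0 by omega),
      kron_ne (show n ≠ 0 by omega),
      kron_ne' (show k' ≠ 0 by omega), kron_ne' (show m ≠ 0 by omega)] at e1 e2 h0 hn'
    by_cases hj : n = j'
    · subst hj
      simp only [kron_self, kron_ne hjk, kron_ne hjk.symm] at e1 e2 h0 hn'
      interval_cases i <;> rcases hl : linked G m <;> simp_all [coeff₀, coeff₁, coeff₂, IsCenter]
    by_cases hk : n = k'
    · subst hk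
      simp only [kron_self, kron_ne hj, kron_ne' hj] at e1 e2 h0 hn'
      interval_cases i <;> rcases hl : linked G m <;> simp_all [coeff₀, coeff₁, coeff₂, IsCenter]
    · simp only [kron_ne hj, kron_ne hk] at hn'
      simp at hn'
      exact (hβ hn').elim
  · rw [hG] at hi
    change i < 6 at hi
    obtain ⟨hj', hk', vj, vk⟩ := w.mul _ _ _ hG
    have hj0 := (w.two_le_of_isNonconst vj)
    have hk0 := (w.two_le_of_isNonconst vk)
    simp only [co, hG, src₁, src₂, kron_self, kron_ne hmn.symm, kron_ne' (show j' ≠ 0 by omega),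
      kron_ne (show n ≠ 0 by omega),
      kron_ne' (show k' ≠ 0 by omega), kron_ne' (show m ≠ 0 by omega)] at h0 hn'
    by_cases hj : n = j'
    · subst hj
      by_cases hk : n = k'
      · subst hk
        simp only [kron_self] at hn'
        interval_cases i <;> simp_all [coeff₀, coeff₁, coeff₂, IsCenter]
      · simp only [kron_self, kron_ne hk] at hn'
        interval_cases i <;> simp_all [coeff₀, coeff₁, coeff₂, IsCenter]
    · by_cases hk : n = k'
      · subst hk
        simp only [kron_self, kron_ne hj] at hn'
        interval_cases i <;> simp_all [coeff₀, coeff₁, coeff₂, IsCenter]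
      · simp only [kron_ne hj, kron_ne hk] at hn'
        simp at hn'
        exact (hβ hn').elim
  all_goals (rw [hG] at hm; exact hm.elim)

omit a in
/-- The elements in the plane spanned by `p j`, `p k`, `p 0` but on none of the lines through `p 0`
and `p j` or `p k`, for different variables `j` and `k`, belong to the block `j` or the block
`k`. -/
lemma hit_center {m i j k : ℕ} (hi : i < (G m).size) {c α β γ : K[X]} (hα : α ≠ 0) (hβ : β ≠ 0)
    (hj : (G j).IsVal) (hk : (G k).IsVal) (hjk : j ≠ k)
    (h : ∀ n, c * co G x (m, i) n = α * kron n j + β * kron n k + γ * kron n 0) :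
    (∃ s e, m = k ∧ IsCenter G x k i j s e ∧ α = β * s ∧ γ = β * e) ∨
    (∃ s e, m = j ∧ IsCenter G x j i k s e ∧ β = α * s ∧ γ = α * e) := by
  have hj1 := w.pos_of_isVal hj
  have hk1 := w.pos_of_isVal hk
  have hm := h m
  have hjj := h j
  rw [w.co_self] at hm
  rw [kron_self, kron_ne hjk, kron_ne (show j ≠ 0 by omega)] at hjj
  have hm0 : m ≠ 0 := by
    rintro rfl
    rw [w.co_zero, kron_ne (show j ≠ 0 by omega)] at hjj
    simp_all
  have hc : c ≠ 0 := by
    rintro rfl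
    rw [zero_mul, mul_zero, mul_zero, add_zero, add_zero, mul_one] at hjj
    exact hα hjj.symm
  by_cases hmk : m = k
  · subst hmk
    have : c = β := by simpa [kron_ne hjk.symm, kron_ne hm0] using hm
    subst this
    obtain ⟨s, e, h1, h2, h3⟩ := isCenter_of w hk hj hi hjk.symm (γ := γ) hc hα
      (fun r => by rw [h]; ring)
    exact Or.inl ⟨s, e, rfl, h1, h2, h3⟩
  by_cases hmj : m = j
  · subst hmj
    have : c = α := by simpa [kron_ne hjk, kron_ne hm0] using hm
    subst this
    obtain ⟨s, e, h1, h2, h3⟩ := isCenter_of w hj hk hi hjk (γ := γ) hc hβ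
      (fun r => by rw [h])
    exact Or.inr ⟨s, e, rfl, h1, h2, h3⟩
  · simp [kron_ne hmk, kron_ne hmj, kron_ne hm0] at hm
    exact (hc hm).elim

end Admissible
end

/-! ### Collinearity relations that hold identically -/

/-- The determinant with rows `u`, `v`, `w`. -/
def det3 {A : Type*} [CommRing A] (u v w : Fin 3 → A) : A := (Matrix.of ![u, v, w]).det

section Det
variable {A : Type*} [CommRing A] (u v w : Fin 3 → A)

lemma det3_eq : det3 u v w = u 0 * (v 1 * w 2 - v 2 * w 1) - u 1 * (v 0 * w 2 - v 2 * w 0)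
    + u 2 * (v 0 * w 1 - v 1 * w 0) := by
  simp [det3, Matrix.det_fin_three]; ring

variable {u v w}

lemma det3_eq_zero_of_sub_eq_smul {s : A} (h : v - u = s • w) : det3 u v w = 0 := by
  obtain rfl : v = u + s • w := by rw [← h]; abel
  simp [det3_eq]; ring

end Det

/-- Three elements are collinear for all the values of the variables which satisfy the equations,
over all rings, and for all base vectors in dimension three. This is the collinearity relation of
the matroid of the program. -/
def Related (G : ℕ → Gadget) (e₁ e₂ e₃ : ℕ × ℕ) : Prop :=
  ∀ (A : Type u) [CommRing A] (x : ℕ → A), SatisfiesEqs G x → ∀ p : ℕ → Fin 3 → A,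
    det3 (vec G x p e₁) (vec G x p e₂) (vec G x p e₃) = 0

lemma related_of {e₁ e₂ e₃ : ℕ × ℕ} (h : ∀ (A : Type u) [CommRing A] (x : ℕ → A),
    SatisfiesEqs G x → ∀ p : ℕ → Fin 3 → A, ∃ s : A,
      vec G x p e₂ - vec G x p e₁ = s • vec G x p e₃) : Related.{u} G e₁ e₂ e₃ :=
  fun A _ x hx p => det3_eq_zero_of_sub_eq_smul (h A x hx p).choose_spec

section VecLemmas
variable {A : Type*} [CommRing A] {V : Type*} [AddCommGroup V] [Module A V] (x : ℕ → A) (p : ℕ → V)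

lemma vec_zero (l : ℕ) : vec G x p (l, 0) = p l := by
  rcases h : G l with _ | _ | _ | _ | _ | _ | _ <;> simp [vec, h, coeff₀, coeff₁, coeff₂]

lemma vec_pole (w : WellFormed G) (i : ℕ) : vec G x p (0, i) = p 0 := by
  simp [vec, w.G_zero, coeff₀, coeff₁, coeff₂]

lemma vec_one (w : WellFormed G) {l : ℕ} (hl : l ≠ 0) : vec G x p (l, 1) = p l + p 0 := by
  rcases h : G l with _ | _ | _ | _ | _ | _ | _
  · exact (hl ((w.pole_iff l).1 h)).elim
  all_goals simp [vec, h, coeff₀, coeff₁, coeff₂]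

lemma vec_two {l : ℕ} (hl : (G l).IsNonconst) : vec G x p (l, 2) = p l + x l • p 0 := by
  rcases h : G l with _ | _ | _ | _ | _ | _ | _ <;> rw [h] at hl <;> try exact hl.elim
  all_goals simp [vec, h, coeff₀, coeff₁, coeff₂]

/-- The centre of the perspectivity between the marks of the blocks `j` and `k`. -/
lemma vec_center {j k : ℕ} (hc : (G k).hasCenter j = true) : vec G x p (k, 3) = p k - p j := by
  rcases h : G k with _ | _ | _ | _ | _ | _ | _ <;> rw [h] at hc <;> simp [hasCenter] at hc
  all_goals subst hc; simp [vec, h, coeff₀, coeff₁, coeff₂, src₁, src₂, sub_eq_add_neg]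

/-- The mark with the value of a variable has number `2`, except on the frame, where it is the mark
number `1`. -/
lemma vec_val (w : WellFormed G) (hx : x 1 = 1) {j i : ℕ}
    (h : i = 1 ∧ j = 1 ∨ i = 2 ∧ (G j).IsNonconst) :
    vec G x p (j, i) = p j + x j • p 0 := by
  rcases h with ⟨rfl, rfl⟩ | ⟨rfl, h⟩
  · rw [vec_one x p w one_ne_zero, hx, one_smul]
  · exact vec_two x p h

end VecLemmas

section
variable {K : Type*} [Field K] {x : ℕ → K[X]} (w : WellFormed G) (a : Admissible G x)
include w a

namespace Admissible

/-- The points `s • p j + p k + γ • p 0` with `s = ±1` which are elements, if the degree of `x j` is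
smaller than that of `x k`: this is only possible if the block `k` has the centre `p k - p j`. -/
lemma hit_center_of_lt {m i j k : ℕ} (hi : i < (G m).size) {c s β γ : K[X]} (hs : s * s = 1)
    (hβ : β ≠ 0) (hj : (G j).IsVal) (hk : (G k).IsVal)
    (hjk : (x j).natDegree < (x k).natDegree)
    (h : ∀ n, c * co G x (m, i) n = s * β * kron n j + β * kron n k + γ * kron n 0) :
    (G k).hasCenter j ∧ m = k ∧ (i = 3 ∧ γ = 0 ∨
      ∃ k', G k = Gadget.add j k' ∧ i = 4 ∧ γ = β * x k') := by
  have hs0 : s ≠ 0 := by rintro rfl; simp at hs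
  have hjk' : j ≠ k := by rintro rfl; simp at hjk
  rcases hit_center w hi (mul_ne_zero hs0 hβ) hβ hj hk hjk' h with
    ⟨s', e, rfl, hc, h1, h2⟩ | ⟨s', e, rfl, hc, h1, h2⟩
  · rw [mul_comm] at h1
    have h1 := mul_left_cancel₀ hβ h1
    subst h1
    rcases hc with ⟨k', hG, h | h⟩ | ⟨j', hG, -⟩ | ⟨j', hG, h⟩ | ⟨k', hG, h⟩
    · simp [hG, hasCenter, h, h2]
    · simp [hG, hasCenter, h, h2]
    · have := a.natDegree_add hG
      omega
    · simp [hG, hasCenter, h, h2]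
    · rw [h.2.1, neg_mul_neg] at hs
      have := congrArg natDegree hs
      have vk := (w.mul _ _ _ hG).2.2.2
      rw [(a.monic _ vk).natDegree_mul (a.monic _ vk), natDegree_one] at this
      have := a.one_le _ vk
      omega
  · rcases hc with ⟨k', hG, -⟩ | ⟨j', hG, -⟩ | ⟨j', hG, h⟩ | ⟨k', hG, h⟩
    · have := a.natDegree_add hG
      have := a.add_lt _ _ _ hG
      omega
    · have := a.natDegree_add hG
      omega
    · have := a.natDegree_mul w hG
      omega
    · have := a.natDegree_mul w hG
      omega

lemma hit_center_never {m i j k : ℕ} (hi : i < (G m).size) {c s β γ : K[X]} (hs : s * s = 1)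
    (hβ : β ≠ 0) (hj : (G j).IsVal) (hk : (G k).IsVal)
    (hjk : (x j).natDegree < (x k).natDegree) (hl : (G k).hasCenter j = false)
    (h : ∀ n, c * co G x (m, i) n = s * β * kron n j + β * kron n k + γ * kron n 0) : False := by
  have := (a.hit_center_of_lt w hi hs hβ hj hk hjk h).1
  simp [hl] at this

/-- If `p k - p j` is proportional to the coordinates of an element, then it is proportional to the
vector of that element for all values of the variables and all base vectors. -/
lemma hit_center_eq {m i j k : ℕ} (hi : i < (G m).size) {c β : K[X]}
    (hβ : β ≠ 0) (hj : (G j).IsVal) (hk : (G k).IsVal) (hjk : j ≠ k)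
    (h : ∀ n, c * co G x (m, i) n = -β * kron n j + β * kron n k) (p q : ℕ)
    (hpq : p = j ∧ q = k ∨ p = k ∧ q = j) (A : Type*) [CommRing A] (x' : ℕ → A)
    (V : Type*) [AddCommGroup V] [Module A V] (p' : ℕ → V) :
    ∃ s : A, p' q - p' p = s • vec G x' p' (m, i) := by
  suffices H : ∀ j k m s e, IsCenter G x k i j s e → m = k → s = -1 → e = 0 →
      vec G x' p' (m, i) = p' k - p' j by
    rcases hit_center (γ := 0) w hi (neg_ne_zero.2 hβ) hβ hj hk hjk (by simpa using h) with
      ⟨s', e, hm, hc, h1, h2⟩ | ⟨s', e, hm, hc, h1, h2⟩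
    · have := H j k m s' e hc hm
        (mul_left_cancel₀ hβ (by rw [← h1]; ring)) (by simpa [hβ] using h2.symm)
      rcases hpq with ⟨rfl, rfl⟩ | ⟨rfl, rfl⟩
      · exact ⟨1, by rw [this]; module⟩
      · exact ⟨-1, by rw [this]; module⟩
    · have := H k j m s' e hc hm
        (mul_left_cancel₀ hβ (by linear_combination h1)) (by simpa [hβ] using h2.symm)
      rcases hpq with ⟨rfl, rfl⟩ | ⟨rfl, rfl⟩
      · exact ⟨-1, by rw [this]; module⟩
      · exact ⟨1, by rw [this]; module⟩
  rintro j k m s e hc rfl rfl rfl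
  rcases hc with ⟨k', hG, h | h⟩ | ⟨j', hG, hl, h⟩ | ⟨j', hG, h⟩ | ⟨k', hG, h⟩
  · rw [h.1]; exact vec_center x' p' (by simp [hG, hasCenter])
  · exact ((a.monic _ (w.add _ _ _ hG).2.2.2.2).ne_zero h.2.2.symm).elim
  · rw [h.1]
    simp [vec, hG, coeff₀, coeff₁, coeff₂, hl, src₁, src₂, sub_eq_add_neg]
  · rw [h.1]; exact vec_center x' p' (by simp [hG, hasCenter])
  · have vk := (w.mul _ _ _ hG).2.2.2
    exact (ne_one_of_one_le_natDegree (a.one_le _ vk) (by simpa using h.2.1.symm)).elim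

end Admissible
end

/-! ### Dependences between a block and an element of another block -/

/-- In characteristic two, the left hand side vanishes. -/
lemma two_mul_ne_one {K : Type*} [Field K] {f : K[X]} (hf : 1 ≤ f.natDegree) : 2 * f ≠ 1 := by
  intro h2
  rw [← map_ofNat C 2] at h2
  by_cases h0 : (2 : K) = 0
  · simp [h0] at h2
  · have := congrArg natDegree h2
    rw [natDegree_C_mul h0, natDegree_one] at this
    omega

section
variable {K : Type*} [Field K] {x : ℕ → K[X]} (w : WellFormed G) (a : Admissible G x)
include w a

omit w a in
lemma co_sub (l i₁ i₂ n : ℕ) (d : K[X]) : d * (co G x (l, i₂) n - co G x (l, i₁) n) =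
    d * ((G l).coeff₁ (linked G l) x i₂ - (G l).coeff₁ (linked G l) x i₁) * kron n (G l).src₁ +
    d * ((G l).coeff₂ (linked G l) i₂ - (G l).coeff₂ (linked G l) i₁) * kron n (G l).src₂ +
    d * ((G l).coeff₀ (linked G l) x l i₂ - (G l).coeff₀ (linked G l) x l i₁) * kron n 0 := by
  simp only [co]; ring

/-- A dependence between two elements of the block of an addition and an element of another block
holds for all values of the variables. The difference of the two elements is a combination of `p j`,
`p k` and `p 0`; for each of the pairs, either the elements proportional to it are known to be so
identically, or there are none, for reasons of degree. -/
lemma related_add {l j k : ℕ} (hG : G l = Gadget.add j k) {i₁ i₂ m i : ℕ} (h₁₂ : i₁ < i₂)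
    (h₂ : i₂ < 7) (hi : i < (G m).size) {c d : K[X]} (hc : c ≠ 0) (hd : d ≠ 0)
    (h : ∀ n, c * co G x (m, i) n = d * (co G x (l, i₂) n - co G x (l, i₁) n)) :
    Related.{u} G (l, i₁) (l, i₂) (m, i) := by
  obtain ⟨hj, hk, hjk, vj, nk⟩ := w.add _ _ _ hG
  have vk := IsNonconst.isVal nk
  have hlt := a.add_lt _ _ _ hG
  have h1k := a.one_le _ nk
  have hxl := a.add _ _ _ hG
  have hdl := a.natDegree_add hG
  have hd1 : (1 - x k).natDegree = (x k).natDegree := by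
    rw [natDegree_sub_eq_right_of_natDegree_lt (by rw [natDegree_one]; omega)]
  have hxj := (a.monic_val w vj).ne_zero
  have hxk := (a.monic_val w vk).ne_zero
  have hd' : -d ≠ 0 := neg_ne_zero.2 hd
  apply related_of
  intro A _ x' hx p
  have hxl' := hx.add _ _ _ hG
  have hv : ∀ i, vec G x' p (l, i) = p l + (coeff₁ (linked G l) x' (Gadget.add j k) i) • p j
    + (coeff₂ (linked G l) (Gadget.add j k) i : A) • p k
    + (coeff₀ (linked G l) x' l (Gadget.add j k) i) • p 0 := by
    intro i; simp [vec, hG, src₁, src₂]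
  have hl : linked G l = (G k).hasCenter j := by simp [linked, hG, src₁, src₂]
  have hkx : ∀ k', G k = Gadget.add j k' → x k = x j + x k' ∧ x k' ≠ 0 ∧ x k' ≠ 1 ∧
      (2 * x k ≠ 1) := by
    intro k' h'
    have nk' := (w.add _ _ _ h').2.2.2.2
    refine ⟨a.add _ _ _ h', (a.monic _ nk').ne_zero,
      ne_one_of_one_le_natDegree (a.one_le _ nk'), two_mul_ne_one h1k⟩
  rw [hv, hv]
  simp only [co_sub, hG, src₁, src₂] at h
  generalize hL : linked G l = L at h
  have hlink := hl.symm.trans hL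
  have point : ∀ γ, (∀ n, c * co G x (m, i) n = γ * kron n 0) → vec G x' p (m, i) = p 0 := by
    intro γ h
    obtain rfl := Admissible.hit_point w hc h
    exact vec_pole x' p w i
  have zero : ∀ {α j}, α ≠ 0 → (G j).IsVal → (∀ n, c * co G x (m, i) n = α * kron n j) →
      vec G x' p (m, i) = p j := by
    intro α j hα hj h
    obtain ⟨rfl, rfl⟩ := a.hit_line_zero w hi hα hj h
    exact vec_zero x' p _
  have one : ∀ {α j}, α ≠ 0 → (G j).IsVal → (∀ n, c * co G x (m, i) n = α * kron n j +
      α * kron n 0) → vec G x' p (m, i) = p j + p 0 := by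
    intro α j hα hj h
    obtain ⟨rfl, rfl⟩ := a.hit_line_one w hi hα hj h
    exact vec_one x' p w (by have := w.pos_of_isVal hj; omega)
  have val : ∀ {α j}, α ≠ 0 → (G j).IsVal → (∀ n, c * co G x (m, i) n = α * kron n j +
      α * x j * kron n 0) → vec G x' p (m, i) = p j + x' j • p 0 := by
    intro α j hα hj h
    obtain ⟨rfl, hh⟩ := a.hit_line_val w hi hα hj h
    exact vec_val x' p w hx.one hh
  interval_cases i₂ <;> interval_cases i₁
  · refine ⟨1, ?_⟩
    rw [point d fun n => by rw [h]; simp [coeff₀, coeff₁, coeff₂]]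
    simp [coeff₀, coeff₁, coeff₂]
  · refine ⟨x' l, ?_⟩
    rw [point (d * x l) fun n => by rw [h]; simp [coeff₀, coeff₁, coeff₂]]
    simp [coeff₀, coeff₁, coeff₂]
  · refine ⟨x' l - 1, ?_⟩
    rw [point (d * (x l - 1)) fun n => by rw [h]; simp [coeff₀, coeff₁, coeff₂]]
    simp [coeff₀, coeff₁, coeff₂]; module
  · refine ⟨-1, ?_⟩
    rw [zero hd' vj fun n => by rw [h]; simp [coeff₀, coeff₁, coeff₂]]
    simp [coeff₀, coeff₁, coeff₂]
  · refine ⟨-1, ?_⟩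
    rw [one hd' vj fun n => by rw [h]; simp [coeff₀, coeff₁, coeff₂]]
    simp [coeff₀, coeff₁, coeff₂]; module
  · exact (a.hit_line_never w hi hd' vj (z := x l) (by omega) (by omega)
      (by rw [hxl]; simpa using hxk) fun n => by
        rw [h]; simp [coeff₀, coeff₁, coeff₂]).elim
  · exact (a.hit_line_never w hi hd' vj (z := - x k) (by simpa) (by simpa using hlt.le)
      (by intro h'; have := congrArg natDegree h'; rw [natDegree_neg] at this; omega) fun n => by
        rw [h]; simp [coeff₀, coeff₁, coeff₂]).elim
  · exact (a.hit_line_never w hi hd' vj (z := 1 - x k) (by omega) (by omega)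
      (by intro h'; have := congrArg natDegree h'; omega) fun n => by
        rw [h]; simp [coeff₀, coeff₁, coeff₂]; ring).elim
  · refine ⟨-1, ?_⟩
    rw [val hd' vj fun n => by rw [h]; simp [coeff₀, coeff₁, coeff₂, hxl]]
    simp [coeff₀, coeff₁, coeff₂, hxl']; module
  · refine ⟨x' k, ?_⟩
    rw [point (d * x k) fun n => by rw [h]; simp [coeff₀, coeff₁, coeff₂]]
    simp [coeff₀, coeff₁, coeff₂]
  -- In the remaining pairs one of the elements has number `5` or `6`, which depends on the kind of
  -- the addition. The ordinary additions are treated here, and rotated to the front one by one.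
  all_goals cases L
  · refine ⟨-1, ?_⟩
    rw [zero hd' vk fun n => by rw [h]; simp [coeff₀, coeff₁, coeff₂]]
    simp [coeff₀, coeff₁, coeff₂]
  rotate_left
  · refine ⟨-1, ?_⟩
    rw [one hd' vk fun n => by rw [h]; simp [coeff₀, coeff₁, coeff₂]]
    simp [coeff₀, coeff₁, coeff₂]; module
  rotate_left
  · exact (a.hit_line_never w hi hd' vk (z := x l) (by omega) (by omega)
      (by rw [hxl]; simpa using hxj) fun n => by
        rw [h]; simp [coeff₀, coeff₁, coeff₂]).elim
  rotate_left
  · exact (a.hit_center_never w hi (s := -1) (γ := 0) (by ring) hd' vj vk hlt hlink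
      fun n => by
        rw [h]; simp [coeff₀, coeff₁, coeff₂]).elim
  rotate_left
  · exact (a.hit_center_never w hi (s := -1) (γ := -d * x k) (by ring) hd' vj vk hlt hlink
      fun n => by
        rw [h]; simp [coeff₀, coeff₁, coeff₂]).elim
  rotate_left
  · exact (a.hit_center_never w hi (s := 1) (γ := 0) (by ring) hd' vj vk hlt hlink
      fun n => by
        rw [h]; simp [coeff₀, coeff₁, coeff₂]).elim
  rotate_left
  · exact (a.hit_center_never w hi (s := 1) (γ := -d) (by ring) hd' vj vk hlt hlink
      fun n => by
        rw [h]; simp [coeff₀, coeff₁, coeff₂]).elim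
  rotate_left
  · exact (a.hit_center_never w hi (s := 1) (γ := -d * x l) (by ring) hd' vj vk hlt hlink
      fun n => by
        rw [h]; simp [coeff₀, coeff₁, coeff₂]).elim
  rotate_left
  · refine ⟨-1, ?_⟩
    rw [zero hd' vk fun n => by rw [h]; simp [coeff₀, coeff₁, coeff₂]]
    simp [coeff₀, coeff₁, coeff₂]
  rotate_left
  · refine ⟨-1, ?_⟩
    rw [val hd' vk fun n => by rw [h]; simp [coeff₀, coeff₁, coeff₂]]
    simp [coeff₀, coeff₁, coeff₂]; module
  rotate_left
  · refine ⟨-1, ?_⟩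
    rw [zero hd' vj fun n => by rw [h]; simp [coeff₀, coeff₁, coeff₂]]
    simp [coeff₀, coeff₁, coeff₂]
  rotate_left
  -- The special additions: the differences may be proportional to elements of the block `k`.
  all_goals
    have cen : ∀ γ, (∀ n, c * co G x (m, i) n = -1 * d * kron n j + d * kron n k + γ * kron n 0) →
        m = k ∧ (i = 3 ∧ γ = 0 ∨ ∃ k', G k = Gadget.add j k' ∧ i = 4 ∧ γ = d * x k') :=
      fun γ h => (a.hit_center_of_lt w hi (s := -1) (by ring) hd vj vk hlt h).2
    have never : ∀ z, (∀ n, c * co G x (m, i) n = -1 * d * kron n j + d * kron n k +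
        d * z * kron n 0) → z ≠ 0 → (∀ k', G k = Gadget.add j k' → z ≠ x k') → False := by
      intro z h hz hz'
      obtain ⟨-, ⟨-, h⟩ | ⟨k', h1, -, h2⟩⟩ := cen _ h
      · exact (mul_ne_zero hd hz) h
      · exact hz' k' h1 (mul_left_cancel₀ hd h2)
    have hx1 : x k ≠ 1 := ne_one_of_one_le_natDegree h1k
  · refine (never 1 (fun n => ?_) one_ne_zero fun k' h' => (hkx k' h').2.2.1.symm).elim
    rw [h]; simp [coeff₀, coeff₁, coeff₂]
  · obtain ⟨rfl, ⟨rfl, -⟩ | ⟨k', h1, -, h2⟩⟩ := cen 0 fun n => by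
      rw [h]; simp [coeff₀, coeff₁, coeff₂]
    · exact ⟨1, by rw [vec_center x' p hlink]; simp [coeff₀, coeff₁, coeff₂]; module⟩
    · exact (mul_ne_zero hd (hkx k' h1).2.1 h2.symm).elim
  · refine (never (1 - x l) (fun n => ?_) (sub_ne_zero.2 ?_) fun k' h' => ?_).elim
    · rw [h]; simp [coeff₀, coeff₁, coeff₂]
    · exact (ne_one_of_one_le_natDegree (by omega)).symm
    · intro e
      apply (hkx k' h').2.2.2
      linear_combination (hkx k' h').1 - e - hxl
  · refine ⟨1, ?_⟩
    rw [one hd vk fun n => by rw [h]; simp [coeff₀, coeff₁, coeff₂]]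
    simp [coeff₀, coeff₁, coeff₂]; module
  · exact (a.hit_line_never w hi hd vk (z := 1 - x k) (by omega) (by omega)
      (by intro e; exact two_mul_ne_one h1k (by linear_combination -e)) fun n => by
        rw [h]; simp [coeff₀, coeff₁, coeff₂]).elim
  · refine (never (x k) (fun n => ?_) hxk fun k' h' => ?_).elim
    · rw [h]; simp [coeff₀, coeff₁, coeff₂]
    · rw [(hkx k' h').1]; simpa using hxj
  · by_cases h0 : x j = 1
    · obtain ⟨rfl, ⟨rfl, h2⟩ | ⟨k', h1, rfl, h2⟩⟩ := cen (d * (x k - 1)) fun n => by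
        rw [h]; simp [coeff₀, coeff₁, coeff₂]
      · exact (mul_ne_zero hd (sub_ne_zero.2 hx1) h2).elim
      · have hj1 : j = 1 := by
          rcases a.val_cases w vj with h' | h'
          · exact h'.1
          · exact (ne_one_of_one_le_natDegree (a.one_le _ h') h0).elim
        subst hj1
        refine ⟨1, ?_⟩
        simp [coeff₀, coeff₁, coeff₂, vec, h1, src₁, src₂, hx.add _ _ _ h1, hx.one]
        module
    · refine (never (x k - 1) (fun n => ?_) (sub_ne_zero.2 hx1) fun k' h' => ?_).elim
      · rw [h]; simp [coeff₀, coeff₁, coeff₂]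
      · intro e
        apply h0
        linear_combination e - (hkx k' h').1
  · refine (never (-x j) (fun n => ?_) (neg_ne_zero.2 hxj) fun k' h' => ?_).elim
    · rw [h]; simp [coeff₀, coeff₁, coeff₂, hxl]
    · intro e
      apply hxk
      linear_combination (hkx k' h').1 - e
  · refine ⟨1, ?_⟩
    rw [val hd vk fun n => by rw [h]; simp [coeff₀, coeff₁, coeff₂]]
    simp [coeff₀, coeff₁, coeff₂]; module
  · refine ⟨1, ?_⟩
    rw [zero hd vk fun n => by rw [h]; simp [coeff₀, coeff₁, coeff₂]]
    simp [coeff₀, coeff₁, coeff₂]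
  · refine ⟨x' k - 1, ?_⟩
    rw [point (d * (x k - 1)) fun n => by rw [h]; simp [coeff₀, coeff₁, coeff₂]]
    simp [coeff₀, coeff₁, coeff₂]; module

/-- A dependence between two elements of the block of a multiplication and an element of another
block holds for all values of the variables. -/
lemma related_mul {l j k : ℕ} (hG : G l = Gadget.mul j k) {i₁ i₂ m i : ℕ} (h₁₂ : i₁ < i₂)
    (h₂ : i₂ < 6) (hi : i < (G m).size) {c d : K[X]} (hc : c ≠ 0) (hd : d ≠ 0)
    (h : ∀ n, c * co G x (m, i) n = d * (co G x (l, i₂) n - co G x (l, i₁) n)) :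
    Related.{u} G (l, i₁) (l, i₂) (m, i) := by
  obtain ⟨hj, hk, nj, nk⟩ := w.mul _ _ _ hG
  have vj := IsNonconst.isVal nj
  have vk := IsNonconst.isVal nk
  have h1j := a.one_le _ nj
  have h1k := a.one_le _ nk
  have hxl := a.mul _ _ _ hG
  have hdl := a.natDegree_mul w hG
  have hxj := (a.monic_val w vj).ne_zero
  have hxk := (a.monic_val w vk).ne_zero
  have hdk : -d * x k ≠ 0 := mul_ne_zero (neg_ne_zero.2 hd) hxk
  have hd' : -d ≠ 0 := neg_ne_zero.2 hd
  apply related_of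
  intro A _ x' hx p
  have hv : ∀ i, vec G x' p (l, i) = p l + (coeff₁ (linked G l) x' (Gadget.mul j k) i) • p j
    + (coeff₂ (linked G l) (Gadget.mul j k) i : A) • p k
    + (coeff₀ (linked G l) x' l (Gadget.mul j k) i) • p 0 := by
    intro i; simp [vec, hG, src₁, src₂]
  rw [hv, hv]
  simp only [co_sub, hG, src₁, src₂] at h
  have point : ∀ γ, (∀ n, c * co G x (m, i) n = γ * kron n 0) → vec G x' p (m, i) = p 0 := by
    intro γ h
    obtain rfl := Admissible.hit_point w hc h
    exact vec_pole x' p w i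
  have zero : ∀ {α j}, α ≠ 0 → (G j).IsVal → (∀ n, c * co G x (m, i) n = α * kron n j) →
      vec G x' p (m, i) = p j := by
    intro α j hα hj h
    obtain ⟨rfl, rfl⟩ := a.hit_line_zero w hi hα hj h
    exact vec_zero x' p _
  have one : ∀ {α j}, α ≠ 0 → (G j).IsVal → (∀ n, c * co G x (m, i) n = α * kron n j +
      α * kron n 0) → vec G x' p (m, i) = p j + p 0 := by
    intro α j hα hj h
    obtain ⟨rfl, rfl⟩ := a.hit_line_one w hi hα hj h
    exact vec_one x' p w (by have := w.pos_of_isVal hj; omega)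
  have val : ∀ {α j}, α ≠ 0 → (G j).IsVal → (∀ n, c * co G x (m, i) n = α * kron n j +
      α * x j * kron n 0) → vec G x' p (m, i) = p j + x' j • p 0 := by
    intro α j hα hj h
    obtain ⟨rfl, hh⟩ := a.hit_line_val w hi hα hj h
    exact vec_val x' p w hx.one hh
  interval_cases i₂ <;> interval_cases i₁
  · refine ⟨1, ?_⟩
    rw [point d fun n => by rw [h]; simp [coeff₀, coeff₁, coeff₂]]
    simp [coeff₀, coeff₁, coeff₂]
  · refine ⟨x' l, ?_⟩
    rw [point (d * (x l)) fun n => by rw [h]; simp [coeff₀, coeff₁, coeff₂]]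
    simp [coeff₀, coeff₁, coeff₂]
  · refine ⟨x' l - 1, ?_⟩
    rw [point (d * (x l - 1)) fun n => by rw [h]; simp [coeff₀, coeff₁, coeff₂]]
    simp [coeff₀, coeff₁, coeff₂]; module
  · refine ⟨-1, ?_⟩
    rw [zero hd' vk fun n => by rw [h]; simp [coeff₀, coeff₁, coeff₂]]
    simp [coeff₀, coeff₁, coeff₂]
  · refine ⟨-1, ?_⟩
    rw [one hd' vk fun n => by rw [h]; simp [coeff₀, coeff₁, coeff₂]]
    simp [coeff₀, coeff₁, coeff₂]; module
  · exact (a.hit_line_never w hi hd' vk (z := x l) (by omega) (by omega)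
      (by intro e; have := congrArg natDegree e; omega) fun n => by
        rw [h]; simp [coeff₀, coeff₁, coeff₂]).elim
  · refine ⟨x' k, ?_⟩
    rw [point (d * (x k)) fun n => by rw [h]; simp [coeff₀, coeff₁, coeff₂]]
    simp [coeff₀, coeff₁, coeff₂]
  · refine ⟨x' k - 1, ?_⟩
    rw [point (d * (x k - 1)) fun n => by rw [h]; simp [coeff₀, coeff₁, coeff₂]]
    simp [coeff₀, coeff₁, coeff₂]; module
  · refine ⟨x' k - x' l, ?_⟩
    rw [point (d * (x k - x l)) fun n => by rw [h]; simp [coeff₀, coeff₁, coeff₂]]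
    simp [coeff₀, coeff₁, coeff₂]; module
  · refine ⟨1, ?_⟩
    rw [val hd vk fun n => by rw [h]; simp [coeff₀, coeff₁, coeff₂]]
    simp [coeff₀, coeff₁, coeff₂]; module
  · refine ⟨-x' k, ?_⟩
    rw [zero hdk vj fun n => by rw [h]; simp [coeff₀, coeff₁, coeff₂]]
    simp [coeff₀, coeff₁, coeff₂]
  · exfalso
    rcases (a.hit_line w (α := -d * x k) (γ := -d) hi hdk vj fun n => by
      rw [h]; simp [coeff₀, coeff₁, coeff₂]).2 with e | e | ⟨-, -, e⟩ | ⟨-, j', k', hG', e⟩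
    · exact hd' e.2
    · exact ne_one_of_one_le_natDegree h1k
        (mul_left_cancel₀ hd' (e.2.symm.trans (mul_one _).symm))
    · rw [mul_assoc] at e
      have := congrArg natDegree (mul_left_cancel₀ hd' (e.symm.trans (mul_one _).symm))
      rw [natDegree_mul hxk hxj, natDegree_one] at this
      omega
    · rw [mul_assoc] at e
      have := congrArg natDegree (mul_left_cancel₀ hd' (e.symm.trans (mul_one _).symm))
      rw [natDegree_mul hxk (a.monic _ (w.mul _ _ _ hG').2.2.2).ne_zero, natDegree_one] at this
      omega
  · refine ⟨-x' k, ?_⟩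
    rw [val hdk vj fun n => by rw [h]; simp [coeff₀, coeff₁, coeff₂, hxl, mul_comm, mul_left_comm]]
    simp [coeff₀, coeff₁, coeff₂, hx.mul _ _ _ hG]; module
  · by_cases hjk : j = k
    · subst hjk
      refine ⟨1 - x' j, ?_⟩
      rw [zero (α := d * (1 - x j)) (mul_ne_zero hd (sub_ne_zero.2
        (ne_one_of_one_le_natDegree h1k).symm)) vj fun n => by
          rw [h]; simp [coeff₀, coeff₁, coeff₂]; ring]
      simp [coeff₀, coeff₁, coeff₂]; module
    · exfalso
      rcases Admissible.hit_center w (α := -d * x k) (β := d) (γ := 0) hi hdk hd vj vk hjk fun n => by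
        rw [h]; simp [coeff₀, coeff₁, coeff₂] with ⟨s, e, -, hc, h1, -⟩ | ⟨s, e, -, hc, h1, -⟩
      · have h1 : x k = -s := mul_left_cancel₀ hd (by linear_combination -h1)
        rcases hc with ⟨k', hG', h | h⟩ | ⟨j', hG', -, h⟩ | ⟨j', hG', h⟩ | ⟨k', hG', h⟩
        · exact ne_one_of_one_le_natDegree h1k (by rw [h1, h.2.1, neg_neg])
        · exact ne_one_of_one_le_natDegree h1k (by rw [h1, h.2.1, neg_neg])
        · exact ne_one_of_one_le_natDegree h1k (by rw [h1, h.2.1, neg_neg])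
        · exact ne_one_of_one_le_natDegree h1k (by rw [h1, h.2.1, neg_neg])
        · rw [h.2.1, neg_neg] at h1
          have := a.natDegree_mul w hG'
          rw [h1] at this
          omega
      · have h1 : 1 = x k * -s := mul_left_cancel₀ hd (by linear_combination h1)
        have h2 : s ≠ 0 := by rintro rfl; simp at h1
        have := congrArg natDegree h1
        rw [natDegree_one, natDegree_mul hxk (neg_ne_zero.2 h2)] at this
        omega
  · refine ⟨-x' k, ?_⟩
    rw [one hdk vj fun n => by rw [h]; simp [coeff₀, coeff₁, coeff₂]]
    simp [coeff₀, coeff₁, coeff₂]; module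

/-- A dependence between two elements of the block of an equation and an element of another block
holds for all values of the variables which satisfy the equations. -/
lemma related_eq {l j k : ℕ} (hG : G l = Gadget.eq j k) {i₁ i₂ m i : ℕ} (h₁₂ : i₁ < i₂)
    (h₂ : i₂ < 5) (hi : i < (G m).size) {c d : K[X]} (hc : c ≠ 0) (hd : d ≠ 0)
    (h : ∀ n, c * co G x (m, i) n = d * (co G x (l, i₂) n - co G x (l, i₁) n)) :
    Related.{u} G (l, i₁) (l, i₂) (m, i) := by
  obtain ⟨hj, hk, hjk, nj, vk⟩ := w.eq _ _ _ hG
  have vj := IsNonconst.isVal nj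
  have h1j := a.one_le _ nj
  have hd' : -d ≠ 0 := neg_ne_zero.2 hd
  apply related_of
  intro A _ x' hx p
  have hv : ∀ i, vec G x' p (l, i) = p l + (coeff₁ (linked G l) x' (Gadget.eq j k) i) • p j
    + (coeff₂ (linked G l) (Gadget.eq j k) i : A) • p k
    + (coeff₀ (linked G l) x' l (Gadget.eq j k) i) • p 0 := by
    intro i; simp [vec, hG, src₁, src₂]
  rw [hv, hv]
  simp only [co_sub, hG, src₁, src₂] at h
  have point : ∀ γ, (∀ n, c * co G x (m, i) n = γ * kron n 0) → vec G x' p (m, i) = p 0 := by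
    intro γ h
    obtain rfl := Admissible.hit_point w hc h
    exact vec_pole x' p w i
  have zero : ∀ {α j}, α ≠ 0 → (G j).IsVal → (∀ n, c * co G x (m, i) n = α * kron n j) →
      vec G x' p (m, i) = p j := by
    intro α j hα hj h
    obtain ⟨rfl, rfl⟩ := a.hit_line_zero w hi hα hj h
    exact vec_zero x' p _
  have one : ∀ {α j}, α ≠ 0 → (G j).IsVal → (∀ n, c * co G x (m, i) n = α * kron n j +
      α * kron n 0) → vec G x' p (m, i) = p j + p 0 := by
    intro α j hα hj h
    obtain ⟨rfl, rfl⟩ := a.hit_line_one w hi hα hj h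
    exact vec_one x' p w (by have := w.pos_of_isVal hj; omega)
  have val : ∀ {α j}, α ≠ 0 → (G j).IsVal → (∀ n, c * co G x (m, i) n = α * kron n j +
      α * x j * kron n 0) → vec G x' p (m, i) = p j + x' j • p 0 := by
    intro α j hα hj h
    obtain ⟨rfl, hh⟩ := a.hit_line_val w hi hα hj h
    exact vec_val x' p w hx.one hh
  interval_cases i₂ <;> interval_cases i₁
  · refine ⟨1, ?_⟩
    rw [point d fun n => by rw [h]; simp [coeff₀, coeff₁, coeff₂]]
    simp [coeff₀, coeff₁, coeff₂]
  · refine ⟨x' j, ?_⟩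
    rw [point (d * (x j)) fun n => by rw [h]; simp [coeff₀, coeff₁, coeff₂]]
    simp [coeff₀, coeff₁, coeff₂]
  · refine ⟨x' j - 1, ?_⟩
    rw [point (d * (x j - 1)) fun n => by rw [h]; simp [coeff₀, coeff₁, coeff₂]]
    simp [coeff₀, coeff₁, coeff₂]; module
  · refine ⟨-1, ?_⟩
    rw [zero hd' vj fun n => by rw [h]; simp [coeff₀, coeff₁, coeff₂]]
    simp [coeff₀, coeff₁, coeff₂]
  · refine ⟨-1, ?_⟩
    rw [one hd' vj fun n => by rw [h]; simp [coeff₀, coeff₁, coeff₂]]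
    simp [coeff₀, coeff₁, coeff₂]; module
  · refine ⟨-1, ?_⟩
    rw [val hd' vj fun n => by rw [h]; simp [coeff₀, coeff₁, coeff₂]]
    simp [coeff₀, coeff₁, coeff₂]; module
  · refine ⟨-1, ?_⟩
    rw [zero hd' vk fun n => by rw [h]; simp [coeff₀, coeff₁, coeff₂]]
    simp [coeff₀, coeff₁, coeff₂]
  · refine ⟨-1, ?_⟩
    rw [one hd' vk fun n => by rw [h]; simp [coeff₀, coeff₁, coeff₂]]
    simp [coeff₀, coeff₁, coeff₂]; module
  · by_cases hk1 : k = 1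
    · subst hk1
      exact (a.hit_line_never w hi hd' vk (z := x j) h1j (by rw [a.one, natDegree_one]; omega)
        (by rw [a.one]; exact ne_one_of_one_le_natDegree h1j) fun n => by
          rw [h]; simp [coeff₀, coeff₁, coeff₂]).elim
    · refine ⟨-1, ?_⟩
      rw [val hd' vk fun n => by rw [h]; simp [coeff₀, coeff₁, coeff₂, a.eq _ _ _ hG hk1]]
      simp [coeff₀, coeff₁, coeff₂, hx.eq _ _ _ hG hk1]; module
  · obtain ⟨s, hs⟩ := a.hit_center_eq w (β := -d) hi hd' vj vk hjk (fun n => by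
      rw [h]; simp [coeff₀, coeff₁, coeff₂]) k j (Or.inr ⟨rfl, rfl⟩) A x' (Fin 3 → A) p
    refine ⟨s, ?_⟩
    rw [← hs]
    simp [coeff₀, coeff₁, coeff₂]; module

/-- A dependence between two elements of the block of an inequality and an element of another block
holds for all values of the variables. Here it matters that the two sides are different of the same
degree: there are no elements `p j + x k • p 0` and `p k + x j • p 0`. -/
lemma related_ineq {l j k : ℕ} (hG : G l = Gadget.ineq j k) {i₁ i₂ m i : ℕ} (h₁₂ : i₁ < i₂)
    (h₂ : i₂ < 6) (hi : i < (G m).size) {c d : K[X]} (hc : c ≠ 0) (hd : d ≠ 0)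
    (h : ∀ n, c * co G x (m, i) n = d * (co G x (l, i₂) n - co G x (l, i₁) n)) :
    Related.{u} G (l, i₁) (l, i₂) (m, i) := by
  obtain ⟨hj, hk, hjk, nj, nk⟩ := w.ineq _ _ _ hG
  have vj := IsNonconst.isVal nj
  have vk := IsNonconst.isVal nk
  have h1j := a.one_le _ nj
  have h1k := a.one_le _ nk
  have hdeg := a.ineq_deg _ _ _ hG
  have hne := a.ineq_ne _ _ _ hG
  have hd' : -d ≠ 0 := neg_ne_zero.2 hd
  apply related_of
  intro A _ x' hx p
  have hv : ∀ i, vec G x' p (l, i) = p l + (coeff₁ (linked G l) x' (Gadget.ineq j k) i) • p j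
    + (coeff₂ (linked G l) (Gadget.ineq j k) i : A) • p k
    + (coeff₀ (linked G l) x' l (Gadget.ineq j k) i) • p 0 := by
    intro i; simp [vec, hG, src₁, src₂]
  rw [hv, hv]
  simp only [co_sub, hG, src₁, src₂] at h
  have point : ∀ γ, (∀ n, c * co G x (m, i) n = γ * kron n 0) → vec G x' p (m, i) = p 0 := by
    intro γ h
    obtain rfl := Admissible.hit_point w hc h
    exact vec_pole x' p w i
  have zero : ∀ {α j}, α ≠ 0 → (G j).IsVal → (∀ n, c * co G x (m, i) n = α * kron n j) →
      vec G x' p (m, i) = p j := by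
    intro α j hα hj h
    obtain ⟨rfl, rfl⟩ := a.hit_line_zero w hi hα hj h
    exact vec_zero x' p _
  have one : ∀ {α j}, α ≠ 0 → (G j).IsVal → (∀ n, c * co G x (m, i) n = α * kron n j +
      α * kron n 0) → vec G x' p (m, i) = p j + p 0 := by
    intro α j hα hj h
    obtain ⟨rfl, rfl⟩ := a.hit_line_one w hi hα hj h
    exact vec_one x' p w (by have := w.pos_of_isVal hj; omega)
  have val : ∀ {α j}, α ≠ 0 → (G j).IsVal → (∀ n, c * co G x (m, i) n = α * kron n j +
      α * x j * kron n 0) → vec G x' p (m, i) = p j + x' j • p 0 := by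
    intro α j hα hj h
    obtain ⟨rfl, hh⟩ := a.hit_line_val w hi hα hj h
    exact vec_val x' p w hx.one hh
  interval_cases i₂ <;> interval_cases i₁
  · refine ⟨1, ?_⟩
    rw [point d fun n => by rw [h]; simp [coeff₀, coeff₁, coeff₂]]
    simp [coeff₀, coeff₁, coeff₂]
  · refine ⟨x' j, ?_⟩
    rw [point (d * (x j)) fun n => by rw [h]; simp [coeff₀, coeff₁, coeff₂]]
    simp [coeff₀, coeff₁, coeff₂]
  · refine ⟨x' j - 1, ?_⟩
    rw [point (d * (x j - 1)) fun n => by rw [h]; simp [coeff₀, coeff₁, coeff₂]]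
    simp [coeff₀, coeff₁, coeff₂]; module
  · refine ⟨-1, ?_⟩
    rw [zero hd' vj fun n => by rw [h]; simp [coeff₀, coeff₁, coeff₂]]
    simp [coeff₀, coeff₁, coeff₂]
  · refine ⟨-1, ?_⟩
    rw [one hd' vj fun n => by rw [h]; simp [coeff₀, coeff₁, coeff₂]]
    simp [coeff₀, coeff₁, coeff₂]; module
  · refine ⟨-1, ?_⟩
    rw [val hd' vj fun n => by rw [h]; simp [coeff₀, coeff₁, coeff₂]]
    simp [coeff₀, coeff₁, coeff₂]; module
  · refine ⟨-1, ?_⟩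
    rw [zero hd' vk fun n => by rw [h]; simp [coeff₀, coeff₁, coeff₂]]
    simp [coeff₀, coeff₁, coeff₂]
  · refine ⟨-1, ?_⟩
    rw [one hd' vk fun n => by rw [h]; simp [coeff₀, coeff₁, coeff₂]]
    simp [coeff₀, coeff₁, coeff₂]; module
  · exact (a.hit_line_never w hi hd' vk (z := x j) h1j hdeg.ge hne fun n => by
      rw [h]; simp [coeff₀, coeff₁, coeff₂]).elim
  · obtain ⟨s, hs⟩ := a.hit_center_eq w (β := -d) hi hd' vj vk hjk (fun n => by
      rw [h]; simp [coeff₀, coeff₁, coeff₂]) k j (Or.inr ⟨rfl, rfl⟩) A x' (Fin 3 → A) p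
    refine ⟨s, ?_⟩
    rw [← hs]
    simp [coeff₀, coeff₁, coeff₂]; module
  · refine ⟨x' k, ?_⟩
    rw [point (d * (x k)) fun n => by rw [h]; simp [coeff₀, coeff₁, coeff₂]]
    simp [coeff₀, coeff₁, coeff₂]
  · refine ⟨x' k - 1, ?_⟩
    rw [point (d * (x k - 1)) fun n => by rw [h]; simp [coeff₀, coeff₁, coeff₂]]
    simp [coeff₀, coeff₁, coeff₂]; module
  · refine ⟨x' k - x' j, ?_⟩
    rw [point (d * (x k - x j)) fun n => by rw [h]; simp [coeff₀, coeff₁, coeff₂]]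
    simp [coeff₀, coeff₁, coeff₂]; module
  · exact (a.hit_line_never w hi hd vj (z := x k) h1k hdeg.le hne.symm fun n => by
      rw [h]; simp [coeff₀, coeff₁, coeff₂]).elim
  · refine ⟨1, ?_⟩
    rw [val hd vk fun n => by rw [h]; simp [coeff₀, coeff₁, coeff₂]]
    simp [coeff₀, coeff₁, coeff₂]; module

end

/-! ### Dependences within a block -/

/-- Three points `(a₁, b₁)`, `(a₂, b₂)`, `(a₃, b₃)` of an affine plane with a nontrivial affine
dependence are collinear. -/
lemma det2_eq_zero {D : Type*} [CommRing D] [IsDomain D] {c₁ c₂ c₃ a₁ a₂ a₃ b₁ b₂ b₃ : D}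
    (hc : c₁ ≠ 0 ∨ c₂ ≠ 0 ∨ c₃ ≠ 0) (h : c₁ + c₂ + c₃ = 0)
    (ha : c₁ * a₁ + c₂ * a₂ + c₃ * a₃ = 0) (hb : c₁ * b₁ + c₂ * b₂ + c₃ * b₃ = 0) :
    (a₂ - a₁) * (b₃ - b₁) = (a₃ - a₁) * (b₂ - b₁) := by
  by_contra hne
  have hne := sub_ne_zero.2 hne
  have h2 : c₂ = 0 := (mul_eq_zero.1 (show c₂ * _ = 0 by
    linear_combination (b₃ - b₁) * (ha - a₁ * h) - (a₃ - a₁) * (hb - b₁ * h))).resolve_right hne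
  have h3 : c₃ = 0 := (mul_eq_zero.1 (show c₃ * _ = 0 by
    linear_combination (a₂ - a₁) * (hb - b₁ * h) - (b₂ - b₁) * (ha - a₁ * h))).resolve_right hne
  simp_all

/-- Three elements on a common line through `Q` are collinear for all values of the variables. -/
lemma related_axis {l i₁ i₂ i₃ : ℕ}
    (h : ∀ (A : Type u) [CommRing A] (x : ℕ → A), ∃ v : ℕ → A, ∀ p : ℕ → Fin 3 → A,
      ∃ P Q : Fin 3 → A,
      vec G x p (l, i₁) = P + v 1 • Q ∧ vec G x p (l, i₂) = P + v 2 • Q ∧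
      vec G x p (l, i₃) = P + v 3 • Q) : Related.{u} G (l, i₁) (l, i₂) (l, i₃) := by
  intro A _ x _ p
  obtain ⟨v, h⟩ := h A x
  obtain ⟨P, Q, h1, h2, h3⟩ := h p
  rw [h1, h2, h3]
  simp [det3_eq]
  ring

namespace Related
variable {e₁ e₂ e₃ : ℕ × ℕ}

lemma rotate (h : Related.{u} G e₁ e₂ e₃) : Related.{u} G e₂ e₃ e₁ := by
  intro A _ x hx p
  rw [← h A x hx p]
  simp only [det3_eq]; ring

lemma swap (h : Related.{u} G e₁ e₂ e₃) : Related.{u} G e₂ e₁ e₃ := by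
  intro A _ x hx p
  rw [← neg_eq_zero, ← h A x hx p]
  simp only [det3_eq]; ring

lemma of_eq (h : e₁ = e₂) : Related.{u} G e₁ e₂ e₃ := by
  intro A _ x hx p
  rw [h]
  simp only [det3_eq]; ring

end Related

namespace Dep
variable {D : Type*} [CommRing D] {x : ℕ → D} {e₁ e₂ e₃ : ℕ × ℕ}

lemma rotate (h : Dep G x e₁ e₂ e₃) : Dep G x e₂ e₃ e₁ := by
  obtain ⟨c₁, c₂, c₃, hc, h⟩ := h
  exact ⟨c₂, c₃, c₁, by tauto, fun n => by rw [← h n]; ring⟩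

lemma swap (h : Dep G x e₁ e₂ e₃) : Dep G x e₂ e₁ e₃ := by
  obtain ⟨c₁, c₂, c₃, hc, h⟩ := h
  exact ⟨c₂, c₁, c₃, by tauto, fun n => by rw [← h n]; ring⟩

end Dep

section
variable {K : Type*} [Field K] {x : ℕ → K[X]} (w : WellFormed G) (a : Admissible G x)
include w a

/-- A dependence between two elements of a block and an element of another block holds for all
values of the variables. -/
lemma related_pair {l i₁ i₂ m i : ℕ} (h₁₂ : i₁ < i₂)
    (h₂ : i₂ < (G l).size) (hi : i < (G m).size) {c d : K[X]} (hc : c ≠ 0) (hd : d ≠ 0)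
    (h : ∀ n, c * co G x (m, i) n = d * (co G x (l, i₂) n - co G x (l, i₁) n)) :
    Related.{u} G (l, i₁) (l, i₂) (m, i) := by
  rcases hG : G l with _ | _ | _ | ⟨j, k⟩ | ⟨j, k⟩ | ⟨j, k⟩ | ⟨j, k⟩ <;> rw [hG] at h₂
  · change i₂ < 1 at h₂; omega
  · change i₂ < 2 at h₂
    obtain rfl : m = 0 := Admissible.hit_point w (γ := d) hc fun n => by
      rw [h, co_sub, hG]
      obtain ⟨rfl, rfl⟩ : i₁ = 0 ∧ i₂ = 1 := by omega
      simp [coeff₀, coeff₁, coeff₂]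
    obtain ⟨rfl, rfl⟩ : i₁ = 0 ∧ i₂ = 1 := by omega
    refine related_of fun A _ x' hx p => ⟨1, ?_⟩
    rw [vec_pole x' p w]
    simp [vec, hG, coeff₀, coeff₁, coeff₂]
  · change i₂ < 3 at h₂
    obtain rfl : m = 0 := Admissible.hit_point w
      (γ := d * (coeff₀ false x l Gadget.free i₂ - coeff₀ false x l Gadget.free i₁)) hc fun n => by
      rw [h, co_sub, hG]
      interval_cases i₂ <;> interval_cases i₁ <;> simp [coeff₀, coeff₁, coeff₂]
    refine related_of fun A _ x' hx p =>
      ⟨coeff₀ false x' l Gadget.free i₂ - coeff₀ false x' l Gadget.free i₁, ?_⟩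
    rw [vec_pole x' p w]
    interval_cases i₂ <;> interval_cases i₁ <;> simp [vec, hG, coeff₀, coeff₁, coeff₂]; module
  · exact related_add w a hG h₁₂ h₂ hi hc hd h
  · exact related_mul w a hG h₁₂ h₂ hi hc hd h
  · exact related_eq w a hG h₁₂ h₂ hi hc hd h
  · exact related_ineq w a hG h₁₂ h₂ hi hc hd h

set_option maxHeartbeats 1000000 in
lemma related_same_add {l j k i₁ i₂ i₃ : ℕ} (hG : G l = Gadget.add j k) (h₁₂ : i₁ < i₂)
    (h₂₃ : i₂ < i₃)
    (h₃ : i₃ < 7) (h : Dep G x (l, i₁) (l, i₂) (l, i₃)) :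
    Related.{u} G (l, i₁) (l, i₂) (l, i₃) := by
  obtain ⟨c₁, c₂, c₃, hc, h⟩ := h
  have hs : c₁ + c₂ + c₃ = 0 := by simpa [w.co_self] using h l
  obtain ⟨hj, hk, hjk, vj, nk⟩ := w.add _ _ _ hG
  have vk := IsNonconst.isVal nk
  have hj0 := w.pos_of_isVal vj
  have hk0 := w.pos_of_isVal vk
  have h1k := a.one_le _ nk
  have hk1 := ne_one_of_one_le_natDegree h1k
  have hxk := ne_zero_of_one_le_natDegree h1k
  have h1l := h1k.trans_eq (a.natDegree_add hG).symm
  have hl1 := ne_one_of_one_le_natDegree h1l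
  have hxl := ne_zero_of_one_le_natDegree h1l
  have ej := h j
  have ek := h k
  have e0 := h 0
  simp only [co, hG, src₁, src₂, kron_self, kron_ne hjk, kron_ne hjk.symm,
    kron_ne (show j ≠ 0 by omega), kron_ne (show k ≠ 0 by omega), kron_ne hj.ne,
    kron_ne hk.ne, kron_ne' (show j ≠ 0 by omega), kron_ne' (show k ≠ 0 by omega),
    kron_ne' (show l ≠ 0 by omega), mul_one, mul_zero, add_zero, zero_add] at ej ek e0
  have d1 := det2_eq_zero hc hs ej ek
  have d2 := det2_eq_zero hc hs ej e0
  have d3 := det2_eq_zero hc hs ek e0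
  clear ej ek e0 h
  interval_cases i₃ <;> interval_cases i₂ <;> interval_cases i₁
  · refine related_axis fun A _ x => ⟨fun i => if i = 1 then 0 else if i = 2 then 1 else x l,
      fun p => ⟨p l, p 0, ?_⟩⟩
    simp [vec, hG, coeff₀, coeff₁, coeff₂]
  all_goals
    exfalso
    clear hc hs h₃ h₂₃ h₁₂ hj0 hk0 h1k h1l
    generalize linked G l = L at d1 d2 d3
    cases L <;>
    simp [coeff₀, coeff₁, coeff₂, sub_eq_zero, @eq_comm K[X] 0, hk1, hxk, hxl, hk1.symm, hl1.symm
      ] at d1 d2 d3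

lemma related_same_mul {l j k i₁ i₂ i₃ : ℕ} (hG : G l = Gadget.mul j k) (h₁₂ : i₁ < i₂)
    (h₂₃ : i₂ < i₃)
    (h₃ : i₃ < 6) (h : Dep G x (l, i₁) (l, i₂) (l, i₃)) :
    Related.{u} G (l, i₁) (l, i₂) (l, i₃) := by
  obtain ⟨c₁, c₂, c₃, hc, h⟩ := h
  have hs : c₁ + c₂ + c₃ = 0 := by simpa [w.co_self] using h l
  obtain ⟨hj, hk, nj, nk⟩ := w.mul _ _ _ hG
  have hj0 := w.pos_of_isVal (IsNonconst.isVal nj)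
  have hk0 := w.pos_of_isVal (IsNonconst.isVal nk)
  have h1k := a.one_le _ nk
  have hk1 := ne_one_of_one_le_natDegree h1k
  have hxk := ne_zero_of_one_le_natDegree h1k
  have hdl := a.natDegree_mul w hG
  have h1j := a.one_le _ nj
  have hl1 : x l ≠ 1 := ne_one_of_one_le_natDegree (by omega)
  have hxl : x l ≠ 0 := ne_zero_of_one_le_natDegree (by omega)
  have hkl : x k ≠ x l := by intro e; rw [e] at hdl; omega
  have axis : ∀ v : ∀ (A : Type u) [CommRing A], (ℕ → A) → ℕ → A,
      (∀ (A : Type u) [CommRing A] (x : ℕ → A) (p : ℕ → Fin 3 → A),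
        vec G x p (l, i₁) = p l + v A x 1 • p 0 ∧ vec G x p (l, i₂) = p l + v A x 2 • p 0 ∧
        vec G x p (l, i₃) = p l + v A x 3 • p 0) → Related.{u} G (l, i₁) (l, i₂) (l, i₃) :=
    fun v hv => related_axis fun A _ x => ⟨v A x, fun p => ⟨p l, p 0, hv A x p⟩⟩
  have e0 := h 0
  have ej := h j
  have ek := h k
  by_cases hjk : j = k
  · subst hjk
    simp only [co, hG, src₁, src₂, kron_self,
      kron_ne (show j ≠ 0 by omega), kron_ne hj.ne, kron_ne' (show j ≠ 0 by omega),
      kron_ne' (show l ≠ 0 by omega), mul_one, mul_zero, add_zero, zero_add] at ej e0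
    have d2 := det2_eq_zero hc hs ej e0
    clear ej ek e0 h
    by_cases h5 : i₁ = 0 ∧ i₂ = 3 ∧ i₃ = 5
    · obtain ⟨rfl, rfl, rfl⟩ := h5
      refine related_axis fun A _ x => ⟨fun i => if i = 1 then 0 else if i = 2 then -1 else -x j,
        fun p => ⟨p l, p j, ?_⟩⟩
      simp [vec, hG, coeff₀, coeff₁, coeff₂, src₁, src₂]
    by_cases h4 : i₃ < 3 ∨ i₃ = 4 ∧ i₂ < 3
    · apply axis fun A _ x i => coeff₀ false x l (Gadget.mul j j)
        (if i = 1 then i₁ else if i = 2 then i₂ else i₃)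
      intro A _ x p
      clear d2
      interval_cases i₃ <;> interval_cases i₂ <;> interval_cases i₁ <;>
        first | omega | simp [vec, hG, coeff₀, coeff₁, coeff₂]
    exfalso
    clear axis
    interval_cases i₃ <;> interval_cases i₂ <;> interval_cases i₁ <;> first | omega |
      simp [coeff₀, coeff₁, coeff₂, sub_eq_zero, @eq_comm K[X] 0, hk1, hxk, hl1, hxl, hk1.symm,
        hl1.symm,
        hkl, hkl.symm, neg_add_eq_zero] at d2
  · simp only [co, hG, src₁, src₂, kron_self, kron_ne hjk, kron_ne' hjk,
      kron_ne (show j ≠ 0 by omega), kron_ne (show k ≠ 0 by omega), kron_ne hj.ne,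
      kron_ne hk.ne, kron_ne' (show j ≠ 0 by omega), kron_ne' (show k ≠ 0 by omega),
      kron_ne' (show l ≠ 0 by omega), mul_one, mul_zero, add_zero, zero_add] at ej ek e0
    have d1 := det2_eq_zero hc hs ej ek
    have d2 := det2_eq_zero hc hs ej e0
    have d3 := det2_eq_zero hc hs ek e0
    clear ej ek e0 h
    by_cases h4 : i₃ < 3 ∨ i₃ = 4 ∧ i₂ < 3
    · apply axis fun A _ x i => coeff₀ false x l (Gadget.mul j k)
        (if i = 1 then i₁ else if i = 2 then i₂ else i₃)
      intro A _ x p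
      clear d1 d2 d3
      interval_cases i₃ <;> interval_cases i₂ <;> interval_cases i₁ <;>
        first | omega | simp [vec, hG, coeff₀, coeff₁, coeff₂]
    exfalso
    clear axis
    interval_cases i₃ <;> interval_cases i₂ <;> interval_cases i₁ <;> first | omega |
      simp [coeff₀, coeff₁, coeff₂, sub_eq_zero, @eq_comm K[X] 0, hk1, hxk, hl1, hxl, hk1.symm,
        hl1.symm,
        hkl, hkl.symm] at d1 d2 d3

lemma related_same_eq {l j k i₁ i₂ i₃ : ℕ} (hG : G l = Gadget.eq j k) (h₁₂ : i₁ < i₂)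
    (h₂₃ : i₂ < i₃)
    (h₃ : i₃ < 5) (h : Dep G x (l, i₁) (l, i₂) (l, i₃)) :
    Related.{u} G (l, i₁) (l, i₂) (l, i₃) := by
  obtain ⟨c₁, c₂, c₃, hc, h⟩ := h
  have hs : c₁ + c₂ + c₃ = 0 := by simpa [w.co_self] using h l
  obtain ⟨hj, hk, hjk, nj, vk⟩ := w.eq _ _ _ hG
  have hj0 := w.pos_of_isVal (IsNonconst.isVal nj)
  have hk0 := w.pos_of_isVal vk
  have h1j := a.one_le _ nj
  have hj1 := ne_one_of_one_le_natDegree h1j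
  have hxj := ne_zero_of_one_le_natDegree h1j
  have ej := h j
  have ek := h k
  have e0 := h 0
  simp only [co, hG, src₁, src₂, kron_self, kron_ne hjk, kron_ne hjk.symm,
    kron_ne (show j ≠ 0 by omega), kron_ne (show k ≠ 0 by omega), kron_ne hj.ne,
    kron_ne hk.ne, kron_ne' (show j ≠ 0 by omega), kron_ne' (show k ≠ 0 by omega),
    kron_ne' (show l ≠ 0 by omega), mul_one, mul_zero, add_zero, zero_add] at ej ek e0
  have d1 := det2_eq_zero hc hs ej ek
  have d2 := det2_eq_zero hc hs ej e0
  have d3 := det2_eq_zero hc hs ek e0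
  clear ej ek e0 h
  interval_cases i₃ <;> interval_cases i₂ <;> interval_cases i₁
  · refine related_axis fun A _ x => ⟨fun i => if i = 1 then 0 else if i = 2 then 1 else x j,
      fun p => ⟨p l, p 0, ?_⟩⟩
    simp [vec, hG, coeff₀, coeff₁, coeff₂]
  all_goals
    exfalso
    simp [coeff₀, coeff₁, coeff₂, sub_eq_zero, @eq_comm K[X] 0, hxj, hj1.symm] at d1 d2 d3

lemma related_same_ineq {l j k i₁ i₂ i₃ : ℕ} (hG : G l = Gadget.ineq j k) (h₁₂ : i₁ < i₂)
    (h₂₃ : i₂ < i₃)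
    (h₃ : i₃ < 6) (h : Dep G x (l, i₁) (l, i₂) (l, i₃)) :
    Related.{u} G (l, i₁) (l, i₂) (l, i₃) := by
  obtain ⟨c₁, c₂, c₃, hc, h⟩ := h
  have hs : c₁ + c₂ + c₃ = 0 := by simpa [w.co_self] using h l
  obtain ⟨hj, hk, hjk, nj, nk⟩ := w.ineq _ _ _ hG
  have hj0 := w.pos_of_isVal (IsNonconst.isVal nj)
  have hk0 := w.pos_of_isVal (IsNonconst.isVal nk)
  have h1j := a.one_le _ nj
  have hj1 := ne_one_of_one_le_natDegree h1j
  have hxj := ne_zero_of_one_le_natDegree h1j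
  have h1k := a.one_le _ nk
  have hk1 := ne_one_of_one_le_natDegree h1k
  have hxk := ne_zero_of_one_le_natDegree h1k
  have hne := a.ineq_ne _ _ _ hG
  have ej := h j
  have ek := h k
  have e0 := h 0
  simp only [co, hG, src₁, src₂, kron_self, kron_ne hjk, kron_ne hjk.symm,
    kron_ne (show j ≠ 0 by omega), kron_ne (show k ≠ 0 by omega), kron_ne hj.ne,
    kron_ne hk.ne, kron_ne' (show j ≠ 0 by omega), kron_ne' (show k ≠ 0 by omega),
    kron_ne' (show l ≠ 0 by omega), mul_one, mul_zero, add_zero, zero_add] at ej ek e0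
  have d1 := det2_eq_zero hc hs ej ek
  have d2 := det2_eq_zero hc hs ej e0
  have d3 := det2_eq_zero hc hs ek e0
  clear ej ek e0 h
  by_cases h4 : i₃ < 3 ∨ i₃ = 5 ∧ i₂ < 3
  · clear d1 d2 d3
    refine related_axis fun A _ x => ⟨fun i => coeff₀ false x l (Gadget.ineq j k)
        (if i = 1 then i₁ else if i = 2 then i₂ else i₃), fun p => ⟨p l, p 0, ?_⟩⟩
    interval_cases i₃ <;> interval_cases i₂ <;> interval_cases i₁ <;>
        first | omega | simp [vec, hG, coeff₀, coeff₁, coeff₂]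
  exfalso
  interval_cases i₃ <;> interval_cases i₂ <;> interval_cases i₁ <;> first | omega |
    simp [coeff₀, coeff₁, coeff₂, sub_eq_zero, @eq_comm K[X] 0, hxj, hj1.symm, hxk, hk1.symm,
      hne] at d1 d2 d3

/-- A dependence between three elements of the same block holds for all values of the variables. -/
lemma related_same {l i₁ i₂ i₃ : ℕ} (h₁₂ : i₁ < i₂) (h₂₃ : i₂ < i₃) (h₃ : i₃ < (G l).size)
    (h : Dep G x (l, i₁) (l, i₂) (l, i₃)) : Related.{u} G (l, i₁) (l, i₂) (l, i₃) := by
  rcases hG : G l with _ | _ | _ | ⟨j, k⟩ | ⟨j, k⟩ | ⟨j, k⟩ | ⟨j, k⟩ <;> rw [hG] at h₃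
  · change i₃ < 1 at h₃; omega
  · change i₃ < 2 at h₃; omega
  · change i₃ < 3 at h₃
    obtain ⟨rfl, rfl, rfl⟩ : i₁ = 0 ∧ i₂ = 1 ∧ i₃ = 2 := by omega
    refine related_axis fun A _ x => ⟨fun i => if i = 1 then 0 else if i = 2 then 1 else x l,
      fun p => ⟨p l, p 0, ?_⟩⟩
    simp [vec, hG, coeff₀, coeff₁, coeff₂]
  · exact related_same_add w a hG h₁₂ h₂₃ h₃ h
  · exact related_same_mul w a hG h₁₂ h₂₃ h₃ h
  · exact related_same_eq w a hG h₁₂ h₂₃ h₃ h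
  · exact related_same_ineq w a hG h₁₂ h₂₃ h₃ h

end

/-! ### Dependences for admissible values hold identically -/

section
variable {K : Type*} [Field K] {x : ℕ → K[X]} (w : WellFormed G) (a : Admissible G x)
include w a

/-- Different elements of a block have different coordinates. -/
lemma co_ne {l i₁ i₂ : ℕ} (h₁₂ : i₁ < i₂) (h₂ : i₂ < (G l).size)
    (h : ∀ n, co G x (l, i₁) n = co G x (l, i₂) n) : False := by
  have h := fun n => (co_sub (x := x) l i₁ i₂ n 1).symm.trans (by rw [h]; ring : _ = (0 : K[X]))
  simp only [one_mul] at h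
  rcases hG : G l with _ | _ | _ | ⟨j, k⟩ | ⟨j, k⟩ | ⟨j, k⟩ | ⟨j, k⟩ <;> rw [hG] at h₂
  · change i₂ < 1 at h₂; omega
  · change i₂ < 2 at h₂
    obtain ⟨rfl, rfl⟩ : i₁ = 0 ∧ i₂ = 1 := by omega
    simpa [hG, coeff₀, coeff₁, coeff₂] using h 0
  · change i₂ < 3 at h₂
    have e0 := h 0
    have h1l := a.one_le l (by rw [hG]; trivial)
    have hl1 := ne_one_of_one_le_natDegree h1l
    have hxl := ne_zero_of_one_le_natDegree h1l
    interval_cases i₂ <;> interval_cases i₁ <;>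
      simp [hG, coeff₀, coeff₁, coeff₂, hxl, hl1, sub_eq_zero] at e0
  · obtain ⟨hj, hk, hjk, vj, nk⟩ := w.add _ _ _ hG
    change i₂ < 7 at h₂
    have hj0 := w.pos_of_isVal vj
    have hk0 := w.pos_of_isVal (IsNonconst.isVal nk)
    have h1k := a.one_le _ nk
    have hk1 := ne_one_of_one_le_natDegree h1k
    have hxk := ne_zero_of_one_le_natDegree h1k
    have h1l := h1k.trans_eq (a.natDegree_add hG).symm
    have hl1 := ne_one_of_one_le_natDegree h1l
    have hxl := ne_zero_of_one_le_natDegree h1l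
    have ej := h j
    have ek := h k
    have e0 := h 0
    simp only [hG, src₁, src₂, kron_self, kron_ne hjk, kron_ne hjk.symm,
      kron_ne (show j ≠ 0 by omega), kron_ne (show k ≠ 0 by omega),
      kron_ne' (show j ≠ 0 by omega), kron_ne' (show k ≠ 0 by omega),
      mul_one, mul_zero, add_zero, zero_add] at ej ek e0
    generalize linked G l = L at ej ek e0
    cases L <;> interval_cases i₂ <;> interval_cases i₁ <;>
      simp [coeff₀, coeff₁, coeff₂, hxk, hk1, hxl, hl1, sub_eq_zero] at ej ek e0
  · obtain ⟨hj, hk, nj, nk⟩ := w.mul _ _ _ hG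
    change i₂ < 6 at h₂
    have hj0 := w.pos_of_isVal (IsNonconst.isVal nj)
    have hk0 := w.pos_of_isVal (IsNonconst.isVal nk)
    have h1k := a.one_le _ nk
    have hk1 := ne_one_of_one_le_natDegree h1k
    have hxk := ne_zero_of_one_le_natDegree h1k
    have hdl := a.natDegree_mul w hG
    have h1j := a.one_le _ nj
    have hl1 : x l ≠ 1 := ne_one_of_one_le_natDegree (by omega)
    have hxl : x l ≠ 0 := ne_zero_of_one_le_natDegree (by omega)
    have hkl : x k ≠ x l := by intro e; rw [e] at hdl; omega
    have ej := h j
    have ek := h k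
    have e0 := h 0
    by_cases hjk : j = k
    · subst hjk
      simp only [hG, src₁, src₂, kron_self, kron_ne (show j ≠ 0 by omega),
        kron_ne' (show j ≠ 0 by omega), mul_one, mul_zero, add_zero, zero_add] at ej e0
      clear ek
      interval_cases i₂ <;> interval_cases i₁ <;>
        simp [coeff₀, coeff₁, coeff₂, hxk, hk1, hxl, hl1, hkl, sub_eq_zero,
          neg_add_eq_zero] at ej e0
    · simp only [hG, src₁, src₂, kron_self, kron_ne hjk, kron_ne' hjk,
        kron_ne (show j ≠ 0 by omega), kron_ne (show k ≠ 0 by omega),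
        kron_ne' (show j ≠ 0 by omega), kron_ne' (show k ≠ 0 by omega),
        mul_one, mul_zero, add_zero, zero_add] at ej ek e0
      interval_cases i₂ <;> interval_cases i₁ <;>
        simp [coeff₀, coeff₁, coeff₂, hxk, hk1, hxl, hl1, hkl, sub_eq_zero] at ej ek e0
  · obtain ⟨hj, hk, hjk, nj, vk⟩ := w.eq _ _ _ hG
    change i₂ < 5 at h₂
    have hj0 := w.pos_of_isVal (IsNonconst.isVal nj)
    have hk0 := w.pos_of_isVal vk
    have h1j := a.one_le _ nj
    have hj1 := ne_one_of_one_le_natDegree h1j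
    have hxj := ne_zero_of_one_le_natDegree h1j
    have ej := h j
    have ek := h k
    have e0 := h 0
    simp only [hG, src₁, src₂, kron_self, kron_ne hjk, kron_ne hjk.symm,
      kron_ne (show j ≠ 0 by omega), kron_ne (show k ≠ 0 by omega),
      kron_ne' (show j ≠ 0 by omega), kron_ne' (show k ≠ 0 by omega),
      mul_one, mul_zero, add_zero, zero_add] at ej ek e0
    interval_cases i₂ <;> interval_cases i₁ <;>
      simp [coeff₀, coeff₁, coeff₂, hxj, hj1, sub_eq_zero] at ej ek e0
  · obtain ⟨hj, hk, hjk, nj, nk⟩ := w.ineq _ _ _ hG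
    change i₂ < 6 at h₂
    have hj0 := w.pos_of_isVal (IsNonconst.isVal nj)
    have hk0 := w.pos_of_isVal (IsNonconst.isVal nk)
    have h1j := a.one_le _ nj
    have hj1 := ne_one_of_one_le_natDegree h1j
    have hxj := ne_zero_of_one_le_natDegree h1j
    have h1k := a.one_le _ nk
    have hk1 := ne_one_of_one_le_natDegree h1k
    have hxk := ne_zero_of_one_le_natDegree h1k
    have hne := a.ineq_ne _ _ _ hG
    have ej := h j
    have ek := h k
    have e0 := h 0
    simp only [hG, src₁, src₂, kron_self, kron_ne hjk, kron_ne hjk.symm,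
      kron_ne (show j ≠ 0 by omega), kron_ne (show k ≠ 0 by omega),
      kron_ne' (show j ≠ 0 by omega), kron_ne' (show k ≠ 0 by omega),
      mul_one, mul_zero, add_zero, zero_add] at ej ek e0
    interval_cases i₂ <;> interval_cases i₁ <;>
      simp [coeff₀, coeff₁, coeff₂, hxj, hj1, hxk, hk1, hne.symm, sub_eq_zero] at ej ek e0

lemma co_injective {l i₁ i₂ : ℕ} (h₁ : i₁ < (G l).size) (h₂ : i₂ < (G l).size)
    (h : ∀ n, co G x (l, i₁) n = co G x (l, i₂) n) : i₁ = i₂ := by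
  rcases lt_trichotomy i₁ i₂ with h' | h' | h'
  · exact (co_ne w a h' h₂ h).elim
  · exact h'
  · exact (co_ne w a h' h₁ fun n => (h n).symm).elim

omit a in
/-- If an element of the block `l` and two elements of earlier blocks are dependent, then these two
coincide: only the first one has a component along `p l`, and different blocks have different
leading base vectors. -/
lemma eq_of_dep_of_lt {l i : ℕ} {e₂ e₃ : ℕ × ℕ} (h₂ : e₂.1 < l) (h₃ : e₃.1 < l)
    (h : Dep G x (l, i) e₂ e₃) :
    e₂.1 = e₃.1 ∧ ∀ n, co G x e₂ n = co G x e₃ n := by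
  obtain ⟨l₂, i₂⟩ := e₂
  obtain ⟨l₃, i₃⟩ := e₃
  obtain ⟨c₁, c₂, c₃, hc, h⟩ := h
  have h1 : c₁ = 0 := by simpa [w.co_self, w.co_above _ _ _ _ h₂, w.co_above _ _ _ _ h₃] using h l
  subst h1
  simp only [zero_mul, zero_add] at h
  have hl : l₂ = l₃ := by
    rcases lt_trichotomy l₂ l₃ with h' | h' | h'
    · have h3 : c₃ = 0 := by simpa [w.co_self, w.co_above _ _ _ _ h'] using h l₃
      subst h3
      have h2 : c₂ = 0 := by simpa [w.co_self] using h l₂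
      simp [h2] at hc
    · exact h'
    · have h2 : c₂ = 0 := by simpa [w.co_self, w.co_above _ _ _ _ h'] using h l₂
      subst h2
      have h3 : c₃ = 0 := by simpa [w.co_self] using h l₃
      simp [h3] at hc
  subst hl
  refine ⟨rfl, fun n => ?_⟩
  have hs : c₂ + c₃ = 0 := by simpa [w.co_self] using h l₂
  have h2 : c₂ ≠ 0 := by
    rintro rfl
    simp_all
  apply mul_left_cancel₀ h2
  linear_combination h n - hs * co G x (l₂, i₃) n

/-- One element lies in a later block than the two others. -/
lemma related_of_dep_of_lt {l i : ℕ} {e₂ e₃ : ℕ × ℕ} (h₂ : e₂.1 < l) (h₃ : e₃.1 < l)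
    (s₂ : e₂.2 < (G e₂.1).size) (s₃ : e₃.2 < (G e₃.1).size)
    (h : Dep G x (l, i) e₂ e₃) : Related.{u} G (l, i) e₂ e₃ := by
  obtain ⟨hl, h⟩ := eq_of_dep_of_lt w h₂ h₃ h
  obtain ⟨l₂, i₂⟩ := e₂
  obtain ⟨l₃, i₃⟩ := e₃
  obtain rfl : l₂ = l₃ := hl
  obtain rfl := co_injective w a s₂ s₃ h
  exact (Related.of_eq rfl).rotate.rotate

/-- Two elements lie in the same block, and the third one in an earlier block. -/
lemma related_of_dep_of_eq {l i₁ i₂ : ℕ} {e₃ : ℕ × ℕ} (h₃ : e₃.1 < l)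
    (s₁ : i₁ < (G l).size) (s₂ : i₂ < (G l).size) (s₃ : e₃.2 < (G e₃.1).size)
    (h : Dep G x (l, i₁) (l, i₂) e₃) : Related.{u} G (l, i₁) (l, i₂) e₃ := by
  by_cases h₁₂ : i₁ = i₂
  · exact Related.of_eq (by rw [h₁₂])
  wlog hlt : i₁ < i₂ generalizing i₁ i₂
  · exact (this s₂ s₁ h.swap (Ne.symm h₁₂) (by omega)).swap
  obtain ⟨c₁, c₂, c₃, hc, h⟩ := h
  obtain ⟨m, i⟩ := e₃
  have hs : c₁ + c₂ = 0 := by simpa [w.co_self, w.co_above _ _ _ _ h₃] using h l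
  have h' : ∀ n, c₃ * co G x (m, i) n = c₁ * (co G x (l, i₂) n - co G x (l, i₁) n) := fun n => by
    linear_combination h n - hs * co G x (l, i₂) n
  have h3 : c₃ ≠ 0 := by
    rintro rfl
    have h1 : c₁ ≠ 0 := by rintro rfl; simp_all
    refine co_ne w a hlt s₂ fun n => ?_
    have := h' n
    rw [zero_mul, zero_eq_mul] at this
    exact (sub_eq_zero.1 (this.resolve_left h1)).symm
  have h1 : c₁ ≠ 0 := by
    rintro rfl
    have := h' m
    rw [w.co_self] at this
    simp_all
  exact related_pair w a hlt s₂ s₃ h3 h1 h'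

lemma related_of_dep_line {l i₁ i₂ i₃ : ℕ} (s₁ : i₁ < (G l).size) (s₂ : i₂ < (G l).size)
    (s₃ : i₃ < (G l).size) (h : Dep G x (l, i₁) (l, i₂) (l, i₃)) :
    Related.{u} G (l, i₁) (l, i₂) (l, i₃) := by
  by_cases h₁₂ : i₁ = i₂
  · exact Related.of_eq (by rw [h₁₂])
  by_cases h₂₃ : i₂ = i₃
  · exact (Related.of_eq (by rw [h₂₃])).rotate.rotate
  by_cases h₁₃ : i₁ = i₃
  · exact (Related.of_eq (by rw [h₁₃])).rotate
  rcases lt_or_gt_of_ne h₁₂ with a1 | a1 <;> rcases lt_or_gt_of_ne h₂₃ with a2 | a2 <;>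
    rcases lt_or_gt_of_ne h₁₃ with a3 | a3
  · exact related_same w a a1 a2 s₃ h
  · omega
  · exact (related_same w a a3 a2 s₂ h.rotate.rotate.swap).swap.rotate
  · exact (related_same w a a3 a1 s₂ h.rotate.rotate).rotate
  · exact (related_same w a a1 a3 s₃ h.swap).swap
  · exact (related_same w a a2 a3 s₁ h.rotate).rotate.rotate
  · omega
  · exact (related_same w a a2 a1 s₁ h.swap.rotate.rotate).rotate.swap

/-- A dependence of three elements for one admissible choice of the values of the variables, over
any field, and linearly independent base vectors, holds for all values of the variables which
satisfy the equations, over all rings, and all base vectors. -/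
theorem related_of_dep {e₁ e₂ e₃ : ℕ × ℕ} (s₁ : e₁.2 < (G e₁.1).size) (s₂ : e₂.2 < (G e₂.1).size)
    (s₃ : e₃.2 < (G e₃.1).size) (h : Dep G x e₁ e₂ e₃) : Related.{u} G e₁ e₂ e₃ := by
  obtain ⟨l₁, i₁⟩ := e₁
  obtain ⟨l₂, i₂⟩ := e₂
  obtain ⟨l₃, i₃⟩ := e₃
  rcases lt_trichotomy l₁ l₂ with h₁₂ | h₁₂ | h₁₂ <;>
    rcases lt_trichotomy l₂ l₃ with h₂₃ | h₂₃ | h₂₃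
  · exact (related_of_dep_of_lt w a (h₁₂.trans h₂₃) h₂₃ s₁ s₂ h.rotate.rotate).rotate
  · subst h₂₃
    exact (related_of_dep_of_eq w a h₁₂ s₂ s₃ s₁ h.rotate).rotate.rotate
  · exact (related_of_dep_of_lt w a h₂₃ h₁₂ s₃ s₁ h.rotate).rotate.rotate
  · subst h₁₂
    exact (related_of_dep_of_lt w a h₂₃ h₂₃ s₁ s₂ h.rotate.rotate).rotate
  · subst h₁₂ h₂₃
    exact related_of_dep_line w a s₁ s₂ s₃ h
  · subst h₁₂
    exact related_of_dep_of_eq w a h₂₃ s₁ s₂ s₃ h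
  · rcases lt_trichotomy l₁ l₃ with h₁₃ | h₁₃ | h₁₃
    · exact (related_of_dep_of_lt w a h₁₃ h₂₃ s₁ s₂ h.rotate.rotate).rotate
    · subst h₁₃
      exact (related_of_dep_of_eq w a h₁₂ s₃ s₁ s₂ h.rotate.rotate).rotate
    · exact related_of_dep_of_lt w a h₁₂ h₁₃ s₂ s₃ h
  · subst h₂₃
    exact related_of_dep_of_lt w a h₁₂ h₁₂ s₂ s₃ h
  · exact related_of_dep_of_lt w a h₁₂ (h₂₃.trans h₁₂) s₂ s₃ h

end

end

/-! ### Matroids of rank three from collinearity relations -/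

/-- The relation is the ternary relation of collinearity of a planar geometry. Degenerate triples
count as collinear, and no line through two points contains all the points. -/
structure IsCollinearity {α : Type} (Col : α → α → α → Prop) : Prop where
  rotate : ∀ a b c, Col a b c → Col b c a
  swap : ∀ a b c, Col a b c → Col b a c
  refl : ∀ a b, Col a a b
  trans : ∀ a b c d, a ≠ b → Col a b c → Col a b d → Col a c d
  exists_not : ∀ a b, a ≠ b → ∃ c, ¬ Col a b c

namespace IsCollinearity
variable {α : Type} [Finite α] {Col : α → α → α → Prop} (h : IsCollinearity Col)
include h

omit [Finite α] in
lemma of_three {a b c d e : α} (hab : a ≠ b) (hc : Col a b c) (hd : Col a b d) (he : Col a b e) :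
    Col c d e := by
  have h1 := h.trans a b c d hab hc hd
  have h2 := h.trans a b c e hab hc he
  by_cases hac : a = c
  · subst hac
    exact h.trans a b d e hab hd he
  · exact h.trans c a d e (Ne.symm hac) (h.swap _ _ _ h1) (h.swap _ _ _ h2)

omit [Finite α] in
lemma refl_left (a b : α) : Col b a a := h.rotate _ _ _ (h.rotate _ _ _ (h.refl a b))

omit [Finite α] in
lemma refl_outer (a b : α) : Col a b a := h.rotate _ _ _ (h.refl a b)

omit [Finite α] in
lemma distinct {a b c : α} (hn : ¬ Col a b c) : a ≠ b ∧ a ≠ c ∧ b ≠ c := by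
  refine ⟨?_, ?_, ?_⟩ <;> rintro rfl
  · exact hn (h.refl _ _)
  · exact hn (h.refl_outer _ _)
  · exact hn (h.refl_left _ _)

omit [Finite α] in
lemma col_of_mem {a b c x y z : α} (ha : a ∈ ({x, y, z} : Set α)) (hb : b ∈ ({x, y, z} : Set α))
    (hc : c ∈ ({x, y, z} : Set α)) (hxyz : Col x y z) : Col a b c := by
  have h1 := h.rotate _ _ _ hxyz
  have h2 := h.rotate _ _ _ h1
  have h3 := h.swap _ _ _ hxyz
  have h4 := h.rotate _ _ _ h3
  have h5 := h.rotate _ _ _ h4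
  rcases ha with rfl | rfl | rfl <;> rcases hb with rfl | rfl | rfl <;>
    rcases hc with rfl | rfl | rfl <;>
    first | assumption | exact h.refl _ _ | exact h.refl_left _ _ | exact h.refl_outer _ _

omit [Finite α] in
lemma ncard_eq_three {a b c : α} (hn : ¬ Col a b c) : ({a, b, c} : Set α).ncard = 3 := by
  obtain ⟨h1, h2, h3⟩ := h.distinct hn
  exact Set.ncard_eq_three.2 ⟨a, b, c, h1, h2, h3, rfl⟩

/-- The simple matroid of rank three with the given relation of collinearity. -/
def matroid : Matroid α :=
  (IndepMatroid.ofFinite (E := Set.univ) Set.finite_univ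
    (fun I => I.ncard ≤ 3 ∧ ∀ a b c, I = {a, b, c} → I.ncard = 3 → ¬ Col a b c)
    (by simp)
    (by
      rintro I J ⟨h1, h2⟩ hIJ
      refine ⟨(Set.ncard_le_ncard hIJ J.toFinite).trans h1, fun a b c hI hI3 => ?_⟩
      obtain rfl : I = J := Set.eq_of_subset_of_ncard_le hIJ (by omega) J.toFinite
      exact h2 a b c hI hI3)
    (by
      rintro I J ⟨h1, h2⟩ ⟨h3, h4⟩ hIJ
      by_cases hI : I.ncard = 2
      · obtain ⟨a, b, hab, rfl⟩ := Set.ncard_eq_two.1 hI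
        obtain ⟨c, d, e, hcd, hce, hde, rfl⟩ := Set.ncard_eq_three.1 (show J.ncard = 3 by omega)
        by_contra hcon
        refine h4 c d e rfl (by omega) ?_
        have key : ∀ z ∈ ({c, d, e} : Set α), Col a b z := by
          intro z hz
          by_contra hz'
          obtain ⟨-, d2, d3⟩ := h.distinct hz'
          have hzab : ({z, a, b} : Set α) = {a, b, z} := by
            ext t; simp only [Set.mem_insert_iff, Set.mem_singleton_iff]; tauto
          refine hcon ⟨z, hz, by simp [d2.symm, d3.symm], ?_⟩
          rw [hzab]
          refine ⟨(h.ncard_eq_three hz').le, fun x y w hx _ hcol => hz' ?_⟩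
          exact h.col_of_mem (by simp [← hx]) (by simp [← hx]) (by simp [← hx]) hcol
        exact h.of_three hab (key c (by simp)) (key d (by simp)) (key e (by simp))
      · obtain ⟨e, he, heI⟩ := Set.exists_mem_notMem_of_ncard_lt_ncard hIJ I.toFinite
        have := Set.ncard_insert_le e I
        exact ⟨e, he, heI, by omega, fun _ _ _ _ _ => by omega⟩)
    (fun _ _ => Set.subset_univ _)).matroid

lemma indep_triple {a b c : α} (hn : ¬ Col a b c) : h.matroid.Indep {a, b, c} :=
  ⟨(h.ncard_eq_three hn).le, fun _ _ _ hx _ hcol =>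
    hn (h.col_of_mem (by simp [← hx]) (by simp [← hx]) (by simp [← hx]) hcol)⟩

lemma isBase_triple {a b c : α} (hn : ¬ Col a b c) : h.matroid.IsBase {a, b, c} :=
  (h.indep_triple hn).isBase_of_maximal fun J hJ hsub =>
    Set.eq_of_subset_of_ncard_le hsub (by
      rw [h.ncard_eq_three hn]
      exact hJ.1) J.toFinite

variable [Nontrivial α]

theorem isSimpleRankThree : IsSimpleRankThree h.matroid where
  ground := rfl
  rank := by
    obtain ⟨a, b, hab⟩ := exists_pair_ne α
    obtain ⟨c, hc⟩ := h.exists_not a b hab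
    rw [← (h.isBase_triple hc).encard_eq_eRank, Set.Finite.encard_eq_coe_toFinset_card
      (Set.toFinite _), ← Set.ncard_eq_toFinset_card, h.ncard_eq_three hc]
    rfl
  simple a b := by
    by_cases hab : a = b
    · obtain ⟨b', hb'⟩ := exists_ne a
      obtain ⟨c, hc⟩ := h.exists_not a b' hb'.symm
      exact (h.indep_triple hc).subset (by simp [hab])
    · obtain ⟨c, hc⟩ := h.exists_not a b hab
      exact (h.indep_triple hc).subset (by intro t; simp; tauto)

theorem isBase_iff {a b c : α} : h.matroid.IsBase {a, b, c} ↔ ¬ Col a b c := by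
  refine ⟨fun hB => ?_, h.isBase_triple⟩
  have h3 : ({a, b, c} : Set α).ncard = 3 := by
    have := hB.encard_eq_eRank.trans h.isSimpleRankThree.rank
    rw [← Set.Finite.cast_ncard_eq (Set.toFinite _)] at this
    exact_mod_cast this
  exact hB.indep.2 a b c rfl h3

end IsCollinearity

section
open Gadget Polynomial
variable {G : ℕ → Gadget}

/-! ### Generic projections to dimension three -/

section Projection
variable {K V : Type*} [Field K] [AddCommGroup V] [Module K V] [FiniteDimensional K V]

/-- Two subspaces of the same dimension have a common complement; equivalently, there is a
projection onto the first one which is injective on the second one. -/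
lemma exists_projection (B W : Submodule K V) (h : Module.finrank K B = Module.finrank K W) :
    ∃ T : V →ₗ[K] B, (∀ b : B, T b = b) ∧ ∀ w ∈ W, T w = 0 → w = 0 := by
  obtain ⟨B', hB⟩ := exists_isCompl ((B ⊓ W).comap B.subtype)
  obtain ⟨W', hW⟩ := exists_isCompl ((B ⊓ W).comap W.subtype)
  have e1 : Module.finrank K B' = Module.finrank K W' := by
    have h1 := Submodule.finrank_add_eq_of_isCompl hB
    have h2 := Submodule.finrank_add_eq_of_isCompl hW
    rw [(Submodule.comapSubtypeEquivOfLe inf_le_left).finrank_eq] at h1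
    rw [(Submodule.comapSubtypeEquivOfLe inf_le_right).finrank_eq] at h2
    omega
  let ψ : W' ≃ₗ[K] B' := LinearEquiv.ofFinrankEq _ _ e1.symm
  have hd : Disjoint B (W'.map W.subtype) := by
    rw [Submodule.disjoint_def]
    rintro _ hb ⟨w, hw, rfl⟩
    have := Submodule.disjoint_def.1 hW.disjoint w ⟨hb, w.2⟩ hw
    simp [this]
  obtain ⟨N, hN, hNB⟩ := hd.symm.exists_isCompl
  have hBN := hNB.symm
  let i : W' →ₗ[K] V := W.subtype ∘ₗ W'.subtype
  have hi : LinearMap.ker i = ⊥ := by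
    rw [LinearMap.ker_eq_bot]
    exact Subtype.val_injective.comp Subtype.val_injective
  obtain ⟨r, hr⟩ := i.exists_leftInverse_of_injective hi
  let g : V →ₗ[K] B := (B'.subtype ∘ₗ ψ.toLinearMap) ∘ₗ r
  let T : V →ₗ[K] B := LinearMap.ofIsCompl hBN LinearMap.id (g ∘ₗ N.subtype)
  have hTB : ∀ b : B, T b = b := fun b => LinearMap.ofIsCompl_apply_left hBN b
  have hTW : ∀ w : W', T (w : W) = (ψ w : B) := fun w => by
    have hwN : ((w : W) : V) ∈ N := hN ⟨w, w.2, rfl⟩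
    refine (LinearMap.ofIsCompl_apply_right hBN ⟨_, hwN⟩).trans ?_
    have : r ((w : W) : V) = w := LinearMap.congr_fun hr w
    simp [g, this]
  refine ⟨T, hTB, fun w hw h0 => ?_⟩
  obtain ⟨⟨u, hu⟩, v, huv⟩ : ∃ (u : (B ⊓ W).comap W.subtype) (v : W'), (u : W) + v = ⟨w, hw⟩ := by
    have : (⟨w, hw⟩ : W) ∈ (B ⊓ W).comap W.subtype ⊔ W' := by rw [hW.sup_eq_top]; trivial
    obtain ⟨u, hu, v, hv, huv⟩ := Submodule.mem_sup.1 this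
    exact ⟨⟨u, hu⟩, ⟨v, hv⟩, huv⟩
  have huv' : w = (u : V) + ((v : W) : V) := (congrArg Subtype.val huv).symm
  rw [huv', map_add, hTB ⟨u, hu.1⟩, hTW] at h0
  have hu0 : (⟨u, hu.1⟩ : B) = 0 := by
    refine Submodule.disjoint_def.1 hB.disjoint _ hu ?_
    rw [eq_neg_of_add_eq_zero_left h0]
    exact B'.neg_mem (ψ v).2
  rw [hu0, zero_add] at h0
  have : v = 0 := ψ.injective (by ext; simpa using h0)
  have hu0' : ((u : W) : V) = 0 := congrArg Subtype.val hu0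
  rw [huv', hu0', this]
  simp

/-- A linear map to a space of dimension three which takes the given independent triple `b` to the
standard basis, and keeps the triple `w` independent. -/
lemma exists_projection_basis {b w : Fin 3 → V} (hb : LinearIndependent K b)
    (hw : LinearIndependent K w) : ∃ T : V →ₗ[K] (Fin 3 → K),
      (∀ i, T (b i) = Pi.single i 1) ∧ LinearIndependent K (T ∘ w) := by
  obtain ⟨T, h1, h2⟩ := exists_projection (Submodule.span K (Set.range b))
    (Submodule.span K (Set.range w))
    (by rw [finrank_span_eq_card hb, finrank_span_eq_card hw])
  let β := Module.Basis.span hb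
  refine ⟨β.equivFun.toLinearMap ∘ₗ T, fun i => ?_, ?_⟩
  · have : T (b i) = β i := by
      rw [← h1 (β i)]
      simp [β, Module.Basis.span_apply]
    ext j
    simp [this, Pi.single_apply, eq_comm]
  · apply hw.map
    rw [LinearMap.ker_comp_of_ker_eq_bot _ (LinearEquiv.ker _), Submodule.disjoint_def]
    exact h2

end Projection

section
variable {R S : Type*} [CommRing R] [CommRing S] (φ : R →+* S)

lemma coeff₁_map (lk : Bool) (x : ℕ → R) (g : Gadget) (i : ℕ) :
    coeff₁ lk (φ ∘ x) g i = φ (coeff₁ lk x g i) := by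
  cases lk <;> cases g <;> rcases i with _ | _ | _ | _ | _ | _ | _ | _ <;> simp [coeff₁]

lemma coeff₂_map (lk : Bool) (g : Gadget) (i : ℕ) : coeff₂ lk g i = φ (coeff₂ lk g i) := by
  cases lk <;> cases g <;> rcases i with _ | _ | _ | _ | _ | _ | _ | _ <;> simp [coeff₂]

lemma coeff₀_map (lk : Bool) (x : ℕ → R) (l : ℕ) (g : Gadget) (i : ℕ) :
    coeff₀ lk (φ ∘ x) l g i = φ (coeff₀ lk x l g i) := by
  cases lk <;> cases g <;> rcases i with _ | _ | _ | _ | _ | _ | _ | _ <;> simp [coeff₀]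

lemma co_map (x : ℕ → R) (e : ℕ × ℕ) (n : ℕ) : co G (φ ∘ x) e n = φ (co G x e n) := by
  simp [co, coeff₁_map, ← coeff₂_map, coeff₀_map, kron, apply_ite φ]

lemma vec_map (x : ℕ → R) (p : ℕ → Fin 3 → R) (e : ℕ × ℕ) :
    vec G (φ ∘ x) (fun n => φ ∘ p n) e = φ ∘ vec G x p e := by
  ext i
  simp [vec, coeff₁_map, ← coeff₂_map, coeff₀_map]

lemma det3_map (u v w : Fin 3 → R) : det3 (φ ∘ u) (φ ∘ v) (φ ∘ w) = φ (det3 u v w) := by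
  simp [det3_eq]

end

lemma WellFormed.vec_eq_sum (w : WellFormed G) {R V : Type*} [CommRing R] [AddCommGroup V]
    [Module R V] (x : ℕ → R) (p : ℕ → V) (e : ℕ × ℕ) (L : ℕ) (he : e.1 < L) :
    vec G x p e = ∑ n ∈ Finset.range L, co G x e n • p n := by
  have key : ∀ m < L, p m = ∑ n ∈ Finset.range L, (kron n m : R) • p n := fun m hm => by
    rw [Finset.sum_eq_single m] <;> simp +contextual [kron_ne, hm]
  have hs : (G e.1).src₁ < L ∧ (G e.1).src₂ < L := by
    rcases e with ⟨_ | _ | l, i⟩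
    · exact ⟨by simpa [w.G_zero, src₁] using he, by simpa [w.G_zero, src₂] using he⟩
    · have h1 : (G (0 + 1)).src₁ = 0 ∧ (G (0 + 1)).src₂ = 0 := by
        simp [w.G_one, src₁, src₂]
      change 0 + 1 < L at he
      dsimp only
      omega
    · have h2 := w.src_lt (l + 1 + 1) (by omega)
      exact ⟨h2.1.trans he, h2.2.trans he⟩
  rw [vec, key _ he, key _ hs.1, key _ hs.2, key 0 (by omega), Finset.smul_sum, Finset.smul_sum,
    Finset.smul_sum, ← Finset.sum_add_distrib, ← Finset.sum_add_distrib, ← Finset.sum_add_distrib]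
  refine Finset.sum_congr rfl fun n _ => ?_
  simp only [co]
  module

lemma det3_ne_zero_iff {K : Type*} [Field K] (v : Fin 3 → Fin 3 → K) :
    det3 (v 0) (v 1) (v 2) ≠ 0 ↔ LinearIndependent K v := by
  have : v = (Matrix.of ![v 0, v 1, v 2]).row := by
    ext i j; fin_cases i <;> rfl
  rw [this, Matrix.linearIndependent_rows_iff_isUnit, Matrix.isUnit_iff_isUnit_det,
    isUnit_iff_ne_zero]
  rfl

/-- An independent triple of elements remains independent after a suitable projection to dimension
three, even if the first three base vectors are prescribed as the coordinate points. Applied to each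
triple separately, this shows that the determinants of the independent triples are nonzero
polynomials in the coordinates of the base points. -/
theorem exists_points_det3_ne_zero (w : WellFormed G) {F : Type*} [Field F] {x : ℕ → F[X]} {L : ℕ}
    (hL : 3 ≤ L) (e : Fin 3 → ℕ × ℕ) (he : ∀ i, (e i).1 < L) (h : ¬ Dep G x (e 0) (e 1) (e 2)) :
    ∃ p : ℕ → Fin 3 → FractionRing F[X], p 0 = ![0, 0, 1] ∧ p 1 = ![0, 1, 0] ∧ p 2 = ![1, 0, 0] ∧
      det3 (vec G (algebraMap F[X] (FractionRing F[X]) ∘ x) p (e 0))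
        (vec G (algebraMap F[X] (FractionRing F[X]) ∘ x) p (e 1))
        (vec G (algebraMap F[X] (FractionRing F[X]) ∘ x) p (e 2)) ≠ 0 := by
  let Q := FractionRing F[X]
  let φ : F[X] →+* Q := algebraMap F[X] Q
  let u : Fin 3 → Fin L → F[X] := fun i n => co G x (e i) n
  have hu : LinearIndependent F[X] u := by
    rw [Fintype.linearIndependent_iff]
    intro c hc
    by_contra! hne
    apply h
    refine ⟨c 0, c 1, c 2, ?_, fun n => ?_⟩
    · obtain ⟨i, hi⟩ := hne
      fin_cases i <;> simp_all
    · by_cases hn : n < L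
      · simpa [Fin.sum_univ_three, u] using congrFun hc ⟨n, hn⟩
      · simp [w.co_above _ _ _ _ (lt_of_lt_of_le (he _) (not_lt.1 hn))]
  let v : Fin 3 → Fin L → Q := fun i => φ ∘ u i
  have hv : LinearIndependent Q v := by
    rw [← LinearIndependent.iff_fractionRing F[X] Q]
    refine hu.map' ((Algebra.linearMap F[X] Q).compLeft (Fin L)) ?_
    rw [LinearMap.ker_eq_bot]
    exact fun a b hab => funext fun n => IsFractionRing.injective F[X] Q (congrFun hab n)
  let m : Fin 3 → Fin L := ![⟨2, by omega⟩, ⟨1, by omega⟩, ⟨0, by omega⟩]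
  have hm : Function.Injective m := by
    intro i j hij
    fin_cases i <;> fin_cases j <;> simp_all [m]
  obtain ⟨T, hT, hTv⟩ := exists_projection_basis
    ((Pi.basisFun Q (Fin L)).linearIndependent.comp m hm) hv
  have hT' : ∀ i, T (Pi.single (m i) 1) = Pi.single i 1 := fun i => by rw [← hT i]; simp
  let p : ℕ → Fin 3 → Q := fun n => if h : n < L then T (Pi.single ⟨n, h⟩ 1) else 0
  have hp : ∀ i, p (m i) = Pi.single i 1 := fun i => by simp [p, hT']
  refine ⟨p, ?_, ?_, ?_, ?_⟩
  · refine (hp 2).trans ?_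
    ext i; fin_cases i <;> rfl
  · refine (hp 1).trans ?_
    ext i; fin_cases i <;> rfl
  · refine (hp 0).trans ?_
    ext i; fin_cases i <;> rfl
  · have : ∀ i, vec G (φ ∘ x) p (e i) = (T ∘ v) i := fun i => by
      rw [w.vec_eq_sum _ _ _ L (he i), Finset.sum_range, Function.comp_apply,
        pi_eq_sum_univ' (v i), map_sum]
      refine Finset.sum_congr rfl fun n _ => ?_
      rw [map_smul, co_map]
      simp [p, v, u]
    rw [this, this, this, det3_ne_zero_iff]
    exact hTv

end

/-! ### Points of the projective plane in coordinates -/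

section Plane
variable {A B : Type u} [CommRing A] [CommRing B]

lemma extendScalars_span (f : A →+* B) (v : Fin 3 → A) :
    extendScalars f (Submodule.span A {v}) = Submodule.span B {f ∘ v} := by
  apply le_antisymm
  · rw [extendScalars, Submodule.span_le]
    rintro _ ⟨u, hu, rfl⟩
    obtain ⟨c, rfl⟩ := Submodule.mem_span_singleton.1 hu
    exact Submodule.mem_span_singleton.2 ⟨f c, by ext; simp⟩
  · rw [Submodule.span_singleton_le_iff_mem]
    exact Submodule.subset_span ⟨v, Submodule.mem_span_singleton_self v, rfl⟩

lemma detIdeal_span (u v w : Fin 3 → A) :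
    detIdeal (Submodule.span A {u}) (Submodule.span A {v}) (Submodule.span A {w}) =
      Ideal.span {det3 u v w} := by
  apply le_antisymm
  · rw [detIdeal, Ideal.span_le]
    rintro _ ⟨x, hx, y, hy, z, hz, rfl⟩
    obtain ⟨a, rfl⟩ := Submodule.mem_span_singleton.1 hx
    obtain ⟨b, rfl⟩ := Submodule.mem_span_singleton.1 hy
    obtain ⟨c, rfl⟩ := Submodule.mem_span_singleton.1 hz
    refine Ideal.mem_span_singleton'.2 ⟨a * b * c, ?_⟩
    change _ = det3 _ _ _
    simp only [det3_eq, Pi.smul_apply, smul_eq_mul]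
    ring
  · rw [Ideal.span_singleton_le_iff_mem]
    exact Ideal.subset_span ⟨u, Submodule.mem_span_singleton_self u, v,
      Submodule.mem_span_singleton_self v, w, Submodule.mem_span_singleton_self w, rfl⟩

/-- A point of the projective plane over a ring has rank one: any two of its vectors are
proportional. -/
lemma Plane.mul_eq_mul (P : Plane A) {u v : Fin 3 → A} (hu : u ∈ P.toSubmodule)
    (hv : v ∈ P.toSubmodule) (i j : Fin 3) : u i * v j = u j * v i := by
  wlog hA : IsLocalRing A generalizing A
  -- The identity may be checked after localization at the maximal ideals.
  · rw [← sub_eq_zero]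
    apply Module.eq_zero_of_localization_maximal (R := A) (fun m _ => Localization.AtPrime m)
      (fun m _ => Algebra.linearMap A (Localization.AtPrime m))
    intro m hm
    let f := algebraMap A (Localization.AtPrime m)
    have := this (P.map f) (u := f ∘ u) (v := f ∘ v) (Submodule.subset_span ⟨u, hu, rfl⟩)
      (Submodule.subset_span ⟨v, hv, rfl⟩) inferInstance
    simp only [Algebra.linearMap_apply, map_sub, map_mul, sub_eq_zero]
    exact this
  let L := P.toSubmodule
  have : Module.Projective A ((Fin 3 → A) ⧸ L) := P.projective_quotient
  have : Module.Finite A ((Fin 3 → A) ⧸ L) := P.finite_quotient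
  have : Module.Free A ((Fin 3 → A) ⧸ L) := Module.free_of_flat_of_isLocalRing
  have hr : Module.finrank A ((Fin 3 → A) ⧸ L) = 2 := by
    have := P.rankAtStalk_eq ⟨IsLocalRing.maximalIdeal A, inferInstance⟩
    rwa [Module.rankAtStalk_eq_finrank_of_free] at this
  let e := (Module.finBasisOfFinrankEq A ((Fin 3 → A) ⧸ L) hr).equivFun
  let q : (Fin 3 → A) →ₗ[A] (Fin 2 → A) := e.toLinearMap ∘ₗ L.mkQ
  have hq : Function.Surjective q := e.surjective.comp L.mkQ_surjective
  let n : Fin 2 → Fin 3 → A := fun i k => q (Pi.single k 1) i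
  have hn : ∀ w i, q w i = n i 0 * w 0 + n i 1 * w 1 + n i 2 * w 2 := fun w i => by
    conv_lhs => rw [pi_eq_sum_univ' w]
    simp [Fin.sum_univ_three, n, mul_comm]
  obtain ⟨s₀, h₀⟩ := hq (Pi.single 0 1)
  obtain ⟨s₁, h₁⟩ := hq (Pi.single 1 1)
  have h00 := (hn s₀ 0).symm.trans (congrFun h₀ 0)
  have h01 := (hn s₀ 1).symm.trans (congrFun h₀ 1)
  have h10 := (hn s₁ 0).symm.trans (congrFun h₁ 0)
  have h11 := (hn s₁ 1).symm.trans (congrFun h₁ 1)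
  simp at h00 h01 h10 h11
  -- The two coordinates of the quotient map are linear forms `n 0`, `n 1`, and their cross product
  -- `c` generates the submodule. The section of the quotient map gives a linear form `l` with value
  -- `1` at `c`.
  let c : Fin 3 → A := crossProduct (n 0) (n 1)
  let l : Fin 3 → A := crossProduct s₀ s₁
  have hlc : l 0 * c 0 + l 1 * c 1 + l 2 * c 2 = 1 := by
    simp only [l, c, cross_apply, Matrix.cons_val]
    linear_combination h11 * (n 0 0 * s₀ 0 + n 0 1 * s₀ 1 + n 0 2 * s₀ 2) + h00
      - h10 * (n 1 0 * s₀ 0 + n 1 1 * s₀ 1 + n 1 2 * s₀ 2)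
  have key : ∀ w ∈ L, ∃ b : A, ∀ k, w k = b * c k := by
    intro w hw
    have hw0 : q w = 0 := by simp [q, (Submodule.Quotient.mk_eq_zero L).2 hw]
    have e0 := (hn w 0).symm.trans (congrFun hw0 0)
    have e1 := (hn w 1).symm.trans (congrFun hw0 1)
    simp only [Pi.zero_apply] at e0 e1
    have c01 : w 0 * c 1 = w 1 * c 0 := by
      simp only [c, cross_apply, Matrix.cons_val]
      linear_combination n 0 2 * e1 - n 1 2 * e0
    have c02 : w 0 * c 2 = w 2 * c 0 := by
      simp only [c, cross_apply, Matrix.cons_val]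
      linear_combination n 1 1 * e0 - n 0 1 * e1
    have c12 : w 1 * c 2 = w 2 * c 1 := by
      simp only [c, cross_apply, Matrix.cons_val]
      linear_combination n 0 0 * e1 - n 1 0 * e0
    refine ⟨l 0 * w 0 + l 1 * w 1 + l 2 * w 2, fun k => ?_⟩
    fin_cases k
    · change w 0 = _ * c 0
      linear_combination -w 0 * hlc + l 1 * c01 + l 2 * c02
    · change w 1 = _ * c 1
      linear_combination -w 1 * hlc - l 0 * c01 + l 2 * c12
    · change w 2 = _ * c 2
      linear_combination -w 2 * hlc - l 0 * c02 - l 1 * c12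
  obtain ⟨a, ha⟩ := key u hu
  obtain ⟨b, hb⟩ := key v hv
  rw [ha, ha, hb, hb]
  ring

/-- A unimodular vector spans a direct summand, whose complement is the quotient. -/
lemma exists_equiv_of_dotProduct_eq_one {l v : Fin 3 → A} (h : l ⬝ᵥ v = 1) :
    Nonempty ((Fin 3 → A) ≃ₗ[A] ((Fin 3 → A) ⧸ Submodule.span A {v}) × A) := by
  let f : (Fin 3 → A) →ₗ[A] A := ∑ i, l i • LinearMap.proj i
  have hf : f v = 1 := by simpa [f, dotProduct] using h
  let N := Submodule.span A {v}
  let g : ((Fin 3 → A) ⧸ N) →ₗ[A] (Fin 3 → A) := N.liftQ (LinearMap.id - f.smulRight v) (by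
    rw [Submodule.span_singleton_le_iff_mem]
    simp [hf])
  refine ⟨LinearEquiv.ofLinearMap (N.mkQ.prod f) (g.coprod (LinearMap.toSpanSingleton A _ v)) ?_ ?_⟩
  · refine LinearMap.ext fun ⟨y, a⟩ => ?_
    obtain ⟨x, rfl⟩ := N.mkQ_surjective y
    have hv : N.mkQ v = 0 :=
      (Submodule.Quotient.mk_eq_zero N).2 (Submodule.mem_span_singleton_self v)
    have hg : g (N.mkQ x) = x - f x • v := by simp [g]
    simp [-Submodule.mkQ_apply, hg, hv, hf]
  · ext x
    simp [g]

/-- The point of the projective plane with the given unimodular vector of coordinates. -/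
def Plane.ofVec (v : Fin 3 → A) (hv : ∃ l : Fin 3 → A, l ⬝ᵥ v = 1) : Plane A where
  toSubmodule := Submodule.span A {v}
  finite_quotient := inferInstance
  projective_quotient := by
    obtain ⟨l, hl⟩ := hv
    obtain ⟨e⟩ := exists_equiv_of_dotProduct_eq_one hl
    have := Module.Projective.of_equiv e
    exact Module.Projective.of_split (LinearMap.inl A _ A) (LinearMap.fst A _ A) (by ext; simp)
  rankAtStalk_eq p := by
    obtain ⟨l, hl⟩ := hv
    obtain ⟨e⟩ := exists_equiv_of_dotProduct_eq_one hl
    have := Module.Projective.of_equiv e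
    have : Module.Projective A ((Fin 3 → A) ⧸ Submodule.span A {v}) :=
      Module.Projective.of_split (LinearMap.inl A _ A) (LinearMap.fst A _ A) (by ext; simp)
    have : Nontrivial A := by
      by_contra hA
      rw [not_nontrivial_iff_subsingleton] at hA
      exact p.2.ne_top (Subsingleton.elim _ _)
    have h1 := congrFun (Module.rankAtStalk_eq_of_equiv e) p
    rw [Module.rankAtStalk_prod, Module.rankAtStalk_eq_finrank_of_free] at h1
    simp at h1
    omega

end Plane

/-! ### Families of submodules and realizations in coordinates -/

section Families
variable {α : Type} {A B C : Type u} [CommRing A] [CommRing B] [CommRing C]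

lemma extendScalars_extendScalars (f : A →+* B) (g : B →+* C) (L : Submodule A (Fin 3 → A)) :
    extendScalars g (extendScalars f L) = extendScalars (g.comp f) L := by
  apply le_antisymm
  · rw [extendScalars, Submodule.span_le]
    rintro _ ⟨u, hu, rfl⟩
    induction hu using Submodule.span_induction with
    | mem u hu =>
      obtain ⟨v, hv, rfl⟩ := hu
      exact Submodule.subset_span ⟨v, hv, rfl⟩
    | zero =>
      have : g ∘ (0 : Fin 3 → B) = 0 := by ext; simp
      simp [this]
    | add u v _ _ hu hv =>
      have : g ∘ (u + v) = g ∘ u + g ∘ v := by ext; simp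
      change g ∘ (u + v) ∈ extendScalars (g.comp f) L
      rw [this]
      exact Submodule.add_mem _ hu hv
    | smul c u _ hu =>
      have : g ∘ (c • u) = g c • (g ∘ u) := by ext; simp
      change g ∘ (c • u) ∈ extendScalars (g.comp f) L
      rw [this]
      exact Submodule.smul_mem _ (g c) hu
  · rw [extendScalars, Submodule.span_le]
    rintro _ ⟨u, hu, rfl⟩
    exact Submodule.subset_span ⟨f ∘ u, Submodule.subset_span ⟨u, hu, rfl⟩, rfl⟩

/-- The automorphism `g` of `A³` takes the family `X` of submodules to the family `Y`. -/
def FamMoves (g : GL (Fin 3) A) (X Y : α → Submodule A (Fin 3 → A)) : Prop :=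
  ∀ a, (X a).map (Matrix.mulVecLin (g : Matrix (Fin 3) (Fin 3) A)) = Y a

/-- The base change of a family of submodules. -/
def famExtend (f : A →+* B) (X : α → Submodule A (Fin 3 → A)) (a : α) :
    Submodule B (Fin 3 → B) := extendScalars f (X a)

/-- The family of submodules generated by single vectors. -/
def famSpan (v : α → Fin 3 → A) (a : α) : Submodule A (Fin 3 → A) := Submodule.span A {v a}

lemma famExtend_famExtend (f : A →+* B) (g : B →+* C) (X : α → Submodule A (Fin 3 → A)) :
    famExtend g (famExtend f X) = famExtend (g.comp f) X :=
  funext fun _ => extendScalars_extendScalars _ _ _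

lemma famExtend_famSpan (f : A →+* B) (v : α → Fin 3 → A) :
    famExtend f (famSpan v) = famSpan fun a => f ∘ v a :=
  funext fun _ => extendScalars_span _ _

namespace FamMoves
variable {g h : GL (Fin 3) A} {X Y Z : α → Submodule A (Fin 3 → A)}

lemma symm (H : FamMoves g X Y) : FamMoves g⁻¹ Y X := fun a => by
  rw [← H a, ← Submodule.map_comp, ← Matrix.mulVecLin_mul, ← Units.val_mul, inv_mul_cancel]
  simp

lemma trans (H : FamMoves g X Y) (H' : FamMoves h Y Z) : FamMoves (h * g) X Z := fun a => by
  rw [← H' a, ← H a, ← Submodule.map_comp, ← Matrix.mulVecLin_mul, ← Units.val_mul]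

lemma map (H : FamMoves g X Y) (f : A →+* B) :
    FamMoves (Matrix.GeneralLinearGroup.map f g) (famExtend f X) (famExtend f Y) := fun a => by
  have key : ∀ u : Fin 3 → A,
      (Matrix.mulVecLin (Matrix.GeneralLinearGroup.map f g : Matrix (Fin 3) (Fin 3) B)) (f ∘ u) =
        f ∘ (Matrix.mulVecLin (g : Matrix (Fin 3) (Fin 3) A) u) := fun u => by
    ext i; simp [Matrix.mulVec, dotProduct, Matrix.GeneralLinearGroup.map]
  rw [famExtend, famExtend, extendScalars, extendScalars, ← H a, Submodule.map_span]
  congr 1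
  ext w
  constructor
  · rintro ⟨_, ⟨u, hu, rfl⟩, rfl⟩
    exact ⟨_, ⟨u, hu, rfl⟩, (key u).symm⟩
  · rintro ⟨_, ⟨u, hu, rfl⟩, rfl⟩
    exact ⟨_, ⟨u, hu, rfl⟩, key u⟩

end FamMoves

/-- Zariski locally on `Spec A`, an automorphism of `A³` takes the family `X` to the family `Y`. To
require this over all the rings in which the local equation `f` is invertible makes the relation
evidently transitive and stable under base change. -/
def FamLocEq (X Y : α → Submodule A (Fin 3 → A)) : Prop :=
  ∀ p : Ideal A, p.IsPrime → ∃ f ∉ p, ∀ (B : Type u) [CommRing B] (h : A →+* B), IsUnit (h f) →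
    ∃ g : GL (Fin 3) B, FamMoves g (famExtend h X) (famExtend h Y)

namespace FamLocEq
variable {X Y Z : α → Submodule A (Fin 3 → A)}

lemma symm (H : FamLocEq X Y) : FamLocEq Y X := fun p hp => by
  obtain ⟨f, hf, H⟩ := H p hp
  exact ⟨f, hf, fun B _ h hu => (H B h hu).imp' _ fun g => FamMoves.symm⟩

lemma trans (H : FamLocEq X Y) (H' : FamLocEq Y Z) : FamLocEq X Z := fun p hp => by
  obtain ⟨f, hf, H⟩ := H p hp
  obtain ⟨f', hf', H'⟩ := H' p hp
  refine ⟨f * f', hp.mul_notMem hf hf', fun B _ h hu => ?_⟩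
  rw [map_mul] at hu
  obtain ⟨g, hg⟩ := H B h (isUnit_of_mul_isUnit_left hu)
  obtain ⟨g', hg'⟩ := H' B h (isUnit_of_mul_isUnit_right hu)
  exact ⟨_, hg.trans hg'⟩

lemma map (H : FamLocEq X Y) (φ : A →+* B) : FamLocEq (famExtend φ X) (famExtend φ Y) :=
  fun p hp => by
  obtain ⟨f, hf, H⟩ := H (p.comap φ) (hp.comap φ)
  refine ⟨φ f, hf, fun C _ h hu => ?_⟩
  rw [famExtend_famExtend, famExtend_famExtend]
  exact H C (h.comp φ) hu

end FamLocEq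

lemma exists_span_eq_top {P : A → Prop} (h : ∀ p : Ideal A, p.IsPrime → ∃ f ∉ p, P f) :
    Ideal.span {f | P f} = ⊤ := by
  by_contra hne
  obtain ⟨m, hm, hle⟩ := Ideal.exists_le_maximal _ hne
  obtain ⟨f, hf, hP⟩ := h m hm.isPrime
  exact hf (hle (Ideal.subset_span hP))

lemma exists_notMem_of_span_eq_top {s : Set A} (h : Ideal.span s = ⊤) (p : Ideal A)
    (hp : p.IsPrime) : ∃ f ∈ s, f ∉ p := by
  by_contra! hs
  exact hp.ne_top (top_le_iff.1 (h.symm.trans_le (Ideal.span_le.2 hs)))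

variable {M : Matroid α}

/-- The underlying family of submodules of a realization. -/
def Realization.fam (x : Realization M A) (a : α) : Submodule A (Fin 3 → A) :=
  (x.point a).toSubmodule

lemma Realization.locallyEquivalent_iff (x y : Realization M A) :
    x.LocallyEquivalent y ↔ FamLocEq x.fam y.fam := by
  constructor
  · rintro ⟨s, hs, H⟩ p hp
    obtain ⟨f, hfs, hf⟩ := exists_notMem_of_span_eq_top hs p hp
    refine ⟨f, hf, fun B _ h hu => ?_⟩
    obtain ⟨g, hg⟩ := H f hfs
    have hg' : FamMoves g (famExtend (algebraMap A _) x.fam) (famExtend (algebraMap A _) y.fam) :=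
      hg
    have := hg'.map (IsLocalization.Away.lift f hu)
    rw [famExtend_famExtend, famExtend_famExtend, IsLocalization.Away.lift_comp] at this
    exact ⟨_, this⟩
  · intro H
    refine ⟨_, exists_span_eq_top fun p hp => ?_, fun f hf => hf⟩
    obtain ⟨f, hf, H⟩ := H p hp
    exact ⟨f, hf, H _ _ (IsLocalization.Away.algebraMap_isUnit f)⟩

end Families

section Config
variable {α : Type} {M : Matroid α} {A B : Type u} [CommRing A] [CommRing B]

/-- The vectors `v a` are coordinates of a realization of `M`. -/
structure IsConfig (M : Matroid α) (v : α → Fin 3 → A) : Prop where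
  dep : ∀ a b c, ¬ M.IsBase {a, b, c} → det3 (v a) (v b) (v c) = 0
  indep : ∀ a b c, M.IsBase {a, b, c} → IsUnit (det3 (v a) (v b) (v c))

lemma IsConfig.map {v : α → Fin 3 → A} (hv : IsConfig M v) (f : A →+* B) :
    IsConfig M fun a => f ∘ v a where
  dep a b c h := by rw [det3_map, hv.dep a b c h, map_zero]
  indep a b c h := by rw [det3_map]; exact (hv.indep a b c h).map f

lemma exists_dotProduct_eq_one_of_isUnit {u v w : Fin 3 → A} (h : IsUnit (det3 u v w)) :
    ∃ l : Fin 3 → A, l ⬝ᵥ u = 1 := by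
  obtain ⟨d, hd⟩ := h.exists_left_inv
  refine ⟨d • crossProduct v w, ?_⟩
  rw [← hd, det3_eq]
  simp [dotProduct, Fin.sum_univ_three, cross_apply]
  ring

lemma IsSimpleRankThree.exists_isBase (hM : IsSimpleRankThree M) (a : α) :
    ∃ b c, M.IsBase {a, b, c} := by
  obtain ⟨B, hB, haB⟩ := (hM.simple a a).exists_isBase_superset
  have h3 : B.encard = 3 := hB.encard_eq_eRank.trans hM.rank
  obtain ⟨x, y, z, -, -, -, rfl⟩ := Set.encard_eq_three.1 h3
  have ha : a ∈ ({x, y, z} : Set α) := haB (by simp)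
  rcases ha with rfl | rfl | rfl
  · exact ⟨y, z, hB⟩
  · exact ⟨x, z, by rwa [Set.insert_comm]⟩
  · exact ⟨x, y, by rwa [Set.insert_comm, Set.pair_comm]⟩

/-- The realization with the given coordinates. -/
noncomputable def IsConfig.realization (hM : IsSimpleRankThree M) {v : α → Fin 3 → A}
    (hv : IsConfig M v) : Realization M A where
  point a := Plane.ofVec (v a) (by
    obtain ⟨b, c, h⟩ := hM.exists_isBase a
    exact exists_dotProduct_eq_one_of_isUnit (hv.indep a b c h))
  collinear a b c h := by
    rw [Plane.ofVec, Plane.ofVec, Plane.ofVec, detIdeal_span, hv.dep a b c h]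
    simp
  noncollinear a b c h := by
    rw [Plane.ofVec, Plane.ofVec, Plane.ofVec, detIdeal_span]
    exact Ideal.span_singleton_eq_top.2 (hv.indep a b c h)

lemma IsConfig.fam_realization (hM : IsSimpleRankThree M) {v : α → Fin 3 → A}
    (hv : IsConfig M v) : (hv.realization hM).fam = famSpan v := rfl

/-- Locally, the points of a realization have coordinates. -/
lemma Realization.exists_isConfig [Finite α] (hM : IsSimpleRankThree M) (x : Realization M A)
    (p : Ideal A) (hp : p.IsPrime) : ∃ f ∉ p, ∀ (B : Type u) [CommRing B] (h : A →+* B),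
      IsUnit (h f) → ∃ w : α → Fin 3 → B, IsConfig M w ∧ famExtend h x.fam = famSpan w := by
  have h1 : ∀ a, ∃ u ∈ x.fam a, ∃ v w : Fin 3 → A, det3 u v w ∉ p := by
    intro a
    obtain ⟨b, c, hb⟩ := hM.exists_isBase a
    obtain ⟨f, ⟨u, hu, v, -, w, -, rfl⟩, hf⟩ :=
      exists_notMem_of_span_eq_top (x.noncollinear a b c hb) p hp
    exact ⟨u, hu, v, w, hf⟩
  choose u hu v w hf using h1
  have := Fintype.ofFinite α
  refine ⟨∏ a, det3 (u a) (v a) (w a), ?_, fun B _ h hunit => ?_⟩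
  · rw [hp.prod_mem_iff]
    simpa using hf
  have hfam : famExtend h x.fam = famSpan fun a => h ∘ u a := by
    funext a
    rw [map_prod] at hunit
    have h1 := (IsUnit.prod_univ_iff.1 hunit) a
    rw [← det3_map] at h1
    obtain ⟨l, hl⟩ := exists_dotProduct_eq_one_of_isUnit h1
    apply le_antisymm
    · refine Submodule.span_le.2 ?_
      rintro _ ⟨s, hs, rfl⟩
      refine Submodule.mem_span_singleton.2 ⟨l ⬝ᵥ (h ∘ s), ?_⟩
      have key : ∀ i j, h (s i) * h (u a j) = h (s j) * h (u a i) := fun i j => by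
        rw [← map_mul, ← map_mul]
        exact congrArg h ((x.point a).mul_eq_mul hs (hu a) i j)
      ext i
      simp only [dotProduct, Fin.sum_univ_three, Function.comp_apply, Pi.smul_apply,
        smul_eq_mul] at hl ⊢
      linear_combination h (s i) * hl + l 0 * key 0 i + l 1 * key 1 i + l 2 * key 2 i
    · refine (Submodule.span_singleton_le_iff_mem _ _).2 ?_
      exact Submodule.subset_span ⟨u a, hu a, rfl⟩
  refine ⟨_, ⟨fun a b c hn => ?_, fun a b c hb => ?_⟩, hfam⟩
  · have h2 := congrArg (Ideal.map h) (x.collinear a b c hn)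
    rw [← detIdeal_extendScalars] at h2
    have ha : ∀ a, extendScalars h (x.point a).toSubmodule = _ := congrFun hfam
    rw [ha, ha, ha, famSpan, famSpan, famSpan, detIdeal_span, Ideal.map_bot] at h2
    exact Ideal.span_singleton_eq_bot.1 h2
  · have h2 := congrArg (Ideal.map h) (x.noncollinear a b c hb)
    rw [← detIdeal_extendScalars] at h2
    have ha : ∀ a, extendScalars h (x.point a).toSubmodule = _ := congrFun hfam
    rw [ha, ha, ha, famSpan, famSpan, famSpan, detIdeal_span, Ideal.map_top] at h2
    exact Ideal.span_singleton_eq_top.1 h2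

end Config

/-! ### Universal realizations -/

section Universal
variable {α : Type} {M : Matroid α} {C : Type u} [CommRing C]

/-- The coordinates `v` over the ring `C` describe a universal realization of `M`: each realization
with coordinates is a specialization of it, up to an automorphism `g` of `A³`, and the
specialization is unique, as is `g` up to scalars. -/
structure IsUniversalConfig (M : Matroid α) (v : α → Fin 3 → C) : Prop extends IsConfig M v where
  rigid : ∀ (A : Type u) [CommRing A] (φ ψ : C →+* A) (g : GL (Fin 3) A),
    FamMoves g (famSpan fun a => φ ∘ v a) (famSpan fun a => ψ ∘ v a) →
      φ = ψ ∧ ∃ c : A, (g : Matrix (Fin 3) (Fin 3) A) = Matrix.scalar (Fin 3) c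
  exists_hom : ∀ (A : Type u) [CommRing A] (w : α → Fin 3 → A), IsConfig M w →
    ∃ (φ : C →+* A) (g : GL (Fin 3) A), FamMoves g (famSpan w) (famSpan fun a => φ ∘ v a)

lemma eq_of_forall_prime {A : Type u} [CommRing A] {a b : A}
    (h : ∀ p : Ideal A, p.IsPrime → ∃ f ∉ p, algebraMap A (Localization.Away f) a =
      algebraMap A (Localization.Away f) b) : a = b :=
  Localization.algebraMap_injective_of_span_eq_top _ (exists_span_eq_top h)
    (funext fun f => f.2)

/-- Ring homomorphisms to `A` may be glued. -/
lemma exists_glue_hom {A : Type u} [CommRing A] {s : Set A} (hs : Ideal.span s = ⊤)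
    (φ : ∀ f : s, C →+* Localization.Away f.1)
    (h : ∀ a b : s, (IsLocalization.Away.awayToAwayRight (P := Localization.Away (a * b : A))
      a.1 b.1).comp (φ a) = (IsLocalization.Away.awayToAwayLeft b.1 a.1).comp (φ b)) :
    ∃ ψ : C →+* A, ∀ f : s, (algebraMap A (Localization.Away f.1)).comp ψ = φ f := by
  choose ψ hψ using fun c => (Localization.existsUnique_algebraMap_eq_of_span_eq_top s hs
    (fun f => φ f c) fun a b => RingHom.congr_fun (h a b) c).exists
  have inj := Localization.algebraMap_injective_of_span_eq_top s hs
  exact ⟨{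
    toFun := ψ
    map_one' := inj (funext fun f => by simp only [Pi.algebraMap_apply, map_one, hψ])
    map_mul' := fun a b => inj (funext fun f => by simp only [Pi.algebraMap_apply, map_mul, hψ])
    map_zero' := inj (funext fun f => by simp only [Pi.algebraMap_apply, map_zero, hψ])
    map_add' := fun a b => inj (funext fun f => by
      simp only [Pi.algebraMap_apply, map_add, hψ]) }, fun f => RingHom.ext fun c => hψ c f⟩

namespace IsUniversalConfig
variable {v : α → Fin 3 → C} (hv : IsUniversalConfig M v) {A : Type u} [CommRing A]
include hv

lemma hom_ext {φ ψ : C →+* A}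
    (h : FamLocEq (famSpan fun a => φ ∘ v a) (famSpan fun a => ψ ∘ v a)) : φ = ψ := by
  ext c
  refine eq_of_forall_prime fun p hp => ?_
  obtain ⟨f, hf, H⟩ := h p hp
  obtain ⟨g, hg⟩ := H _ (algebraMap A (Localization.Away f))
    (IsLocalization.Away.algebraMap_isUnit f)
  rw [famExtend_famSpan, famExtend_famSpan] at hg
  exact ⟨f, hf, RingHom.congr_fun (hv.rigid _ ((algebraMap A _).comp φ)
    ((algebraMap A _).comp ψ) g hg).1 c⟩

variable [Finite α] (hM : IsSimpleRankThree M)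
include hM

lemma exists_local_hom (x : Realization M A) (p : Ideal A) (hp : p.IsPrime) :
    ∃ f ∉ p, ∀ (B : Type u) [CommRing B] (h : A →+* B), IsUnit (h f) →
      ∃ (φ : C →+* B) (g : GL (Fin 3) B),
        FamMoves g (famExtend h x.fam) (famSpan fun a => φ ∘ v a) := by
  obtain ⟨f, hf, H⟩ := x.exists_isConfig hM p hp
  refine ⟨f, hf, fun B _ h hu => ?_⟩
  obtain ⟨w, hw, hx⟩ := H B h hu
  rw [hx]
  exact hv.exists_hom B w hw

theorem actsFreely : ActsFreely.{u} M := by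
  intro A _ x g hg
  refine ⟨(g : Matrix (Fin 3) (Fin 3) A) 0 0, ?_⟩
  ext i j
  refine eq_of_forall_prime fun p hp => ?_
  obtain ⟨f, hf, H⟩ := hv.exists_local_hom hM x p hp
  refine ⟨f, hf, ?_⟩
  let γ := algebraMap A (Localization.Away f)
  obtain ⟨φ, h, hh⟩ := H _ γ (IsLocalization.Away.algebraMap_isUnit f)
  have hgx : FamMoves g x.fam x.fam := hg
  obtain ⟨-, c, hc⟩ := hv.rigid _ φ φ _ ((hh.symm.trans (hgx.map γ)).trans hh)
  have hc' : (Matrix.GeneralLinearGroup.map γ g : Matrix (Fin 3) (Fin 3) (Localization.Away f)) =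
      Matrix.scalar (Fin 3) c := by
    have h1 : Matrix.GeneralLinearGroup.map γ g = h⁻¹ *
        (h * (Matrix.GeneralLinearGroup.map γ g * h⁻¹)) * h := by group
    rw [h1, Units.val_mul, Units.val_mul, hc, mul_assoc,
      (Matrix.scalar_commute c (fun _ => mul_comm _ _) _).eq, ← mul_assoc, ← Units.val_mul,
      inv_mul_cancel, Units.val_one, one_mul]
  have key : ∀ i j, γ ((g : Matrix (Fin 3) (Fin 3) A) i j) = Matrix.scalar (Fin 3) c i j :=
    fun i j => congrFun (congrFun hc' i) j
  change γ _ = γ _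
  rw [key]
  by_cases hij : i = j
  · subst hij
    simp [key]
  · simp [hij]

/-- The local specializations which describe a realization agree on overlaps, by rigidity, and hence
are glued to a single one. -/
lemma exists_hom_famLocEq (x : Realization M A) :
    ∃ φ : C →+* A, FamLocEq x.fam (famSpan fun a => φ ∘ v a) := by
  let P : A → Prop := fun f => ∃ (φ : C →+* Localization.Away f) (g : GL (Fin 3) _),
    FamMoves g (famExtend (algebraMap A _) x.fam) (famSpan fun a => φ ∘ v a)
  have hP : ∀ p : Ideal A, p.IsPrime → ∃ f ∉ p, P f := fun p hp => by
    obtain ⟨f, hf, H⟩ := hv.exists_local_hom hM x p hp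
    exact ⟨f, hf, H _ _ (IsLocalization.Away.algebraMap_isUnit f)⟩
  have hs := exists_span_eq_top hP
  choose φ g hg using fun f : {f | P f} => f.2
  obtain ⟨Ψ, hΨ⟩ := exists_glue_hom hs φ fun a b => by
    let r := IsLocalization.Away.awayToAwayRight (S := Localization.Away a.1)
      (P := Localization.Away (a * b : A)) a.1 b
    let l := IsLocalization.Away.awayToAwayLeft (S := Localization.Away b.1)
      (P := Localization.Away (a * b : A)) b.1 a
    have hr : r.comp (algebraMap A _) = algebraMap A _ := by
      ext t; exact IsLocalization.Away.awayToAwayRight_eq a.1 b.1 t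
    have hl : l.comp (algebraMap A _) = algebraMap A _ := by
      ext t; exact IsLocalization.Away.awayToAwayLeft_eq b.1 a.1 t
    have h1 := (hg a).map r
    have h2 := (hg b).map l
    rw [famExtend_famExtend, famExtend_famSpan, hr] at h1
    rw [famExtend_famExtend, famExtend_famSpan, hl] at h2
    exact (hv.rigid _ (r.comp (φ a)) (l.comp (φ b)) _ (h1.symm.trans h2)).1
  refine ⟨Ψ, fun p hp => ?_⟩
  obtain ⟨f, hf, hPf⟩ := hP p hp
  refine ⟨f, hf, fun B _ h hu => ?_⟩
  have h1 := (hg ⟨f, hPf⟩).map (IsLocalization.Away.lift f hu)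
  rw [famExtend_famExtend, IsLocalization.Away.lift_comp, famExtend_famSpan] at h1
  have h2 : h.comp Ψ = (IsLocalization.Away.lift f hu).comp (φ ⟨f, hPf⟩) := by
    rw [← hΨ ⟨f, hPf⟩, ← RingHom.comp_assoc, IsLocalization.Away.lift_comp]
  have h3 : famExtend h (famSpan fun a => Ψ ∘ v a) =
      famSpan fun a => IsLocalization.Away.lift f hu ∘ φ ⟨f, hPf⟩ ∘ v a :=
    (famExtend_famSpan _ _).trans (congrArg famSpan
      (funext fun a => congrArg (fun k : C →+* B => k ∘ v a) h2))
  rw [h3]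
  exact ⟨_, h1⟩

/-- The spectrum of the base of a universal realization is the realization space. -/
theorem isRealizationSpace : IsRealizationSpace M (Spec (CommRingCat.of C)) := by
  refine ⟨hv.actsFreely hM, ?_⟩
  choose Φ hΦ using fun (A : Type u) (_ : CommRing A) (x : Realization M A) =>
    hv.exists_hom_famLocEq hM x
  have hΦ_unique : ∀ (A : Type u) [i : CommRing A] (x : Realization M A) (φ : C →+* A),
      FamLocEq x.fam (famSpan fun a => φ ∘ v a) → Φ A i x = φ := fun A _ x φ hφ =>
    hv.hom_ext ((hΦ A _ x).symm.trans hφ)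
  refine ⟨⟨fun A _ x => Spec.map (CommRingCat.ofHom (Φ A _ x)), ?_, ?_, ?_⟩⟩
  · intro A B _ _ f x
    rw [← Spec.map_comp, ← CommRingCat.ofHom_comp]
    congr 2
    apply hΦ_unique
    have := (hΦ A _ x).map f
    rw [famExtend_famSpan] at this
    exact this
  · intro A _ x y
    rw [Realization.locallyEquivalent_iff]
    constructor
    · intro h
      have h := congrArg CommRingCat.Hom.hom (Spec.map_injective h)
      simp only [CommRingCat.hom_ofHom] at h
      have h2 := hΦ A _ y
      rw [← h] at h2
      exact (hΦ A _ x).trans h2.symm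
    · intro h
      congr 2
      exact hΦ_unique A x _ (h.trans (hΦ A _ y))
  · intro A _ φ
    obtain ⟨ψ, rfl⟩ := Spec.map_surjective φ
    refine ⟨{1}, by simp, fun f _ => ?_⟩
    let χ := (algebraMap A (Localization.Away f)).comp ψ.hom
    refine ⟨(hv.toIsConfig.map χ).realization hM, ?_⟩
    rw [hΦ_unique _ _ χ (by
      rw [IsConfig.fam_realization]
      exact fun p hp => ⟨1, (Ideal.ne_top_iff_one p).1 hp.ne_top, fun B _ h _ =>
        ⟨1, fun a => by simp [famExtend]⟩⟩), ← Spec.map_comp]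
    rfl

end IsUniversalConfig

/-- The realization space is determined up to isomorphism. -/
lemma IsRealizationSpace.of_iso {X Y : Scheme.{u}} (h : IsRealizationSpace M X) (e : X ≅ Y) :
    IsRealizationSpace M Y := by
  obtain ⟨hf, ⟨q⟩⟩ := h
  refine ⟨hf, ⟨⟨fun A _ x => q.toHom A x ≫ e.hom, ?_, ?_, ?_⟩⟩⟩
  · intro A B _ _ f x
    rw [q.naturality, Category.assoc]
  · intro A _ x y
    rw [cancel_mono, q.toHom_eq_iff]
  · intro A _ φ
    obtain ⟨s, hs, H⟩ := q.locally_surjective A (φ ≫ e.inv)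
    refine ⟨s, hs, fun f hf => ?_⟩
    obtain ⟨x, hx⟩ := H f hf
    exact ⟨x, by rw [hx]; simp⟩

end Universal

/-! ### Realization spaces from vectors over a polynomial ring -/

section OpenSubscheme
variable {R : Type u} [CommRing R] {N : ℕ}

/-- If `d` does not vanish identically on the fibre over the kernel of `f`, then the generic point
of the fibre lies in the locus where `d` is invertible. -/
lemma exists_isPrime_comap_eq_ker {P : Type u} {d : MvPolynomial P R} {F : Type u} [Field F]
    (f : R →+* F) (hd : MvPolynomial.map f d ≠ 0) :
    ∃ q : PrimeSpectrum (Localization.Away d), (PrimeSpectrum.comap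
      ((algebraMap (MvPolynomial P R) (Localization.Away d)).comp MvPolynomial.C) q).asIdeal =
        RingHom.ker f := by
  obtain ⟨Q, _, χ, hχ, hker⟩ : ∃ (Q : Type u) (_ : Field Q) (χ : MvPolynomial P R →+* Q),
      IsUnit (χ d) ∧ ∀ r, χ (MvPolynomial.C r) = 0 ↔ f r = 0 := by
    let Q := FractionRing (MvPolynomial P F)
    have inj : Function.Injective (algebraMap (MvPolynomial P F) Q) := IsFractionRing.injective _ _
    refine ⟨Q, inferInstance, (algebraMap _ _).comp (MvPolynomial.map f), ?_, fun r => ?_⟩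
    · rw [isUnit_iff_ne_zero, RingHom.comp_apply, Ne, map_eq_zero_iff _ inj]
      exact hd
    · rw [RingHom.comp_apply, map_eq_zero_iff _ inj, MvPolynomial.map_C, MvPolynomial.C_eq_zero]
  obtain ⟨ψ, hψ⟩ : ∃ ψ : Localization.Away d →+* Q, ψ.comp (algebraMap _ _) = χ :=
    ⟨_, IsLocalization.Away.lift_comp d hχ⟩
  refine ⟨⟨RingHom.ker ψ, RingHom.ker_isPrime ψ⟩, ?_⟩
  ext r
  rw [← hψ] at hker
  exact hker r

lemma surjective_comap_of_map_ne_zero {P : Type u} (d : MvPolynomial P R)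
    (hd : ∀ (F : Type u) [Field F] (f : R →+* F), MvPolynomial.map f d ≠ 0) :
    Function.Surjective (PrimeSpectrum.comap
      ((algebraMap (MvPolynomial P R) (Localization.Away d)).comp MvPolynomial.C)) := by
  intro p
  obtain ⟨q, hq⟩ := exists_isPrime_comap_eq_ker _ (hd _ (algebraMap R p.asIdeal.ResidueField))
  refine ⟨q, PrimeSpectrum.ext (hq.trans ?_)⟩
  exact Ideal.ker_algebraMap_residueField p.asIdeal

/-- The locus in the affine space over `R` where `d` is invertible is open, and it surjects to
`Spec R` if `d` vanishes identically on none of the fibres. -/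
lemma hasOpenRealizationSpace_of_isRealizationSpace {α : Type} {M : Matroid α}
    (d : MvPolynomial (ULift.{u} (Fin N)) R)
    (hd : ∀ (F : Type u) [Field F] (f : R →+* F), MvPolynomial.map f d ≠ 0)
    (h : IsRealizationSpace M (Spec (CommRingCat.of (Localization.Away d)))) :
    HasOpenRealizationSpace M N R := by
  let B := MvPolynomial (ULift.{u} (Fin N)) R
  let i : Spec (CommRingCat.of (Localization.Away d)) ⟶ Spec (CommRingCat.of B) :=
    Spec.map (CommRingCat.ofHom (algebraMap B (Localization.Away d)))
  have hi : IsOpenImmersion i := IsOpenImmersion.of_isLocalization d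
  let j := i ≫ (AffineSpace.SpecIso (ULift.{u} (Fin N)) (CommRingCat.of R)).inv
  refine ⟨j.opensRange, h.of_iso j.isoOpensRange, ?_⟩
  have hj : j ≫ (𝔸(ULift.{u} (Fin N); Spec (CommRingCat.of R)) ↘ Spec (CommRingCat.of R)) =
      Spec.map (CommRingCat.ofHom
        ((algebraMap B (Localization.Away d)).comp MvPolynomial.C)) := by
    rw [Category.assoc, AffineSpace.SpecIso_inv_over, ← Spec.map_comp]
    rfl
  have hs : Surjective (j.isoOpensRange.hom ≫ j.opensRange.ι ≫
      (𝔸(ULift.{u} (Fin N); Spec (CommRingCat.of R)) ↘ Spec (CommRingCat.of R))) := by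
    rw [← Category.assoc, Scheme.Hom.isoOpensRange_hom_ι, hj]
    exact ⟨surjective_comap_of_map_ne_zero d hd⟩
  exact Surjective.of_comp j.isoOpensRange.hom _

end OpenSubscheme

section
variable {α : Type} {M : Matroid α} {A : Type u} [CommRing A]

lemma det3_mulVec (g : Matrix (Fin 3) (Fin 3) A) (u v w : Fin 3 → A) :
    det3 (g.mulVec u) (g.mulVec v) (g.mulVec w) = g.det * det3 u v w := by
  simp [det3_eq, Matrix.mulVec, dotProduct, Fin.sum_univ_three, Matrix.det_fin_three]
  ring

lemma det3_smul (a b c : A) (u v w : Fin 3 → A) :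
    det3 (a • u) (b • v) (c • w) = a * b * c * det3 u v w := by
  simp [det3_eq]
  ring

lemma famMoves_famSpan_iff {g : GL (Fin 3) A} {v w : α → Fin 3 → A} :
    FamMoves g (famSpan v) (famSpan w) ↔
      ∀ a, Submodule.span A {(g : Matrix (Fin 3) (Fin 3) A).mulVec (v a)} =
        Submodule.span A {w a} := by
  refine forall_congr' fun a => ?_
  rw [famSpan, famSpan, Submodule.map_span, Set.image_singleton]
  rfl

lemma FamMoves.exists_smul {g : GL (Fin 3) A} {v w : α → Fin 3 → A}
    (h : FamMoves g (famSpan v) (famSpan w)) (a : α) :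
    ∃ c : A, (g : Matrix (Fin 3) (Fin 3) A).mulVec (v a) = c • w a := by
  have h1 := famMoves_famSpan_iff.1 h a
  obtain ⟨c, hc⟩ := Submodule.mem_span_singleton.1 (h1 ▸ Submodule.mem_span_singleton_self _)
  exact ⟨c, hc.symm⟩

lemma isUnit_det3_of_famMoves {g : GL (Fin 3) A} {v w : α → Fin 3 → A}
    (h : FamMoves g (famSpan v) (famSpan w)) {a b c : α}
    (hu : IsUnit (det3 (v a) (v b) (v c))) : IsUnit (det3 (w a) (w b) (w c)) := by
  obtain ⟨a', ha⟩ := h.exists_smul a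
  obtain ⟨b', hb⟩ := h.exists_smul b
  obtain ⟨c', hc⟩ := h.exists_smul c
  have h1 := det3_mulVec (g : Matrix (Fin 3) (Fin 3) A) (v a) (v b) (v c)
  rw [ha, hb, hc, det3_smul] at h1
  have h2 : IsUnit ((g : Matrix (Fin 3) (Fin 3) A).det) :=
    (Matrix.isUnit_iff_isUnit_det _).1 g.isUnit
  exact isUnit_of_mul_isUnit_right (h1 ▸ h2.mul hu)

/-- Universality may be checked over a ring `B` such that `C` is obtained from `B` by inverting the
determinants of the bases. -/
lemma isUniversalConfig_of_lift {B C : Type u} [CommRing B] [CommRing C] [Finite α] (ι : B →+* C)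
    (v : α → Fin 3 → B) (hc : IsConfig M fun a => ι ∘ v a)
    (hext : ∀ (A : Type u) [CommRing A] (φ ψ : C →+* A), φ.comp ι = ψ.comp ι → φ = ψ)
    (hlift : ∀ (A : Type u) [CommRing A] (φ : B →+* A), (∀ a b c, M.IsBase {a, b, c} →
      IsUnit (φ (det3 (v a) (v b) (v c)))) → ∃ Φ : C →+* A, Φ.comp ι = φ)
    (rigid : ∀ (A : Type u) [CommRing A] (φ ψ : B →+* A)
      (g : GL (Fin 3) A), IsConfig M (fun a => φ ∘ v a) → IsConfig M (fun a => ψ ∘ v a) →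
      FamMoves g (famSpan fun a => φ ∘ v a) (famSpan fun a => ψ ∘ v a) →
        φ = ψ ∧ ∃ c : A, (g : Matrix (Fin 3) (Fin 3) A) = Matrix.scalar (Fin 3) c)
    (exists_hom : ∀ (A : Type u) [CommRing A] (w : α → Fin 3 → A), IsConfig M w →
      ∃ (φ : B →+* A) (g : GL (Fin 3) A), FamMoves g (famSpan w) (famSpan fun a => φ ∘ v a)) :
    IsUniversalConfig M fun a => ι ∘ v a := by
  refine ⟨hc, ?_, ?_⟩
  · intro A _ φ ψ g hg
    obtain ⟨h1, h2⟩ := rigid A (φ.comp ι) (ψ.comp ι) g (hc.map φ) (hc.map ψ) hg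
    exact ⟨hext A φ ψ h1, h2⟩
  · intro A _ w hw
    obtain ⟨φ, g, hg⟩ := exists_hom A w hw
    obtain ⟨Φ, hΦ⟩ := hlift A φ fun a b c h => by
      rw [← det3_map]
      exact isUnit_det3_of_famMoves hg (hw.indep _ _ _ h)
    refine ⟨Φ, g, ?_⟩
    rw [← hΦ] at hg
    exact hg

/-- A family of vectors over a polynomial ring which satisfies all the dependences of `M`,
generically over each point of the base no others, and which up to automorphisms describes each
realization exactly once, gives the realization space. -/
theorem hasOpenRealizationSpace [Finite α] {R : Type u} [CommRing R] {N : ℕ}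
    (hM : IsSimpleRankThree M) (v : α → Fin 3 → MvPolynomial (ULift.{u} (Fin N)) R)
    (dep : ∀ a b c, ¬ M.IsBase {a, b, c} → det3 (v a) (v b) (v c) = 0)
    (indep : ∀ (F : Type u) [Field F] (f : R →+* F) (a b c : α), M.IsBase {a, b, c} →
      MvPolynomial.map f (det3 (v a) (v b) (v c)) ≠ 0)
    (rigid : ∀ (A : Type u) [CommRing A] (φ ψ : MvPolynomial (ULift.{u} (Fin N)) R →+* A)
      (g : GL (Fin 3) A), IsConfig M (fun a => φ ∘ v a) → IsConfig M (fun a => ψ ∘ v a) →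
      FamMoves g (famSpan fun a => φ ∘ v a) (famSpan fun a => ψ ∘ v a) →
        φ = ψ ∧ ∃ c : A, (g : Matrix (Fin 3) (Fin 3) A) = Matrix.scalar (Fin 3) c)
    (exists_hom : ∀ (A : Type u) [CommRing A] (w : α → Fin 3 → A), IsConfig M w →
      ∃ (φ : MvPolynomial (ULift.{u} (Fin N)) R →+* A) (g : GL (Fin 3) A),
        FamMoves g (famSpan w) (famSpan fun a => φ ∘ v a)) :
    HasOpenRealizationSpace M N R := by
  classical
  have := Fintype.ofFinite α
  -- The open subscheme is given by the product `d` of the determinants of all bases.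
  obtain ⟨d, hdvd, hunit, hd⟩ : ∃ d : MvPolynomial (ULift.{u} (Fin N)) R,
      (∀ a b c, M.IsBase {a, b, c} → det3 (v a) (v b) (v c) ∣ d) ∧
      (∀ (A : Type u) [CommRing A] (φ : MvPolynomial (ULift.{u} (Fin N)) R →+* A),
        (∀ a b c, M.IsBase {a, b, c} → IsUnit (φ (det3 (v a) (v b) (v c)))) → IsUnit (φ d)) ∧
      ∀ (F : Type u) [Field F] (f : R →+* F), MvPolynomial.map f d ≠ 0 := by
    let T : Finset (α × α × α) := Finset.univ.filter fun t => M.IsBase {t.1, t.2.1, t.2.2}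
    refine ⟨∏ t ∈ T, det3 (v t.1) (v t.2.1) (v t.2.2), fun a b c h => ?_, fun A _ φ h => ?_,
      fun F _ f => ?_⟩
    · exact Finset.dvd_prod_of_mem (fun t : α × α × α => det3 (v t.1) (v t.2.1) (v t.2.2))
        (a := (a, b, c)) (by simpa [T] using h)
    · rw [map_prod, IsUnit.prod_iff]
      exact fun t ht => h _ _ _ (Finset.mem_filter.1 ht).2
    · rw [map_prod, Finset.prod_ne_zero_iff]
      exact fun t ht => indep F f _ _ _ (Finset.mem_filter.1 ht).2
  have hc : IsConfig M fun a => algebraMap _ (Localization.Away d) ∘ v a :=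
    ⟨fun a b c h => by rw [det3_map, dep a b c h, map_zero], fun a b c h => by
      rw [det3_map]
      exact isUnit_of_dvd_unit (map_dvd _ (hdvd a b c h))
        (IsLocalization.Away.algebraMap_isUnit d)⟩
  exact hasOpenRealizationSpace_of_isRealizationSpace d hd
    ((isUniversalConfig_of_lift _ v hc
      (fun A _ φ ψ h => IsLocalization.ringHom_ext (Submonoid.powers d) h)
      (fun A _ φ h => ⟨_, IsLocalization.Away.lift_comp d (hunit A φ h)⟩)
      rigid exists_hom).isRealizationSpace hM)

end

/-! ### The zero ring and the theorem of Pappus -/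

section NonPappus

/-- Eight of the nine lines of the configuration of Pappus; the missing line is `{6, 7, 8}`. -/
def nonPappusLine : Fin 8 → Finset ℕ :=
  ![{0, 1, 2}, {3, 4, 5}, {0, 4, 6}, {1, 3, 6}, {0, 5, 7}, {2, 3, 7}, {1, 5, 8}, {2, 4, 8}]

/-- The collinear triples of the configuration in which Pappus' theorem fails, with further points
in general position. -/
def NonPappusCol {K : ℕ} (a b c : Fin K) : Prop :=
  a = b ∨ b = c ∨ a = c ∨
    ∃ i, (a : ℕ) ∈ nonPappusLine i ∧ (b : ℕ) ∈ nonPappusLine i ∧ (c : ℕ) ∈ nonPappusLine i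

lemma nonPappusLine_unique {i j : Fin 8} {a b : ℕ} (hab : a ≠ b) (hai : a ∈ nonPappusLine i)
    (hbi : b ∈ nonPappusLine i) (haj : a ∈ nonPappusLine j) (hbj : b ∈ nonPappusLine j) :
    i = j := by
  have h : ∀ i j : Fin 8, i ≠ j → (nonPappusLine i ∩ nonPappusLine j).card ≤ 1 := by decide
  by_contra hij
  exact hab (Finset.card_le_one.1 (h i j hij) a (Finset.mem_inter.2 ⟨hai, haj⟩) b
    (Finset.mem_inter.2 ⟨hbi, hbj⟩))

lemma exists_notMem_nonPappusLine (a b : ℕ) : ∃ c < 9, c ≠ a ∧ c ≠ b ∧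
    ∀ i, a ∈ nonPappusLine i → b ∈ nonPappusLine i → a ≠ b → c ∉ nonPappusLine i := by
  have hc : ∀ i, (nonPappusLine i).card = 3 := by decide
  by_cases h : a ≠ b ∧ ∃ i, a ∈ nonPappusLine i ∧ b ∈ nonPappusLine i
  · obtain ⟨hab, i, ha, hb⟩ := h
    obtain ⟨c, hc9, hci⟩ := Finset.exists_mem_notMem_of_card_lt_card
      (show (nonPappusLine i).card < (Finset.range 9).card by rw [hc]; decide)
    refine ⟨c, Finset.mem_range.1 hc9, ?_, ?_, fun j haj hbj _ => ?_⟩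
    · rintro rfl; exact hci ha
    · rintro rfl; exact hci hb
    · rwa [nonPappusLine_unique hab haj hbj ha hb]
  · obtain ⟨c, hc9, hci⟩ := Finset.exists_mem_notMem_of_card_lt_card
      (show ({a, b} : Finset ℕ).card < (Finset.range 9).card from
        (Finset.card_le_two).trans_lt (by decide))
    refine ⟨c, Finset.mem_range.1 hc9, ?_, ?_, fun j haj hbj hab => (h ⟨hab, j, haj, hbj⟩).elim⟩
    · rintro rfl; simp at hci
    · rintro rfl; simp at hci

lemma isCollinearity_nonPappusCol {K : ℕ} (hK : 9 ≤ K) :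
    IsCollinearity (NonPappusCol (K := K)) where
  rotate a b c := by
    rintro (h | h | h | ⟨i, h⟩)
    · exact Or.inr (Or.inr (Or.inl h.symm))
    · exact Or.inl h
    · exact Or.inr (Or.inl h.symm)
    · exact Or.inr (Or.inr (Or.inr ⟨i, by tauto⟩))
  swap a b c := by
    rintro (h | h | h | ⟨i, h⟩)
    · exact Or.inl h.symm
    · exact Or.inr (Or.inr (Or.inl h))
    · exact Or.inr (Or.inl h)
    · exact Or.inr (Or.inr (Or.inr ⟨i, by tauto⟩))
  refl a b := Or.inl rfl
  trans a b c d hab := by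
    rintro (h | h | h | ⟨i, ha, hb, hc⟩) h'
    · exact (hab h).elim
    · rwa [← h]
    · exact Or.inl h
    · rcases h' with h' | h' | h' | ⟨j, ha', hb', hd⟩
      · exact (hab h').elim
      · exact Or.inr (Or.inr (Or.inr ⟨i, ha, hc, h' ▸ hb⟩))
      · exact Or.inr (Or.inr (Or.inl h'))
      · obtain rfl := nonPappusLine_unique (Fin.val_ne_of_ne hab) ha hb ha' hb'
        exact Or.inr (Or.inr (Or.inr ⟨i, ha, hc, hd⟩))
  exists_not a b hab := by
    obtain ⟨c, hc, hca, hcb, h⟩ := exists_notMem_nonPappusLine a b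
    refine ⟨⟨c, by omega⟩, ?_⟩
    rintro (h' | h' | h' | ⟨i, h1, h2, h3⟩)
    · exact hab h'
    · exact hcb (congrArg Fin.val h').symm
    · exact hca (congrArg Fin.val h').symm
    · exact h i h1 h2 (Fin.val_ne_of_ne hab) h3

/-- A basis is taken to the standard basis by an automorphism. -/
lemma exists_mulVec_eq {A : Type u} [CommRing A] {u v w : Fin 3 → A} (h : IsUnit (det3 u v w)) :
    ∃ g : GL (Fin 3) A, (g : Matrix (Fin 3) (Fin 3) A).mulVec u = ![1, 0, 0] ∧
      (g : Matrix (Fin 3) (Fin 3) A).mulVec v = ![0, 1, 0] ∧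
      (g : Matrix (Fin 3) (Fin 3) A).mulVec w = ![0, 0, 1] := by
  let m : Matrix (Fin 3) (Fin 3) A := (Matrix.of ![u, v, w]).transpose
  have hm : IsUnit m.det := by
    rw [Matrix.det_transpose]
    exact h
  let g : GL (Fin 3) A := (Matrix.nonsingInvUnit m hm)⁻¹
  have hg : ∀ z, (g : Matrix (Fin 3) (Fin 3) A).mulVec (m.mulVec z) = z := fun z => by
    rw [Matrix.mulVec_mulVec]
    have : (g : Matrix (Fin 3) (Fin 3) A) * m = 1 := (Matrix.nonsingInvUnit m hm).inv_mul
    rw [this, Matrix.one_mulVec]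
  have h0 : m.mulVec ![1, 0, 0] = u := by
    ext i; fin_cases i <;> simp [m, Matrix.mulVec, dotProduct, Fin.sum_univ_three]
  have h1 : m.mulVec ![0, 1, 0] = v := by
    ext i; fin_cases i <;> simp [m, Matrix.mulVec, dotProduct, Fin.sum_univ_three]
  have h2 : m.mulVec ![0, 0, 1] = w := by
    ext i; fin_cases i <;> simp [m, Matrix.mulVec, dotProduct, Fin.sum_univ_three]
  refine ⟨g, ?_, ?_, ?_⟩
  · rw [← h0, hg]
  · rw [← h1, hg]
  · rw [← h2, hg]

/-- A configuration may be moved so that three given points in general position become the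
coordinate points. -/
lemma IsConfig.exists_normalize {α : Type} {M : Matroid α} {A : Type u} [CommRing A]
    {v : α → Fin 3 → A} (hv : IsConfig M v) {a b c : α} (h : M.IsBase {a, b, c}) :
    ∃ g : GL (Fin 3) A, IsConfig M (fun e => (g : Matrix (Fin 3) (Fin 3) A).mulVec (v e)) ∧
      (g : Matrix (Fin 3) (Fin 3) A).mulVec (v a) = ![1, 0, 0] ∧
      (g : Matrix (Fin 3) (Fin 3) A).mulVec (v b) = ![0, 1, 0] ∧
      (g : Matrix (Fin 3) (Fin 3) A).mulVec (v c) = ![0, 0, 1] := by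
  obtain ⟨g, h0, h1, h2⟩ := exists_mulVec_eq (hv.indep a b c h)
  have hu : IsUnit (g : Matrix (Fin 3) (Fin 3) A).det := (Matrix.isUnit_iff_isUnit_det _).1 g.isUnit
  refine ⟨g, ⟨fun x y z hn => ?_, fun x y z hb => ?_⟩, h0, h1, h2⟩
  · rw [det3_mulVec, hv.dep x y z hn, mul_zero]
  · rw [det3_mulVec]
    exact hu.mul (hv.indep x y z hb)

/-- The theorem of Pappus, for points in a normalized position: the points `0`, `1`, `3` of the
configuration are the coordinate points, `c`, `b'`, `c'` are the points `2`, `4`, `5`, and `x`, `y`,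
`z` are the points of intersection `6`, `7`, `8`. -/
lemma det3_eq_zero_of_pappus {F : Type*} [Field F] {b' c c' x y z : Fin 3 → F}
    (h1 : b' 1 ≠ 0) (h2 : c 0 ≠ 0) (h3 : c' 1 ≠ 0)
    (hc : c 2 = 0) (hc' : b' 0 * c' 1 = b' 1 * c' 0)
    (hx : b' 1 * x 2 = b' 2 * x 1) (hx' : x 0 = 0)
    (hy : c' 1 * y 2 = c' 2 * y 1) (hy' : c 0 * y 1 = c 1 * y 0)
    (hz : c' 0 * z 2 = c' 2 * z 0) (hz' : det3 b' c z = 0) : det3 x y z = 0 := by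
  rw [det3_eq] at hz' ⊢
  grind

/-- The non-Pappus configuration has no coordinates over a nonzero ring, since it has none over the
residue fields. -/
lemma subsingleton_of_isConfig_nonPappus {K : ℕ} (hK : 9 ≤ K) {A : Type u} [CommRing A]
    {v : Fin K → Fin 3 → A}
    (hv : IsConfig (isCollinearity_nonPappusCol hK).matroid v) : Subsingleton A := by
  by_contra hA
  rw [not_subsingleton_iff_nontrivial] at hA
  obtain ⟨m, hm⟩ := Ideal.exists_maximal A
  have hF : IsField (A ⧸ m) := (Ideal.Quotient.maximal_ideal_iff_isField_quotient m).1 hm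
  let : Field (A ⧸ m) := hF.toField
  have : Nontrivial (Fin K) := ⟨⟨⟨0, by omega⟩, ⟨1, by omega⟩, by simp⟩⟩
  have hb : ∀ a b c, (isCollinearity_nonPappusCol hK).matroid.IsBase {a, b, c} ↔
      ¬ NonPappusCol a b c := fun a b c => (isCollinearity_nonPappusCol hK).isBase_iff
  let e : Fin 9 → Fin K := Fin.castLE hK
  have hcol : ∀ i j k : Fin 9, NonPappusCol (e i) (e j) (e k) ↔ NonPappusCol i j k :=
    fun i j k => by simp [NonPappusCol, e, Fin.ext_iff]
  obtain ⟨g, hw, h0, h1, h3⟩ := (hv.map (Ideal.Quotient.mk m)).exists_normalize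
    (a := e 0) (b := e 1) (c := e 3) ((hb _ _ _).2 (by
      rw [hcol]; unfold NonPappusCol; decide))
  let w : Fin 9 → Fin 3 → A ⧸ m := fun i =>
    (g : Matrix (Fin 3) (Fin 3) (A ⧸ m)).mulVec (Ideal.Quotient.mk m ∘ v (e i))
  have hdep : ∀ i j k, NonPappusCol i j k → det3 (w i) (w j) (w k) = 0 := fun i j k h =>
    hw.dep _ _ _ fun h' => (hb _ _ _).1 h' ((hcol i j k).2 h)
  have hind : ∀ i j k, ¬ NonPappusCol i j k → det3 (w i) (w j) (w k) ≠ 0 := fun i j k h =>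
    (hw.indep _ _ _ ((hb _ _ _).2 fun h' => h ((hcol i j k).1 h'))).ne_zero
  have h0 : w 0 = ![1, 0, 0] := h0
  have h1 : w 1 = ![0, 1, 0] := h1
  have h3 : w 3 = ![0, 0, 1] := h3
  have n1 := hind 0 3 4 (by unfold NonPappusCol; decide)
  have n2 := hind 1 3 2 (by unfold NonPappusCol; decide)
  have n3 := hind 0 3 5 (by unfold NonPappusCol; decide)
  have d1 := hdep 0 1 2 (by unfold NonPappusCol; decide)
  have d2 := hdep 3 4 5 (by unfold NonPappusCol; decide)
  have d3 := hdep 0 4 6 (by unfold NonPappusCol; decide)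
  have d4 := hdep 1 3 6 (by unfold NonPappusCol; decide)
  have d5 := hdep 0 5 7 (by unfold NonPappusCol; decide)
  have d6 := hdep 2 3 7 (by unfold NonPappusCol; decide)
  have d7 := hdep 1 5 8 (by unfold NonPappusCol; decide)
  have d8 := hdep 4 2 8 (by unfold NonPappusCol; decide)
  refine hind 6 7 8 (by unfold NonPappusCol; decide) ?_
  rw [h0] at n1 n3 d1 d3 d5
  rw [h1] at n2 d1 d4 d7
  rw [h3] at n1 n2 n3 d2 d4 d6
  simp [det3_eq] at n1 n2 n3 d1 d2 d3 d4 d5 d6 d7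
  refine det3_eq_zero_of_pappus n1 n2 n3 d1 ?_ ?_ d4 ?_ ?_ ?_ d8
  · linear_combination d2
  · linear_combination d3
  · linear_combination d5
  · linear_combination -d6
  · linear_combination -d7

/-- Over the zero ring, the empty scheme is the realization space of a matroid without
realizations. -/
theorem hasOpenRealizationSpace_of_subsingleton {R : Type u} [CommRing R] [Subsingleton R]
    {K : ℕ} (hK : 9 ≤ K) (N : ℕ) :
    ∃ M : Matroid (Fin K), IsSimpleRankThree M ∧ HasOpenRealizationSpace M N R := by
  have : Nontrivial (Fin K) := ⟨⟨⟨0, by omega⟩, ⟨1, by omega⟩, by simp⟩⟩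
  have hM := (isCollinearity_nonPappusCol hK).isSimpleRankThree
  refine ⟨_, hM, hasOpenRealizationSpace hM (fun _ => 0) ?_ ?_ ?_ ?_⟩
  · intro a b c _
    exact Subsingleton.elim _ _
  · intro F _ f
    exact (one_ne_zero (f.map_one.symm.trans ((congrArg f (Subsingleton.elim 1 0)).trans
      f.map_zero))).elim
  · intro A _ φ ψ g _ _ _
    have : Subsingleton A := subsingleton_of_zero_eq_one
      (φ.map_zero.symm.trans ((congrArg φ (Subsingleton.elim 0 1)).trans φ.map_one))
    exact ⟨RingHom.ext fun _ => Subsingleton.elim _ _, 0, Subsingleton.elim _ _⟩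
  · intro A _ w hw
    have := subsingleton_of_isConfig_nonPappus hK hw
    exact ⟨MvPolynomial.eval₂Hom ⟨⟨⟨fun _ => 0, Subsingleton.elim _ _⟩,
      fun _ _ => Subsingleton.elim _ _⟩, Subsingleton.elim _ _,
      fun _ _ => Subsingleton.elim _ _⟩ 0, 1, fun a => Subsingleton.elim _ _⟩

end NonPappus

section
open Gadget Polynomial
variable {G : ℕ → Gadget}

/-! ### The marks of a realization -/

section Sim
variable {A : Type u} [CommRing A]

/-- The vectors `v` and `w` are coordinates of the same point. -/
def Sim (v w : Fin 3 → A) : Prop := ∃ c : Aˣ, v = (c : A) • w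

namespace Sim
variable {u v w u' v' w' : Fin 3 → A}

lemma symm (h : Sim v w) : Sim w v := by
  obtain ⟨c, rfl⟩ := h
  exact ⟨c⁻¹, by simp [smul_smul]⟩

lemma isUnit_det3 (hu : Sim u u') (hv : Sim v v') (hw : Sim w w') :
    IsUnit (det3 u v w) ↔ IsUnit (det3 u' v' w') := by
  obtain ⟨a, rfl⟩ := hu
  obtain ⟨b, rfl⟩ := hv
  obtain ⟨c, rfl⟩ := hw
  rw [det3_smul, IsUnit.mul_iff, IsUnit.mul_iff, IsUnit.mul_iff]
  simp

lemma det3_eq_zero (hu : Sim u u') (hv : Sim v v') (hw : Sim w w') :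
    det3 u v w = 0 ↔ det3 u' v' w' = 0 := by
  obtain ⟨a, rfl⟩ := hu
  obtain ⟨b, rfl⟩ := hv
  obtain ⟨c, rfl⟩ := hw
  rw [det3_smul, ← Units.val_mul, ← Units.val_mul, Units.mul_right_eq_zero]

lemma refl (v : Fin 3 → A) : Sim v v := ⟨1, by simp⟩

end Sim

lemma det3_smul_eq (u v z s : Fin 3 → A) :
    det3 u v z • s = det3 s v z • u + det3 u s z • v + det3 u v s • z := by
  ext i
  simp only [det3_eq, Pi.smul_apply, Pi.add_apply, smul_eq_mul]
  fin_cases i <;> simp <;> ring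

/-- A vector in the plane spanned by two vectors which are part of a basis is a combination of
them. -/
lemma exists_combination {u v z s : Fin 3 → A} (h : IsUnit (det3 u v z)) (hs : det3 u s v = 0) :
    ∃ a b : A, s = a • u + b • v := by
  obtain ⟨d, hd⟩ := h.exists_left_inv
  refine ⟨d * det3 s v z, d * det3 u s z, ?_⟩
  have h0 : det3 u v s = 0 := by rw [← neg_eq_zero, ← hs, det3_eq, det3_eq]; ring
  have := congrArg (d • ·) (det3_smul_eq u v z s)
  simp only [smul_smul, hd, one_smul, h0, zero_smul, add_zero, smul_add] at this
  exact this

/-- Two vectors which are part of a basis are independent. -/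
lemma eq_zero_of_smul_add_smul {u v z : Fin 3 → A} (h : IsUnit (det3 u v z)) {a b : A}
    (hab : a • u + b • v = 0) : a = 0 ∧ b = 0 := by
  have h0 : ∀ i, a * u i + b * v i = 0 := fun i => congrFun hab i
  constructor
  · rw [← h.mul_left_eq_zero, det3_eq]
    linear_combination (v 1 * z 2 - v 2 * z 1) * h0 0 - (v 0 * z 2 - v 2 * z 0) * h0 1
      + (v 0 * z 1 - v 1 * z 0) * h0 2
  · rw [← h.mul_left_eq_zero, det3_eq]
    linear_combination -(u 1 * z 2 - u 2 * z 1) * h0 0 + (u 0 * z 2 - u 2 * z 0) * h0 1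
      - (u 0 * z 1 - u 1 * z 0) * h0 2

/-- The intersection of the line through `n₁`, `a₁` and the line through `n₂`, `a₂`. -/
lemma sim_of_det3_eq_zero {X n₁ n₂ a₁ a₂ v : Fin 3 → A} {c₁ c₂ : A} (h₁ : det3 n₁ X a₁ = 0)
    (h₂ : det3 n₂ X a₂ = 0) (hX : IsUnit (det3 X a₁ a₂)) (hn : IsUnit (det3 n₁ a₁ a₂))
    (hv₁ : v = n₁ + c₁ • a₁) (hv₂ : v = n₂ + c₂ • a₂) : Sim X v := by
  obtain ⟨a, b, rfl⟩ := exists_combination hn h₁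
  have ha : IsUnit a := by
    have : det3 (a • n₁ + b • a₁) a₁ a₂ = a * det3 n₁ a₁ a₂ := by
      simp only [det3_eq, Pi.smul_apply, Pi.add_apply, smul_eq_mul]; ring
    rw [this] at hX
    exact isUnit_of_mul_isUnit_left hX
  have hb : b = a * c₁ := by
    obtain rfl : n₂ = n₁ + c₁ • a₁ - c₂ • a₂ := by rw [← hv₁, hv₂]; abel
    have : (b - a * c₁) * det3 n₁ a₁ a₂ = 0 := by
      rw [← h₂]
      simp only [det3_eq, Pi.smul_apply, Pi.add_apply, Pi.sub_apply, smul_eq_mul]; ring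
    rw [hn.mul_left_eq_zero] at this
    exact sub_eq_zero.1 this
  refine ⟨ha.unit, ?_⟩
  rw [hv₁, hb, IsUnit.unit_spec]
  module

end Sim

section Reconstruct
variable {A : Type u} [CommRing A] {L : ℕ} {w : ℕ × ℕ → Fin 3 → A}

/-- The pair `e` is an element of one of the first `L` blocks. -/
def InRange (G : ℕ → Gadget) (L : ℕ) (e : ℕ × ℕ) : Prop := e.1 < L ∧ e.2 < (G e.1).size

/-- The conditions on coordinates of a realization which are used in its reconstruction: `col` gives
the collinear triples, by `new` no element lies on the line through two elements of earlier blocks,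
by `line` the first two marks of a block are different, and by `ineq` so are the marks with the
values of the two sides of an inequality. Being different is expressed by means of the auxiliary
point `p 1`. -/
structure IsRealized (G : ℕ → Gadget) (L : ℕ) (w : ℕ × ℕ → Fin 3 → A) : Prop where
  three_le : 3 ≤ L
  col : ∀ e₁ e₂ e₃, InRange G L e₁ → InRange G L e₂ → InRange G L e₃ → Related.{u} G e₁ e₂ e₃ →
    det3 (w e₁) (w e₂) (w e₃) = 0
  new : ∀ e₁ e₂ e₃, InRange G L e₁ → InRange G L e₂ → InRange G L e₃ → e₂.1 < e₁.1 →
    e₃.1 < e₁.1 → e₂ ≠ e₃ → IsUnit (det3 (w e₁) (w e₂) (w e₃))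
  line : ∀ l, 2 ≤ l → l < L → IsUnit (det3 (w (l, 0)) (w (l, 1)) (w (1, 0)))
  ineq : ∀ l j k, l < L → G l = Gadget.ineq j k → IsUnit (det3 (w (l, 2)) (w (l, 5)) (w (1, 0)))

/-- The vectors `p` and the values `x` describe the marks of the realization `w`. -/
structure IsMarked (G : ℕ → Gadget) (L : ℕ) (w : ℕ × ℕ → Fin 3 → A) (x : ℕ → A)
    (p : ℕ → Fin 3 → A) : Prop where
  one : x 1 = 1
  mark_zero : ∀ l < L, Sim (w (l, 0)) (p l)
  mark_one : ∀ l < L, 1 ≤ l → Sim (w (l, 1)) (p l + p 0)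
  mark_two : ∀ l < L, (G l).IsNonconst → Sim (w (l, 2)) (p l + x l • p 0)

lemma size_pos (g : Gadget) : 0 < g.size := by cases g <;> simp [size]

lemma WellFormed.one_lt_size (h : WellFormed G) {l : ℕ} (hl : 1 ≤ l) : 1 < (G l).size := by
  rcases hG : G l with _ | _ | _ | _ | _ | _ | _ <;> simp [size]
  have := (h.pole_iff l).1 hG
  omega

lemma two_lt_size {g : Gadget} (h : g.IsNonconst) : 2 < g.size := by
  cases g <;> simp_all [size, IsNonconst]

namespace IsRealized
variable (h : WellFormed G) (hw : IsRealized G L w)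
include h hw

omit h in
lemma exists_isUnit_det3 {l : ℕ} (hl : l < L) (hl1 : 1 ≤ l) :
    ∃ z, ∀ i < (G l).size, IsUnit (det3 (w (l, i)) (w (0, 0)) z) := by
  have hL := hw.three_le
  have i0 : InRange G L (0, 0) := ⟨by omega, size_pos _⟩
  by_cases h2 : 2 ≤ l
  · exact ⟨w (1, 0), fun i hi => hw.new _ _ _ ⟨hl, hi⟩ i0 ⟨by simp; omega, size_pos _⟩
      (by simp; omega) (by simp; omega) (by simp)⟩
  · obtain rfl : l = 1 := by omega
    refine ⟨w (2, 0), fun i hi => ?_⟩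
    have := hw.new (2, 0) (1, i) (0, 0) ⟨by simp; omega, size_pos _⟩ ⟨hl, hi⟩ i0 (by simp)
      (by simp) (by simp)
    rw [← IsUnit.neg_iff]
    convert this.neg using 2
    simp only [det3_eq]; ring

omit h in
/-- The marks lie on the line through `p l` and `p 0`, and they are different from `p 0`. -/
lemma exists_mark {l i : ℕ} (hl : l < L) (hl1 : 1 ≤ l) (hi : i < (G l).size)
    (hr : Related.{u} G (l, 0) (l, i) (0, 0)) :
    ∃ (a : Aˣ) (b : A), w (l, i) = (a : A) • w (l, 0) + b • w (0, 0) := by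
  have hL := hw.three_le
  have i0 : InRange G L (0, 0) := ⟨by omega, size_pos _⟩
  have il : InRange G L (l, 0) := ⟨hl, size_pos _⟩
  have ii : InRange G L (l, i) := ⟨hl, hi⟩
  obtain ⟨z, hz⟩ := hw.exists_isUnit_det3 hl hl1
  obtain ⟨a, b, hab⟩ := exists_combination (hz 0 (size_pos _)) (hw.col _ _ _ il ii i0 hr)
  have ha : IsUnit a := by
    have h1 := hz i hi
    rw [hab, show det3 (a • w (l, 0) + b • w (0, 0)) (w (0, 0)) z =
      a * det3 (w (l, 0)) (w (0, 0)) z by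
        simp only [det3_eq, Pi.smul_apply, Pi.add_apply, smul_eq_mul]; ring] at h1
    exact isUnit_of_mul_isUnit_left h1
  exact ⟨ha.unit, b, hab⟩

/-- The vector `p l` may be scaled such that the mark number `1` has the coordinates `p l + p 0`. -/
lemma exists_scale {l : ℕ} (hl : l < L) (hl1 : 1 ≤ l) :
    ∃ q, Sim (w (l, 0)) q ∧ Sim (w (l, 1)) (q + w (0, 0)) := by
  have hL := hw.three_le
  obtain ⟨a, b, hab⟩ := hw.exists_mark hl hl1 (h.one_lt_size hl1) (related_of fun A _ x _ p =>
    ⟨1, by rw [vec_zero, vec_zero, vec_one x p h (by omega)]; module⟩)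
  have hb : IsUnit b := by
    by_cases h2 : 2 ≤ l
    · have h1 := hw.line l h2 hl
      rw [hab, show det3 (w (l, 0)) ((a : A) • w (l, 0) + b • w (0, 0)) (w (1, 0)) =
        b * det3 (w (l, 0)) (w (0, 0)) (w (1, 0)) by
          simp only [det3_eq, Pi.smul_apply, Pi.add_apply, smul_eq_mul]; ring] at h1
      exact isUnit_of_mul_isUnit_left h1
    · obtain rfl : l = 1 := by omega
      have h1 := hw.new (2, 0) (1, 0) (1, 1) ⟨by simp; omega, size_pos _⟩ ⟨hl, size_pos _⟩
        ⟨hl, h.one_lt_size le_rfl⟩ (by simp) (by simp) (by simp)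
      rw [hab, show det3 (w (2, 0)) (w (1, 0)) ((a : A) • w (1, 0) + b • w (0, 0)) =
        b * det3 (w (2, 0)) (w (1, 0)) (w (0, 0)) by
          simp only [det3_eq, Pi.smul_apply, Pi.add_apply, smul_eq_mul]; ring] at h1
      exact isUnit_of_mul_isUnit_left h1
  refine ⟨((hb.unit⁻¹ * a : Aˣ) : A) • w (l, 0), Sim.symm ⟨hb.unit⁻¹ * a, rfl⟩, hb.unit, ?_⟩
  rw [hab, smul_add, smul_smul, ← Units.val_mul]
  simp

/-- The values of the variables can be read off from the marks. The value of the frame is set to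
`1`. -/
lemma exists_isMarked : ∃ x p, IsMarked G L w x p := by
  have hL := hw.three_le
  have h1 : ∀ l, ∃ q, l < L → Sim (w (l, 0)) q ∧ (1 ≤ l → Sim (w (l, 1)) (q + w (0, 0))) ∧
      (l = 0 → q = w (0, 0)) := by
    intro l
    by_cases hl : l < L
    · by_cases hl1 : 1 ≤ l
      · obtain ⟨q, hq⟩ := exists_scale h hw hl hl1
        exact ⟨q, fun _ => ⟨hq.1, fun _ => hq.2, by omega⟩⟩
      · obtain rfl : l = 0 := by omega
        exact ⟨w (0, 0), fun _ => ⟨Sim.refl _, by omega, fun _ => rfl⟩⟩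
    · exact ⟨0, fun h => (hl h).elim⟩
  choose p hp using h1
  have hp0 : p 0 = w (0, 0) := (hp 0 (by omega)).2.2 rfl
  have h2 : ∀ l, ∃ c : A, l < L → (G l).IsNonconst → Sim (w (l, 2)) (p l + c • p 0) := by
    intro l
    by_cases hl : l < L ∧ (G l).IsNonconst
    · have hl2 := h.two_le_of_isNonconst hl.2
      obtain ⟨a, b, hab⟩ := hw.exists_mark hl.1 (by omega) (two_lt_size hl.2)
        (related_of fun A _ x _ p => ⟨x l, by
          rw [vec_zero, vec_zero, vec_two x p hl.2]; module⟩)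
      obtain ⟨c, hc⟩ := (hp l hl.1).1
      refine ⟨((a * c)⁻¹ : Aˣ) * b, fun _ _ => ⟨a * c, ?_⟩⟩
      rw [hab, hc, hp0, smul_add, smul_smul, smul_smul, ← mul_assoc, ← Units.val_mul,
        ← Units.val_mul]
      simp
    · exact ⟨0, fun h3 h4 => (hl ⟨h3, h4⟩).elim⟩
  choose y hy using h2
  refine ⟨fun l => if l = 1 then 1 else y l, p, by simp, fun l hl => (hp l hl).1,
    fun l hl hl1 => ?_, fun l hl hn => ?_⟩
  · rw [hp0]
    exact (hp l hl).2.1 hl1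
  · have := h.two_le_of_isNonconst hn
    simp only [show l ≠ 1 by omega, if_false]
    exact hy l hl hn

variable {x : ℕ → A} {p : ℕ → Fin 3 → A}

omit h in
/-- An element which is collinear with two pairs of known elements, on different lines, is known: it
is the intersection of the lines. -/
lemma sim_of_related {l i i₁ i₂ : ℕ} {e₁ e₂ : ℕ × ℕ} {v : Fin 3 → A} {c₁ c₂ : A} (hl : l < L)
    (hi : i < (G l).size) (hi₁ : i₁ < (G l).size) (hi₂ : i₂ < (G l).size)
    (he₁ : InRange G L e₁) (he₂ : InRange G L e₂)
    (h₁ : e₁.1 < l) (h₂ : e₂.1 < l) (hne : e₁ ≠ e₂)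
    (k₁ : Sim (w (l, i₁)) (vec G x p (l, i₁))) (k₂ : Sim (w (l, i₂)) (vec G x p (l, i₂)))
    (k₃ : Sim (w e₁) (vec G x p e₁)) (k₄ : Sim (w e₂) (vec G x p e₂))
    (r₁ : Related.{u} G (l, i₁) (l, i) e₁) (r₂ : Related.{u} G (l, i₂) (l, i) e₂)
    (hv₁ : v = vec G x p (l, i₁) + c₁ • vec G x p e₁)
    (hv₂ : v = vec G x p (l, i₂) + c₂ • vec G x p e₂) : Sim (w (l, i)) v :=
  sim_of_det3_eq_zero ((k₁.det3_eq_zero (Sim.refl _) k₃).1 (hw.col _ _ _ ⟨hl, hi₁⟩ ⟨hl, hi⟩ he₁ r₁))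
    ((k₂.det3_eq_zero (Sim.refl _) k₄).1 (hw.col _ _ _ ⟨hl, hi₂⟩ ⟨hl, hi⟩ he₂ r₂))
    (((Sim.refl _).isUnit_det3 k₃ k₄).1 (hw.new _ _ _ ⟨hl, hi⟩ he₁ he₂ h₁ h₂ hne))
    ((k₁.isUnit_det3 k₃ k₄).1 (hw.new _ _ _ ⟨hl, hi₁⟩ he₁ he₂ h₁ h₂ hne)) hv₁ hv₂

end IsRealized
end Reconstruct

/-! ### Reconstruction of a realization from its marks -/

section Reconstruct
variable {A : Type u} [CommRing A] {L : ℕ} {w : ℕ × ℕ → Fin 3 → A}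

/-- The element which is the mark with the value of a variable. -/
lemma exists_val (G : ℕ → Gadget) {j : ℕ} (hj : (G j).IsVal) (h : WellFormed G) :
    ∃ i, i < (G j).size ∧ i ≠ 0 ∧ ∀ (A : Type u) [CommRing A] (x : ℕ → A) (p : ℕ → Fin 3 → A),
      x 1 = 1 → vec G x p (j, i) = p j + x j • p 0 := by
  by_cases hn : (G j).IsNonconst
  · exact ⟨2, two_lt_size hn, by simp, fun A _ x p _ => vec_two x p hn⟩
  · have : j = 1 := by
      rw [← h.frame_iff]
      cases hG : G j <;> simp_all [IsVal, IsNonconst]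
    exact ⟨1, by subst this; rw [h.G_one]; simp [size], by simp,
      fun A _ x p hx => vec_val x p h hx (Or.inl ⟨rfl, this⟩)⟩

namespace IsRealized
variable {x : ℕ → A} {p : ℕ → Fin 3 → A} (h : WellFormed G) (hw : IsRealized G L w)
  (hm : IsMarked G L w x p)
include h hw hm

omit h hw in
lemma sim_zero {l : ℕ} (hl : l < L) : Sim (w (l, 0)) (vec G x p (l, 0)) := by
  rw [vec_zero]; exact hm.mark_zero l hl

omit hw in
lemma sim_one {l : ℕ} (hl : l < L) (hl1 : 1 ≤ l) : Sim (w (l, 1)) (vec G x p (l, 1)) := by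
  rw [vec_one x p h (by omega)]
  exact hm.mark_one l hl hl1

omit h hw in
lemma sim_two {l : ℕ} (hl : l < L) (hn : (G l).IsNonconst) :
    Sim (w (l, 2)) (vec G x p (l, 2)) := by
  rw [vec_two x p hn]
  exact hm.mark_two l hl hn

omit h in
/-- The intersection argument for an element `(l, i)` whose vector differs from two others of its
block by multiples of `vec G x p e₁` and `vec G x p e₂`, identically. -/
lemma sim_vec {l i i₁ i₂ : ℕ} {e₁ e₂ : ℕ × ℕ} (hl : l < L)
    (ih : ∀ e, InRange G L e → e.1 < l → Sim (w e) (vec G x p e))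
    (hi : i < (G l).size) (hi₁ : i₁ < (G l).size) (hi₂ : i₂ < (G l).size)
    (h₁ : e₁.1 < l ∧ e₁.2 < (G e₁.1).size) (h₂ : e₂.1 < l ∧ e₂.2 < (G e₂.1).size) (hne : e₁ ≠ e₂)
    (k₁ : Sim (w (l, i₁)) (vec G x p (l, i₁))) (k₂ : Sim (w (l, i₂)) (vec G x p (l, i₂)))
    (c₁ c₂ : ∀ (A : Type u) [CommRing A], (ℕ → A) → A)
    (H₁ : ∀ (A : Type u) [CommRing A] (x : ℕ → A) (p : ℕ → Fin 3 → A), x 1 = 1 →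
      vec G x p (l, i) = vec G x p (l, i₁) + c₁ A x • vec G x p e₁)
    (H₂ : ∀ (A : Type u) [CommRing A] (x : ℕ → A) (p : ℕ → Fin 3 → A), x 1 = 1 →
      vec G x p (l, i) = vec G x p (l, i₂) + c₂ A x • vec G x p e₂) :
    Sim (w (l, i)) (vec G x p (l, i)) :=
  have r₁ : InRange G L e₁ := ⟨h₁.1.trans hl, h₁.2⟩
  have r₂ : InRange G L e₂ := ⟨h₂.1.trans hl, h₂.2⟩
  hw.sim_of_related hl hi hi₁ hi₂ r₁ r₂ h₁.1 h₂.1 hne k₁ k₂ (ih _ r₁ h₁.1) (ih _ r₂ h₂.1)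
    (related_of fun A _ x hx p => ⟨c₁ A x, by rw [H₁ A x p hx.one]; abel⟩)
    (related_of fun A _ x hx p => ⟨c₂ A x, by rw [H₂ A x p hx.one]; abel⟩)
    (H₁ A x p hm.one) (H₂ A x p hm.one)

omit h in
/-- The value of a mark is determined by the point. -/
lemma mark_unique {l : ℕ} (hl : l < L) (hl2 : 2 ≤ l) {v : Fin 3 → A} {b c : A}
    (h₁ : Sim v (p l + b • p 0)) (h₂ : Sim v (p l + c • p 0)) : b = c := by
  have h3 := hw.new (l, 0) (0, 0) (1, 0) ⟨hl, size_pos _⟩ ⟨by simp; omega, size_pos _⟩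
    ⟨by simp; omega, size_pos _⟩ (by simp; omega) (by simp; omega) (by simp)
  rw [(hm.mark_zero l hl).isUnit_det3 (hm.mark_zero 0 (by omega)) (Sim.refl _)] at h3
  obtain ⟨u, rfl⟩ := h₁
  obtain ⟨u', hu⟩ := h₂
  have h4 := eq_zero_of_smul_add_smul h3 (a := (u : A) - u') (b := u * b - u' * c) (by
    rw [← sub_eq_zero] at hu
    rw [← hu]
    module)
  have h5 : (u : A) = u' := sub_eq_zero.1 h4.1
  have h6 := h4.2
  rw [← h5, ← mul_sub, Units.mul_right_eq_zero, sub_eq_zero] at h6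
  exact h6

/-- The block of an addition is reconstructed from the earlier ones by intersecting lines, and the
mark with the value of the variable is the expected one. -/
lemma realize_add {l j k : ℕ} (hG : G l = Gadget.add j k) (hl : l < L)
    (ih : ∀ e, InRange G L e → e.1 < l → Sim (w e) (vec G x p e)) :
    x l = x j + x k ∧ ∀ i < 7, Sim (w (l, i)) (vec G x p (l, i)) := by
  obtain ⟨hj, hk, hjk, vj, nk⟩ := h.add _ _ _ hG
  have hj1 := h.pos_of_isVal vj
  have hk2 := h.two_le_of_isNonconst nk
  have hL := hw.three_le
  obtain ⟨ij, hij, hij0, hvj⟩ := exists_val.{u} G vj h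
  have hs : ∀ i < 7, i < (G l).size := by rw [hG]; exact fun i hi => hi
  have nl : (G l).IsNonconst := by rw [hG]; trivial
  have k0 := sim_zero hm hl
  have k1 := sim_one h hm hl (by omega)
  have k2 := sim_two hm hl nl
  have hv : ∀ (A : Type u) [CommRing A] (x : ℕ → A) (p : ℕ → Fin 3 → A) i, vec G x p (l, i) =
      p l + (coeff₁ (linked G l) x (Gadget.add j k) i) • p j
        + (coeff₂ (linked G l) (Gadget.add j k) i : A) • p k
        + (coeff₀ (linked G l) x l (Gadget.add j k) i) • p 0 := by
    intro A _ x p i; simp [vec, hG, src₁, src₂]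
  have s0 : (0, 0).1 < l ∧ (0, 0).2 < (G (0, 0).1).size := ⟨by simp; omega, size_pos _⟩
  have sj : 1 < (G j).size := h.one_lt_size hj1
  have sk : 1 < (G k).size := h.one_lt_size (by omega)
  have sk2 : 2 < (G k).size := two_lt_size nk
  have k3 : Sim (w (l, 3)) (vec G x p (l, 3)) :=
    hw.sim_vec hm hl ih (i₁ := 0) (i₂ := 1) (e₁ := (j, 0)) (e₂ := (j, 1)) (hs _ (by omega))
      (hs _ (by omega)) (hs _ (by omega)) ⟨hj, size_pos _⟩ ⟨hj, sj⟩ (by simp) k0 k1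
      (fun _ _ _ => -1) (fun _ _ _ => -1)
      (fun A _ x p hx => by rw [vec_zero x p j, hv, hv]; simp [coeff₀, coeff₁, coeff₂])
      (fun A _ x p hx => by
        rw [vec_one x p h (show j ≠ 0 by omega), hv, hv]; simp [coeff₀, coeff₁, coeff₂]; module)
  have k456 : Sim (w (l, 4)) (vec G x p (l, 4)) ∧ Sim (w (l, 5)) (vec G x p (l, 5)) ∧
      Sim (w (l, 6)) (vec G x p (l, 6)) := by
    cases hlk : linked G l
    · have k5 : Sim (w (l, 5)) (vec G x p (l, 5)) :=
        hw.sim_vec hm hl ih (i₁ := 0) (i₂ := 1) (e₁ := (k, 0)) (e₂ := (k, 1)) (hs _ (by omega))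
          (hs _ (by omega)) (hs _ (by omega)) ⟨hk, size_pos _⟩ ⟨hk, sk⟩ (by simp) k0 k1
          (fun _ _ _ => -1) (fun _ _ _ => -1)
          (fun A _ x p hx => by rw [vec_zero x p k, hv, hv, hlk]; simp [coeff₀, coeff₁, coeff₂])
          (fun A _ x p hx => by
            rw [vec_one x p h (show k ≠ 0 by omega), hv, hv, hlk]
            simp [coeff₀, coeff₁, coeff₂]; module)
      have k6 : Sim (w (l, 6)) (vec G x p (l, 6)) :=
        hw.sim_vec hm hl ih (i₁ := 3) (i₂ := 5) (e₁ := (k, 0)) (e₂ := (j, 0)) (hs _ (by omega))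
          (hs _ (by omega)) (hs _ (by omega)) ⟨hk, size_pos _⟩ ⟨hj, size_pos _⟩
          (by simp [hjk.symm]) k3 k5 (fun _ _ _ => -1) (fun _ _ _ => -1)
          (fun A _ x p hx => by
            rw [vec_zero x p k, hv, hv, hlk]; simp [coeff₀, coeff₁, coeff₂])
          (fun A _ x p hx => by
            rw [vec_zero x p j, hv, hv, hlk]; simp [coeff₀, coeff₁, coeff₂]; module)
      refine ⟨hw.sim_vec hm hl ih (i₁ := 3) (i₂ := 6) (e₁ := (0, 0)) (e₂ := (k, 2))
        (hs _ (by omega)) (hs _ (by omega)) (hs _ (by omega)) s0 ⟨hk, sk2⟩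
        (by simp) k3 k6 (fun _ _ x => x k) (fun _ _ _ => 1)
        (fun A _ x p hx => by
          rw [vec_zero x p 0, hv, hv, hlk]; simp [coeff₀, coeff₁, coeff₂])
        (fun A _ x p hx => by
          rw [vec_two x p nk, hv, hv, hlk]; simp [coeff₀, coeff₁, coeff₂]), k5, k6⟩
    · have hc : (G k).hasCenter j := by simpa [linked, hG, src₁, src₂] using hlk
      have sk3 : 3 < (G k).size := by
        cases hGk : G k <;> simp_all [hasCenter, size]
      have k5 : Sim (w (l, 5)) (vec G x p (l, 5)) :=
        hw.sim_vec hm hl ih (i₁ := 1) (i₂ := 3) (e₁ := (k, 3)) (e₂ := (k, 1)) (hs _ (by omega))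
          (hs _ (by omega)) (hs _ (by omega)) ⟨hk, sk3⟩ ⟨hk, sk⟩ (by simp) k1 k3
          (fun _ _ _ => 1) (fun _ _ _ => 1)
          (fun A _ x p hx => by
            rw [vec_center x p hc, hv, hv, hlk]; simp [coeff₀, coeff₁, coeff₂]; module)
          (fun A _ x p hx => by
            rw [vec_one x p h (show k ≠ 0 by omega), hv, hv, hlk]
            simp [coeff₀, coeff₁, coeff₂]; module)
      have k6 : Sim (w (l, 6)) (vec G x p (l, 6)) :=
        hw.sim_vec hm hl ih (i₁ := 5) (i₂ := 3) (e₁ := (0, 0)) (e₂ := (k, 2)) (hs _ (by omega))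
          (hs _ (by omega)) (hs _ (by omega)) s0 ⟨hk, sk2⟩
          (by simp) k5 k3 (fun _ _ x => x k - 1) (fun _ _ _ => 1)
          (fun A _ x p hx => by
            rw [vec_zero x p 0, hv, hv, hlk]; simp [coeff₀, coeff₁, coeff₂]; module)
          (fun A _ x p hx => by
            rw [vec_two x p nk, hv, hv, hlk]; simp [coeff₀, coeff₁, coeff₂]; module)
      refine ⟨hw.sim_vec hm hl ih (i₁ := 3) (i₂ := 6) (e₁ := (0, 0)) (e₂ := (k, 0))
        (hs _ (by omega)) (hs _ (by omega)) (hs _ (by omega)) s0 ⟨hk, size_pos _⟩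
        (by simp; omega) k3 k6 (fun _ _ x => x k) (fun _ _ _ => -1)
        (fun A _ x p hx => by
          rw [vec_zero x p 0, hv, hv, hlk]; simp [coeff₀, coeff₁, coeff₂])
        (fun A _ x p hx => by
          rw [vec_zero x p k, hv, hv, hlk]; simp [coeff₀, coeff₁, coeff₂]; module), k5, k6⟩
  refine ⟨hw.mark_unique hm hl (by omega) (hm.mark_two l hl nl)
    (hw.sim_of_related hl (hs _ (by omega)) (hs 0 (by omega)) (hs 4 (by omega)) (e₁ := (0, 0))
      (e₂ := (j, ij)) (c₁ := x j + x k) (c₂ := 1) ⟨s0.1.trans hl, s0.2⟩ ⟨hj.trans hl, hij⟩ s0.1 hj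
      (by simp; omega) k0 k456.1 (sim_zero hm (by omega)) (ih _ ⟨hj.trans hl, hij⟩ hj)
      (related_of fun A _ x _ p => ⟨x l, by rw [vec_zero, vec_zero, vec_two x p nl]; module⟩)
      (related_of fun A _ x hx p => ⟨1, by
        rw [vec_two x p nl, hv, hvj A x p hx.one, hx.add _ _ _ hG]
        simp [coeff₀, coeff₁, coeff₂]; module⟩)
      (by rw [vec_zero, vec_zero])
      (by rw [hvj A x p hm.one, hv]; simp [coeff₀, coeff₁, coeff₂]; module)), fun i hi => ?_⟩
  interval_cases i
  exacts [k0, k1, k2, k3, k456.1, k456.2.1, k456.2.2]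

/-- The block of a multiplication is reconstructed from the earlier ones by intersecting lines, and
the mark with the value of the variable is the expected one. -/
lemma realize_mul {l j k : ℕ} (hG : G l = Gadget.mul j k) (hl : l < L)
    (ih : ∀ e, InRange G L e → e.1 < l → Sim (w e) (vec G x p e)) :
    x l = x j * x k ∧ ∀ i < 6, Sim (w (l, i)) (vec G x p (l, i)) := by
  obtain ⟨hj, hk, nj, nk⟩ := h.mul _ _ _ hG
  have hj2 := h.two_le_of_isNonconst nj
  have hk2 := h.two_le_of_isNonconst nk
  have hL := hw.three_le
  have hs : ∀ i < 6, i < (G l).size := by rw [hG]; exact fun i hi => hi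
  have nl : (G l).IsNonconst := by rw [hG]; trivial
  have k0 := sim_zero hm hl
  have k1 := sim_one h hm hl (by omega)
  have k2 := sim_two hm hl nl
  have hv : ∀ (A : Type u) [CommRing A] (x : ℕ → A) (p : ℕ → Fin 3 → A) i, vec G x p (l, i) =
      p l + (coeff₁ (linked G l) x (Gadget.mul j k) i) • p j
        + (coeff₂ (linked G l) (Gadget.mul j k) i : A) • p k
        + (coeff₀ (linked G l) x l (Gadget.mul j k) i) • p 0 := by
    intro A _ x p i; simp [vec, hG, src₁, src₂]
  have s0 : (0, 0).1 < l ∧ (0, 0).2 < (G (0, 0).1).size := ⟨by simp; omega, size_pos _⟩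
  have sj : 1 < (G j).size := h.one_lt_size (by omega)
  have sk : 1 < (G k).size := h.one_lt_size (by omega)
  have k3 : Sim (w (l, 3)) (vec G x p (l, 3)) :=
    hw.sim_vec hm hl ih (i₁ := 0) (i₂ := 1) (e₁ := (k, 0)) (e₂ := (k, 1)) (hs _ (by omega))
      (hs _ (by omega)) (hs _ (by omega)) ⟨hk, size_pos _⟩ ⟨hk, sk⟩ (by simp) k0 k1
      (fun _ _ _ => -1) (fun _ _ _ => -1)
      (fun A _ x p hx => by rw [vec_zero x p k, hv, hv]; simp [coeff₀, coeff₁, coeff₂])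
      (fun A _ x p hx => by
        rw [vec_one x p h (show k ≠ 0 by omega), hv, hv]; simp [coeff₀, coeff₁, coeff₂]; module)
  have k4 : Sim (w (l, 4)) (vec G x p (l, 4)) :=
    hw.sim_vec hm hl ih (i₁ := 0) (i₂ := 3) (e₁ := (0, 0)) (e₂ := (k, 2)) (hs _ (by omega))
      (hs _ (by omega)) (hs _ (by omega)) s0 ⟨hk, two_lt_size nk⟩ (by simp) k0 k3
      (fun _ _ x => x k) (fun _ _ _ => 1)
      (fun A _ x p hx => by rw [vec_zero x p 0, hv, hv]; simp [coeff₀, coeff₁, coeff₂])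
      (fun A _ x p hx => by
        rw [vec_two x p nk, hv, hv]; simp [coeff₀, coeff₁, coeff₂])
  have k5 : Sim (w (l, 5)) (vec G x p (l, 5)) :=
    hw.sim_vec hm hl ih (i₁ := 0) (i₂ := 4) (e₁ := (j, 0)) (e₂ := (j, 1)) (hs _ (by omega))
      (hs _ (by omega)) (hs _ (by omega)) ⟨hj, size_pos _⟩ ⟨hj, sj⟩ (by simp) k0 k4
      (fun _ _ x => - x k) (fun _ _ x => - x k)
      (fun A _ x p hx => by rw [vec_zero x p j, hv, hv]; simp [coeff₀, coeff₁, coeff₂])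
      (fun A _ x p hx => by
        rw [vec_one x p h (show j ≠ 0 by omega), hv, hv]; simp [coeff₀, coeff₁, coeff₂]; module)
  refine ⟨hw.mark_unique hm hl (by omega) (hm.mark_two l hl nl)
    (hw.sim_of_related hl (hs _ (by omega)) (hs 0 (by omega)) (hs 5 (by omega)) (e₁ := (0, 0))
      (e₂ := (j, 2)) (c₁ := x j * x k) (c₂ := x k) ⟨s0.1.trans hl, s0.2⟩
      ⟨hj.trans hl, two_lt_size nj⟩ s0.1 hj
      (by simp) k0 k5 (sim_zero hm (by omega)) (ih _ ⟨hj.trans hl, two_lt_size nj⟩ hj)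
      (related_of fun A _ x _ p => ⟨x l, by rw [vec_zero, vec_zero, vec_two x p nl]; module⟩)
      (related_of fun A _ x hx p => ⟨x k, by
        rw [vec_two x p nl, hv, vec_two x p nj, hx.mul _ _ _ hG]
        simp [coeff₀, coeff₁, coeff₂]; module⟩)
      (by rw [vec_zero, vec_zero])
      (by rw [vec_two x p nj, hv]; simp [coeff₀, coeff₁, coeff₂]; module)), fun i hi => ?_⟩
  interval_cases i
  exacts [k0, k1, k2, k3, k4, k5]

/-- The block of an equation is reconstructed by intersecting lines; the mark `p l + x j • p 0` is
also the projection of the mark of the variable `k`, and hence the values agree. -/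
lemma realize_eq {l j k : ℕ} (hG : G l = Gadget.eq j k) (hl : l < L)
    (ih : ∀ e, InRange G L e → e.1 < l → Sim (w e) (vec G x p e)) :
    (k ≠ 1 → x j = x k) ∧ ∀ i < 5, Sim (w (l, i)) (vec G x p (l, i)) := by
  obtain ⟨hj, hk, hjk, nj, vk⟩ := h.eq _ _ _ hG
  have hj2 := h.two_le_of_isNonconst nj
  have hk1 := h.pos_of_isVal vk
  have hL := hw.three_le
  have hs : ∀ i < 5, i < (G l).size := by rw [hG]; exact fun i hi => hi
  have k0 := sim_zero hm hl
  have k1 := sim_one h hm hl (by omega)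
  have hv : ∀ (A : Type u) [CommRing A] (x : ℕ → A) (p : ℕ → Fin 3 → A) i, vec G x p (l, i) =
      p l + (coeff₁ (linked G l) x (Gadget.eq j k) i) • p j
        + (coeff₂ (linked G l) (Gadget.eq j k) i : A) • p k
        + (coeff₀ (linked G l) x l (Gadget.eq j k) i) • p 0 := by
    intro A _ x p i; simp [vec, hG, src₁, src₂]
  have s0 : (0, 0).1 < l ∧ (0, 0).2 < (G (0, 0).1).size := ⟨by simp; omega, size_pos _⟩
  have sj : 1 < (G j).size := h.one_lt_size (by omega)
  have sk : 1 < (G k).size := h.one_lt_size hk1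
  have k3 : Sim (w (l, 3)) (vec G x p (l, 3)) :=
    hw.sim_vec hm hl ih (i₁ := 0) (i₂ := 1) (e₁ := (j, 0)) (e₂ := (j, 1)) (hs _ (by omega))
      (hs _ (by omega)) (hs _ (by omega)) ⟨hj, size_pos _⟩ ⟨hj, sj⟩ (by simp) k0 k1
      (fun _ _ _ => -1) (fun _ _ _ => -1)
      (fun A _ x p hx => by rw [vec_zero x p j, hv, hv]; simp [coeff₀, coeff₁, coeff₂])
      (fun A _ x p hx => by
        rw [vec_one x p h (show j ≠ 0 by omega), hv, hv]; simp [coeff₀, coeff₁, coeff₂]; module)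
  have k4 : Sim (w (l, 4)) (vec G x p (l, 4)) :=
    hw.sim_vec hm hl ih (i₁ := 0) (i₂ := 1) (e₁ := (k, 0)) (e₂ := (k, 1)) (hs _ (by omega))
      (hs _ (by omega)) (hs _ (by omega)) ⟨hk, size_pos _⟩ ⟨hk, sk⟩ (by simp) k0 k1
      (fun _ _ _ => -1) (fun _ _ _ => -1)
      (fun A _ x p hx => by rw [vec_zero x p k, hv, hv]; simp [coeff₀, coeff₁, coeff₂])
      (fun A _ x p hx => by
        rw [vec_one x p h (show k ≠ 0 by omega), hv, hv]; simp [coeff₀, coeff₁, coeff₂]; module)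
  have k2 : Sim (w (l, 2)) (vec G x p (l, 2)) :=
    hw.sim_vec hm hl ih (i₁ := 0) (i₂ := 3) (e₁ := (0, 0)) (e₂ := (j, 2)) (hs _ (by omega))
      (hs _ (by omega)) (hs _ (by omega)) s0 ⟨hj, two_lt_size nj⟩ (by simp) k0 k3
      (fun _ _ x => x j) (fun _ _ _ => 1)
      (fun A _ x p hx => by rw [vec_zero x p 0, hv, hv]; simp [coeff₀, coeff₁, coeff₂])
      (fun A _ x p hx => by
        rw [vec_two x p nj, hv, hv]; simp [coeff₀, coeff₁, coeff₂])
  refine ⟨fun hk1 => ?_, fun i hi => ?_⟩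
  · have nk : (G k).IsNonconst := by
      rw [Ne, ← h.frame_iff] at hk1
      cases hGk : G k <;> simp_all [IsVal, IsNonconst]
    refine hw.mark_unique hm hl (by omega) (v := w (l, 2))
      (by rw [hv] at k2; simpa [coeff₀, coeff₁, coeff₂] using k2)
      (hw.sim_of_related hl (hs _ (by omega)) (hs 0 (by omega)) (hs 4 (by omega)) (e₁ := (0, 0))
        (e₂ := (k, 2)) (c₁ := x k) (c₂ := 1) ⟨s0.1.trans hl, s0.2⟩
        ⟨hk.trans hl, two_lt_size nk⟩ s0.1 hk
        (by simp) k0 k4 (sim_zero hm (by omega)) (ih _ ⟨hk.trans hl, two_lt_size nk⟩ hk)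
        (related_of fun A _ x _ p => ⟨x j, by
          rw [vec_zero x p 0, hv, hv]; simp [coeff₀, coeff₁, coeff₂]⟩)
        (related_of fun A _ x hx p => ⟨1, by
          rw [vec_two x p nk, hv, hv, ← hx.eq _ _ _ hG hk1]
          simp [coeff₀, coeff₁, coeff₂]; module⟩)
        (by rw [vec_zero, vec_zero])
        (by rw [vec_two x p nk, hv]; simp [coeff₀, coeff₁, coeff₂]))
  interval_cases i
  exacts [k0, k1, k2, k3, k4]

/-- The block of an inequality is reconstructed by intersecting lines; the marks `p l + x j • p 0`
and `p l + x k • p 0` are different, and hence so are the values. -/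
lemma realize_ineq {l j k : ℕ} (hG : G l = Gadget.ineq j k) (hl : l < L)
    (ih : ∀ e, InRange G L e → e.1 < l → Sim (w e) (vec G x p e)) :
    IsUnit (x j - x k) ∧ ∀ i < 6, Sim (w (l, i)) (vec G x p (l, i)) := by
  obtain ⟨hj, hk, hjk, nj, nk⟩ := h.ineq _ _ _ hG
  have hj2 := h.two_le_of_isNonconst nj
  have hk2 := h.two_le_of_isNonconst nk
  have hL := hw.three_le
  have hs : ∀ i < 6, i < (G l).size := by rw [hG]; exact fun i hi => hi
  have k0 := sim_zero hm hl
  have k1 := sim_one h hm hl (by omega)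
  have hv : ∀ (A : Type u) [CommRing A] (x : ℕ → A) (p : ℕ → Fin 3 → A) i, vec G x p (l, i) =
      p l + (coeff₁ (linked G l) x (Gadget.ineq j k) i) • p j
        + (coeff₂ (linked G l) (Gadget.ineq j k) i : A) • p k
        + (coeff₀ (linked G l) x l (Gadget.ineq j k) i) • p 0 := by
    intro A _ x p i; simp [vec, hG, src₁, src₂]
  have s0 : (0, 0).1 < l ∧ (0, 0).2 < (G (0, 0).1).size := ⟨by simp; omega, size_pos _⟩
  have sj : 1 < (G j).size := h.one_lt_size (by omega)
  have sk : 1 < (G k).size := h.one_lt_size (by omega)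
  have k3 : Sim (w (l, 3)) (vec G x p (l, 3)) :=
    hw.sim_vec hm hl ih (i₁ := 0) (i₂ := 1) (e₁ := (j, 0)) (e₂ := (j, 1)) (hs _ (by omega))
      (hs _ (by omega)) (hs _ (by omega)) ⟨hj, size_pos _⟩ ⟨hj, sj⟩ (by simp) k0 k1
      (fun _ _ _ => -1) (fun _ _ _ => -1)
      (fun A _ x p hx => by rw [vec_zero x p j, hv, hv]; simp [coeff₀, coeff₁, coeff₂])
      (fun A _ x p hx => by
        rw [vec_one x p h (show j ≠ 0 by omega), hv, hv]; simp [coeff₀, coeff₁, coeff₂]; module)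
  have k4 : Sim (w (l, 4)) (vec G x p (l, 4)) :=
    hw.sim_vec hm hl ih (i₁ := 0) (i₂ := 1) (e₁ := (k, 0)) (e₂ := (k, 1)) (hs _ (by omega))
      (hs _ (by omega)) (hs _ (by omega)) ⟨hk, size_pos _⟩ ⟨hk, sk⟩ (by simp) k0 k1
      (fun _ _ _ => -1) (fun _ _ _ => -1)
      (fun A _ x p hx => by rw [vec_zero x p k, hv, hv]; simp [coeff₀, coeff₁, coeff₂])
      (fun A _ x p hx => by
        rw [vec_one x p h (show k ≠ 0 by omega), hv, hv]; simp [coeff₀, coeff₁, coeff₂]; module)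
  have k2 : Sim (w (l, 2)) (vec G x p (l, 2)) :=
    hw.sim_vec hm hl ih (i₁ := 0) (i₂ := 3) (e₁ := (0, 0)) (e₂ := (j, 2)) (hs _ (by omega))
      (hs _ (by omega)) (hs _ (by omega)) s0 ⟨hj, two_lt_size nj⟩ (by simp) k0 k3
      (fun _ _ x => x j) (fun _ _ _ => 1)
      (fun A _ x p hx => by rw [vec_zero x p 0, hv, hv]; simp [coeff₀, coeff₁, coeff₂])
      (fun A _ x p hx => by
        rw [vec_two x p nj, hv, hv]; simp [coeff₀, coeff₁, coeff₂])
  have k5 : Sim (w (l, 5)) (vec G x p (l, 5)) :=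
    hw.sim_vec hm hl ih (i₁ := 0) (i₂ := 4) (e₁ := (0, 0)) (e₂ := (k, 2)) (hs _ (by omega))
      (hs _ (by omega)) (hs _ (by omega)) s0 ⟨hk, two_lt_size nk⟩ (by simp) k0 k4
      (fun _ _ x => x k) (fun _ _ _ => 1)
      (fun A _ x p hx => by rw [vec_zero x p 0, hv, hv]; simp [coeff₀, coeff₁, coeff₂])
      (fun A _ x p hx => by
        rw [vec_two x p nk, hv, hv]; simp [coeff₀, coeff₁, coeff₂])
  refine ⟨?_, fun i hi => ?_⟩
  · have h1 := hw.ineq l j k hl hG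
    rw [k2.isUnit_det3 k5 (Sim.refl _), hv, hv] at h1
    simp only [coeff₀, coeff₁, coeff₂, zero_smul, add_zero] at h1
    rw [show det3 (p l + x j • p 0) (p l + x k • p 0) (w (1, 0)) =
      (x j - x k) * det3 (p 0) (p l) (w (1, 0)) by
        simp only [det3_eq, Pi.smul_apply, Pi.add_apply, smul_eq_mul]; ring] at h1
    exact isUnit_of_mul_isUnit_left h1
  interval_cases i
  exacts [k0, k1, k2, k3, k4, k5]

end IsRealized

/-- Every realization is, up to the choice of coordinates of the points, of the form `vec G x p`,
where `x` satisfies the equations and the inequalities of the program `G`. -/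
theorem IsRealized.exists_vec (h : WellFormed G) (hw : IsRealized G L w)
    (hG : ∀ l, L ≤ l → G l = free) :
    ∃ (x : ℕ → A) (p : ℕ → Fin 3 → A), SatisfiesEqs G x ∧
      (∀ l j k, G l = Gadget.ineq j k → IsUnit (x j - x k)) ∧
      ∀ e, InRange G L e → Sim (w e) (vec G x p e) := by
  obtain ⟨x, p, hm⟩ := hw.exists_isMarked h
  have key : ∀ e, InRange G L e → Sim (w e) (vec G x p e) := by
    suffices ∀ l, l < L → ∀ i < (G l).size, Sim (w (l, i)) (vec G x p (l, i)) from
      fun e he => this _ he.1 _ he.2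
    intro l
    induction l using Nat.strong_induction_on with
    | _ l ih =>
      intro hl i hi
      have ih' : ∀ e, InRange G L e → e.1 < l → Sim (w e) (vec G x p e) :=
        fun e he hel => ih _ hel he.1 _ he.2
      rcases hGl : G l with _ | _ | _ | ⟨j, k⟩ | ⟨j, k⟩ | ⟨j, k⟩ | ⟨j, k⟩ <;>
        rw [hGl, size] at hi
      · obtain rfl : i = 0 := by omega
        exact sim_zero hm hl
      · have := (h.frame_iff l).1 hGl
        interval_cases i
        exacts [sim_zero hm hl, sim_one h hm hl (by omega)]
      · have h2 : (G l).IsNonconst := by rw [hGl]; trivial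
        have := h.two_le_of_isNonconst h2
        interval_cases i
        exacts [sim_zero hm hl, sim_one h hm hl (by omega), sim_two hm hl h2]
      · exact (realize_add h hw hm hGl hl ih').2 i hi
      · exact (realize_mul h hw hm hGl hl ih').2 i hi
      · exact (realize_eq h hw hm hGl hl ih').2 i hi
      · exact (realize_ineq h hw hm hGl hl ih').2 i hi
  have hlt : ∀ {l g}, G l = g → g ≠ free → l < L := fun {l g} hl hg => by
    by_contra! h'
    exact hg (hl.symm.trans (hG l h'))
  refine ⟨x, p, ⟨⟨hm.one, ?_, ?_⟩, ?_⟩, ?_, key⟩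
  · exact fun l j k hl => (realize_add h hw hm hl (hlt hl (by simp)) fun e he _ => key e he).1
  · exact fun l j k hl => (realize_mul h hw hm hl (hlt hl (by simp)) fun e he _ => key e he).1
  · exact fun l j k hl => (realize_eq h hw hm hl (hlt hl (by simp)) fun e he _ => key e he).1
  · exact fun l j k hl => (realize_ineq h hw hm hl (hlt hl (by simp)) fun e he _ => key e he).1

end Reconstruct

/-! ### The matroid of a program -/

/-- The last property of a collinearity relation follows if some triple is not collinear. -/
lemma IsCollinearity.of_not {α : Type} {Col : α → α → α → Prop}
    (rotate : ∀ a b c, Col a b c → Col b c a) (swap : ∀ a b c, Col a b c → Col b a c)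
    (refl : ∀ a b, Col a a b) (trans : ∀ a b c d, a ≠ b → Col a b c → Col a b d → Col a c d)
    {x y z : α} (h : ¬ Col x y z) : IsCollinearity Col := by
  refine ⟨rotate, swap, refl, trans, fun a b hab => ?_⟩
  by_contra! hc
  have h1 := trans a b x y hab (hc x) (hc y)
  have h2 := trans a b x z hab (hc x) (hc z)
  by_cases hax : a = x
  · subst hax
    exact h (trans a b y z hab (hc y) (hc z))
  · exact h (trans x a y z (Ne.symm hax) (swap _ _ _ h1) (swap _ _ _ h2))

lemma Computes.map {A B : Type*} [CommRing A] [CommRing B] {x : ℕ → A} (h : Computes G x)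
    (φ : A →+* B) : Computes G (φ ∘ x) where
  one := by simp [h.one]
  add l j k hl := by simp [h.add l j k hl]
  mul l j k hl := by simp [h.mul l j k hl]

lemma SatisfiesEqs.map {A B : Type*} [CommRing A] [CommRing B] {x : ℕ → A} (h : SatisfiesEqs G x)
    (φ : A →+* B) : SatisfiesEqs G (φ ∘ x) where
  toComputes := h.toComputes.map φ
  eq l j k hl hk := by simp [h.eq l j k hl hk]

/-- The vector of an element only depends on the earlier variables and base vectors. -/
lemma vec_congr (w : WellFormed G) {A : Type*} [CommRing A] {V : Type*} [AddCommGroup V]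
    [Module A V] {x x' : ℕ → A} {p p' : ℕ → V} {e : ℕ × ℕ}
    (hx : ∀ l ≤ e.1, (G l).IsNonconst → x l = x' l) (hp : ∀ l ≤ e.1, p l = p' l) :
    vec G x p e = vec G x' p' e := by
  obtain ⟨l, i⟩ := e
  have h0 := hp 0 (Nat.zero_le _)
  have hl := hp l le_rfl
  rcases hG : G l with _ | _ | _ | ⟨j, k⟩ | ⟨j, k⟩ | ⟨j, k⟩ | ⟨j, k⟩
  · simp [vec, hG, coeff₀, coeff₁, coeff₂, hl]
  · simp [vec, hG, coeff₁, coeff₂, hl, h0]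
    rcases i with _ | _ | i <;> simp [coeff₀]
  · have h1 := hx l le_rfl (by rw [hG]; trivial)
    rcases i with _ | _ | _ | i <;> simp [vec, hG, coeff₀, coeff₁, coeff₂, hl, h0, h1]
  · obtain ⟨hj, hk, -, -, nk⟩ := w.add _ _ _ hG
    have h1 := hx l le_rfl (by rw [hG]; trivial)
    rcases i with _ | _ | _ | _ | _ | _ | _ | i <;>
      simp [vec, hG, coeff₀, coeff₁, coeff₂, hl, h0, h1, hx k hk.le nk, hp j hj.le, hp k hk.le,
        src₁, src₂]
  · obtain ⟨hj, hk, -, nk⟩ := w.mul _ _ _ hG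
    have h1 := hx l le_rfl (by rw [hG]; trivial)
    rcases i with _ | _ | _ | _ | _ | _ | i <;>
      simp [vec, hG, coeff₀, coeff₁, coeff₂, hl, h0, h1, hx k hk.le nk, hp j hj.le, hp k hk.le,
        src₁, src₂]
  · obtain ⟨hj, hk, -, nj, -⟩ := w.eq _ _ _ hG
    rcases i with _ | _ | _ | _ | _ | i <;>
      simp [vec, hG, coeff₀, coeff₁, coeff₂, hl, h0, hx j hj.le nj, hp j hj.le, hp k hk.le,
        src₁, src₂]
  · obtain ⟨hj, hk, -, nj, nk⟩ := w.ineq _ _ _ hG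
    rcases i with _ | _ | _ | _ | _ | _ | i <;>
      simp [vec, hG, coeff₀, coeff₁, coeff₂, hl, h0, hx j hj.le nj, hx k hk.le nk, hp j hj.le,
        hp k hk.le, src₁, src₂]

lemma mulVec_vec {A : Type*} [CommRing A] (g : Matrix (Fin 3) (Fin 3) A) (x : ℕ → A)
    (p : ℕ → Fin 3 → A) (e : ℕ × ℕ) :
    g.mulVec (vec G x p e) = vec G x (fun n => g.mulVec (p n)) e := by
  simp [vec, Matrix.mulVec_add, Matrix.mulVec_smul]

section Collinear
variable {F : Type u} [Field F] {x : ℕ → F[X]} (w : WellFormed G) (a : Admissible G x)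

include w a

lemma eq_of_proportional {e₁ e₂ : ℕ × ℕ} (s₁ : e₁.2 < (G e₁.1).size)
    (s₂ : e₂.2 < (G e₂.1).size) {c₁ c₂ : F[X]} (hc : c₁ ≠ 0 ∨ c₂ ≠ 0)
    (h : ∀ n, c₁ * co G x e₁ n + c₂ * co G x e₂ n = 0) : e₁ = e₂ := by
  obtain ⟨l₁, i₁⟩ := e₁
  obtain ⟨l₂, i₂⟩ := e₂
  rcases lt_trichotomy l₁ l₂ with hl | rfl | hl
  · have h2 := h l₂
    have h1 := h l₁
    rw [w.co_above x _ _ _ hl, w.co_self] at h2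
    obtain rfl : c₂ = 0 := by simpa using h2
    rw [w.co_self] at h1
    simp_all
  · have h1 := h l₁
    rw [w.co_self, w.co_self] at h1
    obtain rfl : c₂ = - c₁ := by linear_combination h1
    have hc : c₁ ≠ 0 := by simpa using hc
    rw [show i₁ = i₂ from
      co_injective w a s₁ s₂ fun n => mul_left_cancel₀ hc (by linear_combination h n)]
  · have h2 := h l₂
    have h1 := h l₁
    rw [w.co_above x _ _ _ hl, w.co_self] at h1
    obtain rfl : c₁ = 0 := by simpa using h1
    rw [w.co_self] at h2
    simp_all

lemma Dep.trans {e₁ e₂ e₃ e₄ : ℕ × ℕ} (s₁ : e₁.2 < (G e₁.1).size) (s₂ : e₂.2 < (G e₂.1).size)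
    (hne : e₁ ≠ e₂) (h : Dep G x e₁ e₂ e₃) (h' : Dep G x e₁ e₂ e₄) :
    Dep G x e₁ e₃ e₄ := by
  obtain ⟨c₁, c₂, c₃, hc, h⟩ := h
  obtain ⟨d₁, d₂, d₃, hd, h'⟩ := h'
  have hc3 : c₃ ≠ 0 := by
    rintro rfl
    exact hne (eq_of_proportional w a s₁ s₂ (by simpa using hc) fun n => by
      linear_combination h n)
  by_cases hd2 : d₂ = 0
  · subst hd2
    exact ⟨d₁, 0, d₃, by tauto, fun n => by linear_combination h' n⟩
  · exact ⟨c₁ * d₂ - d₁ * c₂, c₃ * d₂, - (c₂ * d₃), Or.inr (Or.inl (mul_ne_zero hc3 hd2)),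
      fun n => by linear_combination d₂ * h n - c₂ * h' n⟩

/-- The collinearity relation of the program can be read off from any admissible values of the
variables, over any field: by `related_of_dep` no dependence is accidental, and by
`exists_points_det3_ne_zero` the generic projection to dimension three does not add any. -/
lemma related_iff_dep {e₁ e₂ e₃ : ℕ × ℕ} (s₁ : e₁.2 < (G e₁.1).size)
    (s₂ : e₂.2 < (G e₂.1).size) (s₃ : e₃.2 < (G e₃.1).size) :
    Related.{u} G e₁ e₂ e₃ ↔ Dep G x e₁ e₂ e₃ := by
  refine ⟨fun h => ?_, related_of_dep w a s₁ s₂ s₃⟩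
  by_contra hn
  obtain ⟨p, -, -, -, hp⟩ := exists_points_det3_ne_zero w (L := e₁.1 + e₂.1 + e₃.1 + 3)
    (by omega) ![e₁, e₂, e₃] (fun i => by fin_cases i <;> simp <;> omega) hn
  exact hp (h _ _ (a.toSatisfiesEqs.map _) p)

lemma not_related_of_lt {e₁ e₂ e₃ : ℕ × ℕ} (s₁ : e₁.2 < (G e₁.1).size)
    (s₂ : e₂.2 < (G e₂.1).size) (s₃ : e₃.2 < (G e₃.1).size) (h₂ : e₂.1 < e₁.1) (h₃ : e₃.1 < e₁.1)
    (hne : e₂ ≠ e₃) : ¬ Related.{u} G e₁ e₂ e₃ := by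
  rw [related_iff_dep w a s₁ s₂ s₃]
  intro h
  obtain ⟨h4, h5⟩ := eq_of_dep_of_lt w h₂ h₃ h
  obtain ⟨l₂, i₂⟩ := e₂
  obtain ⟨l₃, i₃⟩ := e₃
  simp only at h4
  subst h4
  exact hne (by rw [show i₂ = i₃ from co_injective w a s₂ s₃ h5])

/-- The elements `p l`, `p l + p 0` and `p 1` are not collinear. -/
lemma not_related_line {l : ℕ} (hl : 2 ≤ l) : ¬ Related.{u} G (l, 0) (l, 1) (1, 0) := by
  rw [related_iff_dep w a (size_pos _) (w.one_lt_size (by omega)) (size_pos _)]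
  rintro ⟨c₁, c₂, c₃, hc, h⟩
  have e0 : ∀ n, co G x (l, 0) n = kron n l := fun n => by
    rcases hG : G l with _ | _ | _ | _ | _ | _ | _ <;> simp [co, hG, coeff₀, coeff₁, coeff₂]
  have e1 : ∀ n, co G x (l, 1) n = kron n l + kron n 0 := fun n => by
    rcases hG : G l with _ | _ | _ | _ | _ | _ | _
    · have := (w.pole_iff l).1 hG
      omega
    all_goals simp [co, hG, coeff₀, coeff₁, coeff₂]
  have h0 := h 0
  have h1 := h 1
  have h2 := h l
  rw [e0, e1, w.co_one x 0 _ (by omega)] at h0 h1 h2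
  rw [kron_ne' (show l ≠ 0 by omega), kron_ne (show 0 ≠ 1 by omega)] at h0
  rw [kron_ne' (show l ≠ 1 by omega), kron_ne (show 1 ≠ 0 by omega)] at h1
  rw [kron_ne (show l ≠ 1 by omega), kron_ne (show l ≠ 0 by omega)] at h2
  simp only [kron_self] at h0 h1 h2
  have hc2 : c₂ = 0 := by simpa using h0
  have hc3 : c₃ = 0 := by simpa using h1
  simp_all

/-- The marks with the values of the two sides of an inequality are not collinear with `p 1`. -/
lemma not_related_ineq {l j k : ℕ} (hG : G l = Gadget.ineq j k) :
    ¬ Related.{u} G (l, 2) (l, 5) (1, 0) := by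
  obtain ⟨hj, hk, hjk, nj, nk⟩ := w.ineq _ _ _ hG
  have hj2 := w.two_le_of_isNonconst nj
  rw [related_iff_dep w a (by rw [hG]; simp [size]) (by rw [hG]; simp [size]) (size_pos _)]
  rintro ⟨c₁, c₂, c₃, hc, h⟩
  have e0 : ∀ n, co G x (l, 2) n = kron n l + x j * kron n 0 := fun n => by
    simp [co, hG, coeff₀, coeff₁, coeff₂]
  have e1 : ∀ n, co G x (l, 5) n = kron n l + x k * kron n 0 := fun n => by
    simp [co, hG, coeff₀, coeff₁, coeff₂]
  have h0 := h 0
  have h1 := h 1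
  have h2 := h l
  rw [e0, e1, w.co_one x 0 _ (by omega)] at h0 h1 h2
  rw [kron_ne' (show l ≠ 0 by omega), kron_ne (show 0 ≠ 1 by omega)] at h0
  rw [kron_ne' (show l ≠ 1 by omega), kron_ne (show 1 ≠ 0 by omega)] at h1
  rw [kron_ne (show l ≠ 1 by omega), kron_ne (show l ≠ 0 by omega)] at h2
  simp only [kron_self] at h0 h1 h2
  have hc3 : c₃ = 0 := by simpa using h1
  have hc1 : c₁ = - c₂ := by linear_combination h2
  have h4 : c₂ * (x j - x k) = 0 := by
    rw [hc1, hc3] at h0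
    linear_combination -h0
  have hc2 := (mul_eq_zero.1 h4).resolve_right (sub_ne_zero.2 (a.ineq_ne _ _ _ hG))
  simp_all

variable {α : Type} {L : ℕ} {ε : α → ℕ × ℕ}

/-- The collinearity relation of the program defines a matroid, on any set `α` which indexes the
elements of the first `L` blocks. -/
lemma isCollinearity (hL : 3 ≤ L) (hε : Function.Injective ε)
    (hr : ∀ e, InRange G L e ↔ ∃ a, ε a = e) :
    IsCollinearity fun a b c => Related.{u} G (ε a) (ε b) (ε c) := by
  have s : ∀ a, (ε a).2 < (G (ε a).1).size := fun a => ((hr _).2 ⟨a, rfl⟩).2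
  obtain ⟨z₀, h0⟩ := (hr (0, 0)).1 ⟨by simp; omega, size_pos _⟩
  obtain ⟨z₁, h1⟩ := (hr (1, 0)).1 ⟨by simp; omega, size_pos _⟩
  obtain ⟨z₂, h2⟩ := (hr (2, 0)).1 ⟨by simp; omega, size_pos _⟩
  have key : ∀ b c d, Related.{u} G (ε b) (ε c) (ε d) ↔ Dep G x (ε b) (ε c) (ε d) :=
    fun b c d => related_iff_dep w a (s b) (s c) (s d)
  refine IsCollinearity.of_not (x := z₂) (y := z₁) (z := z₀) ?_ ?_ ?_ ?_
    (not_related_of_lt w a (s _) (s _) (s _) (by rw [h1, h2]; simp) (by rw [h0, h2]; simp)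
      (by rw [h0, h1]; simp)) <;> simp only [key]
  · exact fun _ _ _ => Dep.rotate
  · exact fun _ _ _ => Dep.swap
  · exact fun b c => ⟨1, -1, 0, by simp, fun n => by ring⟩
  · exact fun b c d e hbc => Dep.trans w a (s b) (s c) (hε.ne hbc)

lemma IsConfig.isRealized (hL : 3 ≤ L) (hε : Function.Injective ε)
    (hr : ∀ e, InRange G L e ↔ ∃ a, ε a = e) {M : Matroid α}
    (hM : ∀ a b c, M.IsBase {a, b, c} ↔ ¬ Related.{u} G (ε a) (ε b) (ε c)) {A : Type u} [CommRing A]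
    {v : α → Fin 3 → A} (hv : IsConfig M v) :
    ∃ v' : ℕ × ℕ → Fin 3 → A, (∀ a, v' (ε a) = v a) ∧ IsRealized G L v' := by
  refine ⟨Function.extend ε v 0, hε.extend_apply v 0, ?_⟩
  have hd : ∀ e₁ e₂ e₃, InRange G L e₁ → InRange G L e₂ → InRange G L e₃ →
      Related.{u} G e₁ e₂ e₃ → det3 (Function.extend ε v 0 e₁) (Function.extend ε v 0 e₂)
        (Function.extend ε v 0 e₃) = 0 := by
    intro e₁ e₂ e₃ r₁ r₂ r₃ h
    obtain ⟨a, rfl⟩ := (hr e₁).1 r₁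
    obtain ⟨b, rfl⟩ := (hr e₂).1 r₂
    obtain ⟨c, rfl⟩ := (hr e₃).1 r₃
    rw [hε.extend_apply, hε.extend_apply, hε.extend_apply]
    exact hv.dep _ _ _ (by rw [hM]; simpa using h)
  have hi : ∀ e₁ e₂ e₃, InRange G L e₁ → InRange G L e₂ → InRange G L e₃ →
      ¬ Related.{u} G e₁ e₂ e₃ → IsUnit (det3 (Function.extend ε v 0 e₁)
        (Function.extend ε v 0 e₂) (Function.extend ε v 0 e₃)) := by
    intro e₁ e₂ e₃ r₁ r₂ r₃ h
    obtain ⟨a, rfl⟩ := (hr e₁).1 r₁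
    obtain ⟨b, rfl⟩ := (hr e₂).1 r₂
    obtain ⟨c, rfl⟩ := (hr e₃).1 r₃
    rw [hε.extend_apply, hε.extend_apply, hε.extend_apply]
    exact hv.indep _ _ _ ((hM _ _ _).2 h)
  have h1 : InRange G L (1, 0) := ⟨by simp; omega, size_pos _⟩
  exact ⟨hL, hd, fun e₁ e₂ e₃ r₁ r₂ r₃ h₂ h₃ hne =>
      hi _ _ _ r₁ r₂ r₃ (not_related_of_lt w a r₁.2 r₂.2 r₃.2 h₂ h₃ hne),
    fun l hl hlL => hi _ _ _ ⟨hlL, size_pos _⟩ ⟨hlL, w.one_lt_size (by omega)⟩ h1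
      (not_related_line w a hl),
    fun l j k hl hG => hi _ _ _ ⟨hl, by rw [hG]; simp [size]⟩ ⟨hl, by rw [hG]; simp [size]⟩ h1
      (not_related_ineq w a hG)⟩

end Collinear

/-! ### The universal realization of the matroid of a program -/

section Frame
variable {A : Type u} [CommRing A]

/-- The points `p 0`, `p 1`, `p 2` are the coordinate points. -/
structure IsFramed (p : ℕ → Fin 3 → A) : Prop where
  zero : p 0 = ![0, 0, 1]
  one : p 1 = ![0, 1, 0]
  two : p 2 = ![1, 0, 0]

lemma eq_scalar_of_isFramed {p : ℕ → Fin 3 → A} (hp : IsFramed p) {g : Matrix (Fin 3) (Fin 3) A}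
    {c : A} (h : ∀ l < 3, g.mulVec (p l) = c • p l) : g = Matrix.scalar (Fin 3) c := by
  have h0 := h 0 (by omega)
  have h1 := h 1 (by omega)
  have h2 := h 2 (by omega)
  rw [hp.zero] at h0
  rw [hp.one] at h1
  rw [hp.two] at h2
  refine Matrix.ext_of_mulVec_single fun i => ?_
  rw [Matrix.scalar_apply, Matrix.diagonal_const_mulVec]
  fin_cases i
  · have e : (Pi.single 0 1 : Fin 3 → A) = ![1, 0, 0] := by ext j; fin_cases j <;> rfl
    exact (congrArg _ e).trans (h2.trans (congrArg _ e.symm))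
  · have e : (Pi.single 1 1 : Fin 3 → A) = ![0, 1, 0] := by ext j; fin_cases j <;> rfl
    exact (congrArg _ e).trans (h1.trans (congrArg _ e.symm))
  · have e : (Pi.single 2 1 : Fin 3 → A) = ![0, 0, 1] := by ext j; fin_cases j <;> rfl
    exact (congrArg _ e).trans (h0.trans (congrArg _ e.symm))

end Frame

section Rigid
variable {A : Type u} [CommRing A] {L : ℕ} {x x' : ℕ → A} {p p' : ℕ → Fin 3 → A}

/-- The vectors of a realization are determined up to a scalar if the first three points are the
coordinate points, and with them the values of the variables. -/
lemma eq_of_mulVec_eq (h : WellFormed G) {w : ℕ × ℕ → Fin 3 → A} (hw : IsRealized G L w)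
    (hwv : ∀ e, InRange G L e → w e = vec G x' p' e) (hp : IsFramed p) (hp' : IsFramed p')
    {g : GL (Fin 3) A} (hg : ∀ e, InRange G L e →
      ∃ c : A, (g : Matrix (Fin 3) (Fin 3) A).mulVec (vec G x p e) = c • vec G x' p' e) :
    (∃ c : A, (g : Matrix (Fin 3) (Fin 3) A) = Matrix.scalar (Fin 3) c) ∧
      ∀ l < L, p l = p' l ∧ ((G l).IsNonconst → x l = x' l) := by
  have hL := hw.three_le
  have h0 : p 0 = p' 0 := hp.zero.trans hp'.zero.symm
  have hind : ∀ l < L, 1 ≤ l → ∀ a b : A, a • p' l + b • p' 0 = 0 → a = 0 ∧ b = 0 := by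
    intro l hl hl1 a b hab
    obtain ⟨z, hz⟩ := hw.exists_isUnit_det3 hl hl1
    have := hz 0 (size_pos _)
    rw [hwv _ ⟨hl, size_pos _⟩, hwv _ ⟨by simp; omega, size_pos _⟩, vec_zero, vec_zero] at this
    exact eq_zero_of_smul_add_smul this hab
  obtain ⟨c, hc⟩ := hg (0, 0) ⟨by simp; omega, size_pos _⟩
  rw [vec_zero, vec_zero] at hc
  have key : ∀ l < L, (g : Matrix (Fin 3) (Fin 3) A).mulVec (p l) = c • p' l := by
    intro l hl
    rcases Nat.eq_zero_or_pos l with rfl | hl1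
    · exact hc
    obtain ⟨a, ha⟩ := hg (l, 0) ⟨hl, size_pos _⟩
    obtain ⟨b, hb⟩ := hg (l, 1) ⟨hl, h.one_lt_size hl1⟩
    rw [vec_zero, vec_zero] at ha
    rw [vec_one x p h (by omega), vec_one x' p' h (by omega), Matrix.mulVec_add, ha, hc,
      ← sub_eq_zero] at hb
    obtain ⟨h1, h2⟩ := hind l hl hl1 (a - b) (c - b) (by rw [← hb]; module)
    rw [ha, sub_eq_zero.1 h1, sub_eq_zero.1 h2]
  have hgc : (g : Matrix (Fin 3) (Fin 3) A) = Matrix.scalar (Fin 3) c := by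
    refine eq_scalar_of_isFramed hp' fun l hl => ?_
    rw [← key l (by omega)]
    interval_cases l
    · rw [h0]
    · rw [hp.one, hp'.one]
    · rw [hp.two, hp'.two]
  have hs : ∀ v, (g : Matrix (Fin 3) (Fin 3) A).mulVec v = c • v := fun v => by
    rw [hgc, Matrix.scalar_apply, Matrix.diagonal_const_mulVec]
  have hcu : IsUnit c := by
    have := (Matrix.isUnit_iff_isUnit_det _).1 g.isUnit
    rw [hgc, Matrix.scalar_apply, Matrix.det_diagonal, Fin.prod_const] at this
    exact (isUnit_pow_iff (by simp)).1 this
  refine ⟨⟨c, hgc⟩, fun l hl => ⟨hcu.smul_left_cancel.1 (by rw [← key l hl, hs]), fun hn => ?_⟩⟩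
  have hl2 := h.two_le_of_isNonconst hn
  obtain ⟨b, hb⟩ := hg (l, 2) ⟨hl, two_lt_size hn⟩
  rw [vec_two x p hn, vec_two x' p' hn, Matrix.mulVec_add, Matrix.mulVec_smul, key l hl, hc,
    ← sub_eq_zero] at hb
  obtain ⟨h1, h2⟩ := hind l hl (by omega) (c - b) (x l * c - b * x' l) (by rw [← hb]; module)
  rw [← sub_eq_zero.1 h1, mul_comm, sub_eq_zero] at h2
  exact hcu.mul_left_cancel h2

end Rigid

section Universal
variable {R : Type u} [CommRing R] {N L : ℕ}

/-- A labelling of the parameters of a realization: the value of `t` and the coordinates of the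
points `p l`, for `3 ≤ l < L`. -/
abbrev Labels (N L : ℕ) := Option (Fin (L - 3) × Fin 3) ≃ ULift.{u} (Fin N)

variable (τ : Labels.{u} N L) (X : ℕ → R[X])

/-- The universal values of the variables. -/
noncomputable def univVal (l : ℕ) : MvPolynomial (ULift.{u} (Fin N)) R :=
  (X l).eval₂ MvPolynomial.C (MvPolynomial.X (τ none))

/-- The universal points. -/
noncomputable def univPoint : ℕ → Fin 3 → MvPolynomial (ULift.{u} (Fin N)) R
  | 0 => ![0, 0, 1]
  | 1 => ![0, 1, 0]
  | 2 => ![1, 0, 0]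
  | l + 3 => fun i => if h : l < L - 3 then MvPolynomial.X (τ (some (⟨l, h⟩, i))) else 0

variable {A : Type u} [CommRing A]

/-- The homomorphism which gives the parameters the prescribed values. -/
noncomputable def specialize (f : R →+* A) (t : A) (p : ℕ → Fin 3 → A) :
    MvPolynomial (ULift.{u} (Fin N)) R →+* A :=
  MvPolynomial.eval₂Hom f fun s => match τ.symm s with
    | none => t
    | some m => p (m.1 + 3) m.2

lemma isFramed_univPoint (φ : MvPolynomial (ULift.{u} (Fin N)) R →+* A) :
    IsFramed fun l => φ ∘ univPoint τ l := by
  refine ⟨?_, ?_, ?_⟩ <;> ext i <;> fin_cases i <;> simp [univPoint]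

lemma specialize_univVal (f : R →+* A) (t : A) (p : ℕ → Fin 3 → A) (l : ℕ) :
    specialize τ f t p (univVal τ X l) = (X l).eval₂ f t := by
  rw [univVal, hom_eval₂]
  congr 1
  · ext r
    simp [specialize]
  · simp [specialize]

lemma specialize_univPoint (f : R →+* A) (t : A) {p : ℕ → Fin 3 → A} (hp : IsFramed p) {l : ℕ}
    (hl : l < L) : specialize τ f t p ∘ univPoint τ l = p l := by
  rcases l with _ | _ | _ | l
  · rw [hp.zero]; ext i; fin_cases i <;> simp [univPoint]
  · rw [hp.one]; ext i; fin_cases i <;> simp [univPoint]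
  · rw [hp.two]; ext i; fin_cases i <;> simp [univPoint]
  · ext i
    simp [univPoint, specialize, show l < L - 3 by omega]

lemma ringHom_ext_of_univPoint {φ ψ : MvPolynomial (ULift.{u} (Fin N)) R →+* A}
    (hC : φ.comp MvPolynomial.C = ψ.comp MvPolynomial.C)
    (ht : φ (MvPolynomial.X (τ none)) = ψ (MvPolynomial.X (τ none)))
    (hp : ∀ l < L, φ ∘ univPoint τ l = ψ ∘ univPoint τ l) : φ = ψ := by
  refine MvPolynomial.ringHom_ext (fun r => congrArg (fun f => f r) hC) fun s => ?_
  obtain ⟨m, rfl⟩ := τ.surjective s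
  rcases m with _ | ⟨m, i⟩
  · exact ht
  · have := congrFun (hp (m + 3) (by omega)) i
    simpa [univPoint] using this

/-- The ring `R`, with the polynomials `X` over it, is universal among the rings with solutions of
the program `G`: a solution in `A` amounts to a homomorphism from `R[t]` to `A`. -/
structure IsPresentation (G : ℕ → Gadget) (L : ℕ) (X : ℕ → R[X]) : Prop where
  satisfiesEqs : SatisfiesEqs G X
  admissible : ∀ (F : Type u) [Field F] (f : R →+* F), Admissible G fun l => (X l).map f
  exists_hom : ∀ (A : Type u) [CommRing A] (x : ℕ → A), SatisfiesEqs G x →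
    (∀ l j k, G l = Gadget.ineq j k → IsUnit (x j - x k)) →
    ∃ (f : R →+* A) (t : A), ∀ l < L, (G l).IsNonconst → x l = (X l).eval₂ f t
  hom_ext : ∀ (A : Type u) [CommRing A] (f f' : R →+* A) (t t' : A),
    (∀ l < L, (G l).IsNonconst → (X l).eval₂ f t = (X l).eval₂ f' t') → f = f' ∧ t = t'

/-- If `R` has a presentation by the program `G`, then the realization space of the matroid of `G`
is an open subscheme of an affine space over `R`, whose coordinates are the value of `t` and the
coordinates of the base points other than the first three. -/
theorem IsPresentation.hasOpenRealizationSpace [Nontrivial R] {X : ℕ → R[X]}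
    (P : IsPresentation G L X) (τ : Labels.{u} N L)
    (w : WellFormed G) (hL : 3 ≤ L) (hfree : ∀ l, L ≤ l → G l = free) {α : Type} [Finite α]
    {ε : α → ℕ × ℕ} (hε : Function.Injective ε) (hr : ∀ e, InRange G L e ↔ ∃ a, ε a = e) :
    ∃ M : Matroid α, IsSimpleRankThree M ∧ HasOpenRealizationSpace M N R := by
  -- A single residue field suffices to define the matroid; the relation does not depend on it.
  obtain ⟨m, hm⟩ := Ideal.exists_maximal R
  let _ := Ideal.Quotient.field m
  have a := P.admissible _ (Ideal.Quotient.mk m)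
  have hcol := isCollinearity w a hL hε hr
  have : Nontrivial α := by
    obtain ⟨z₀, h0⟩ := (hr (0, 0)).1 ⟨by simp; omega, size_pos _⟩
    obtain ⟨z₁, h1⟩ := (hr (1, 0)).1 ⟨by simp; omega, size_pos _⟩
    exact ⟨z₀, z₁, by rintro rfl; simp [h0] at h1⟩
  have hs : ∀ b, InRange G L (ε b) := fun b => (hr _).2 ⟨b, rfl⟩
  let v : α → Fin 3 → MvPolynomial (ULift.{u} (Fin N)) R := fun b =>
    vec G (univVal τ X) (univPoint τ) (ε b)
  have hx : SatisfiesEqs G (univVal τ X) :=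
    P.satisfiesEqs.map (eval₂RingHom MvPolynomial.C (MvPolynomial.X (τ none)))
  have hv : ∀ (A : Type u) [CommRing A] (φ : MvPolynomial (ULift.{u} (Fin N)) R →+* A) b,
      φ ∘ v b = vec G (fun l => (X l).eval₂ (φ.comp MvPolynomial.C) (φ (MvPolynomial.X (τ none))))
        (fun l => φ ∘ univPoint τ l) (ε b) := fun A _ φ b => by
    rw [← vec_map]
    congr 1
    ext l
    simp [univVal, hom_eval₂]
  have hspec : ∀ (A : Type u) [CommRing A] (f : R →+* A) (t : A) (x : ℕ → A) (p : ℕ → Fin 3 → A),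
      IsFramed p → (∀ l < L, (G l).IsNonconst → x l = (X l).eval₂ f t) → ∀ b,
      specialize τ f t p ∘ v b = vec G x p (ε b) := fun A _ f t x p hp hx b => by
    rw [← vec_map]
    refine vec_congr w (fun l hl hn => ?_) fun l hl => ?_
    · rw [hx l (hl.trans_lt (hs b).1) hn, Function.comp_apply, specialize_univVal]
    · exact specialize_univPoint τ f t hp (hl.trans_lt (hs b).1)
  refine ⟨hcol.matroid, hcol.isSimpleRankThree, Mnev.hasOpenRealizationSpace
    hcol.isSimpleRankThree v ?_ ?_ ?_ ?_⟩
  · intro b c d h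
    rw [hcol.isBase_iff, not_not] at h
    exact h _ _ hx _
  · intro F _ f b c d h h0
    rw [hcol.isBase_iff, related_iff_dep w (P.admissible F f) (hs _).2 (hs _).2 (hs _).2] at h
    obtain ⟨p, p0, p1, p2, hp⟩ := exists_points_det3_ne_zero w hL ![ε b, ε c, ε d]
      (fun i => by fin_cases i; exacts [(hs b).1, (hs c).1, (hs d).1]) h
    apply hp
    let θ := specialize τ ((algebraMap F[X] (FractionRing F[X])).comp (Polynomial.C.comp f))
      (algebraMap F[X] (FractionRing F[X]) Polynomial.X) p
    have key := hspec _ ((algebraMap F[X] (FractionRing F[X])).comp (Polynomial.C.comp f))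
      (algebraMap F[X] (FractionRing F[X]) Polynomial.X)
      (algebraMap F[X] (FractionRing F[X]) ∘ fun l => (X l).map f) p ⟨p0, p1, p2⟩
      (fun l _ _ => by
        rw [Function.comp_apply, ← hom_eval₂, ← eval₂_map, eval₂_C_X])
    have hθ : ∀ d, MvPolynomial.map f d = 0 → θ d = 0 := by
      intro d hd
      have : θ = (specialize τ ((algebraMap F[X] (FractionRing F[X])).comp Polynomial.C)
        (algebraMap F[X] (FractionRing F[X]) Polynomial.X) p).comp (MvPolynomial.map f) := by
        refine MvPolynomial.ringHom_ext (fun r => ?_) fun s => ?_ <;> simp [θ, specialize]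
      rw [this, RingHom.comp_apply, hd, map_zero]
    have := hθ _ h0
    rw [← det3_map] at this
    simp only [θ, key] at this
    exact this
  · intro A _ φ ψ g hφ hψ hg
    obtain ⟨w', hw', hreal⟩ := hψ.isRealized w a hL hε hr fun b c d => hcol.isBase_iff
    obtain ⟨h1, h2⟩ := eq_of_mulVec_eq w hreal (g := g)
      (x := fun l => (X l).eval₂ (φ.comp MvPolynomial.C) (φ (MvPolynomial.X (τ none))))
      (x' := fun l => (X l).eval₂ (ψ.comp MvPolynomial.C) (ψ (MvPolynomial.X (τ none))))
      (fun e he => by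
        obtain ⟨b, rfl⟩ := (hr e).1 he
        rw [hw', hv]) (isFramed_univPoint τ φ) (isFramed_univPoint τ ψ) fun e he => by
        obtain ⟨b, rfl⟩ := (hr e).1 he
        rw [← hv, ← hv]
        exact hg.exists_smul b
    obtain ⟨h3, h4⟩ := P.hom_ext A _ _ _ _ fun l hl hn => (h2 l hl).2 hn
    exact ⟨ringHom_ext_of_univPoint τ h3 h4 fun l hl => (h2 l hl).1, h1⟩
  · intro A _ w' hw'
    obtain ⟨w'', hw'', hreal⟩ := hw'.isRealized w a hL hε hr fun b c d => hcol.isBase_iff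
    obtain ⟨x, p, hx, hineq, hsim⟩ := hreal.exists_vec w hfree
    have r : ∀ l < 3, InRange G L (l, 0) := fun l hl => ⟨by simp; omega, size_pos _⟩
    have hdet := hreal.new (2, 0) (1, 0) (0, 0) (r _ (by omega)) (r _ (by omega)) (r _ (by omega))
      (by simp) (by simp) (by simp)
    rw [(hsim _ (r 2 (by omega))).isUnit_det3 (hsim _ (r 1 (by omega)))
      (hsim _ (r 0 (by omega))), vec_zero, vec_zero, vec_zero] at hdet
    obtain ⟨g, g2, g1, g0⟩ := exists_mulVec_eq hdet
    obtain ⟨f, t, hft⟩ := P.exists_hom A x hx hineq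
    refine ⟨specialize τ f t fun l => (g : Matrix (Fin 3) (Fin 3) A).mulVec (p l), g,
      famMoves_famSpan_iff.2 fun b => ?_⟩
    rw [hspec A f t x _ ⟨g0, g1, g2⟩ hft, ← mulVec_vec, ← hw'']
    obtain ⟨c, hc⟩ := hsim _ (hs b)
    rw [hc, Matrix.mulVec_smul]
    exact Submodule.span_singleton_smul_eq c.isUnit _

end Universal

/-! ### The program of an elementary monic representation -/

namespace ElementaryMonicRep
variable (D : ElementaryMonicRep)

/-- The ring over which the variables of a representation are polynomials. -/
abbrev Base : Type := MvPolynomial (Fin D.n) ℤ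

/-- The number of the variables, including `t`. -/
abbrev numVars : ℕ := D.n + 1 + D.r

/-- Strong induction along the operations of a representation. -/
lemma var_induction (P : Fin D.numVars → Prop) (free : ∀ i, P (Fin.castAdd D.r i))
    (op : ∀ k, (∀ v < Fin.natAdd (D.n + 1) k, P v) → P (Fin.natAdd (D.n + 1) k)) : ∀ v, P v := by
  intro v
  induction v using WellFounded.induction (wellFounded_lt (α := Fin D.numVars)) with
  | _ v ih =>
    induction v using Fin.addCases with
    | left i => exact free i
    | right k => exact op k ih

lemma monic_x (v : Fin D.numVars) : (D.x v).Monic := by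
  induction v using Fin.addCases with
  | left i =>
    induction i using Fin.cases with
    | zero => rw [D.x_zero]; exact monic_X
    | succ i => rw [D.x_free, add_comm]; exact monic_X_add_C _
  | right k => exact D.monic k

/-- The summands of a monic sum have different degrees, since they are monic themselves. -/
lemma natDegree_ne {j k : Fin D.numVars} (h : (D.x j + D.x k).Monic) :
    (D.x j).natDegree ≠ (D.x k).natDegree := by
  intro hjk
  have h2 : (D.x j).leadingCoeff + (D.x k).leadingCoeff = 2 := by
    rw [(D.monic_x j).leadingCoeff, (D.monic_x k).leadingCoeff]; norm_num
  have h3 : (D.x j + D.x k).leadingCoeff = 2 := by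
    rw [leadingCoeff_add_of_degree_eq, h2]
    · rw [degree_eq_natDegree (D.monic_x j).ne_zero, degree_eq_natDegree (D.monic_x k).ne_zero, hjk]
    · rw [h2]; exact two_ne_zero
  rw [h.leadingCoeff] at h3
  norm_num at h3

lemma one_le_natDegree (v : Fin D.numVars) : 1 ≤ (D.x v).natDegree := by
  induction v using D.var_induction with
  | free i =>
    induction i using Fin.cases with
    | zero => rw [D.x_zero, natDegree_X]
    | succ i => rw [D.x_free, add_comm, natDegree_X_add_C]
  | op k ih =>
    have hb := D.op_below k
    have hm := D.monic k
    have hx := D.x_op k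
    rw [hx] at hm ⊢
    rcases hk : D.op k with ⟨i, j⟩ | ⟨i, j⟩ | j <;> rw [hk] at hb hm <;>
      simp only [Operation.result, Operation.UsesOnlyBelow] at hb hm ⊢
    · have hi := ih i hb.1
      have hj := ih j hb.2
      rcases (D.natDegree_ne hm).lt_or_gt with h | h
      · rwa [natDegree_add_eq_right_of_natDegree_lt h]
      · rwa [natDegree_add_eq_left_of_natDegree_lt h]
    · rw [(D.monic_x i).natDegree_mul (D.monic_x j)]
      have hi := ih i hb.1
      omega
    · rw [← C_1, natDegree_add_C]
      exact ih j hb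

/-- The gadget which computes the result of an operation. An addition is arranged such that the
second summand has the larger degree; an increment is the addition of the frame. -/
noncomputable def opGadget : Operation (Fin D.numVars) → Gadget
  | .addition j k =>
    if (D.x j).natDegree < (D.x k).natDegree then add (j + 2) (k + 2) else add (k + 2) (j + 2)
  | .multiplication j k => mul (j + 2) (k + 2)
  | .increment j => add 1 (j + 2)

/-- The gadget of a variable. -/
noncomputable def varGadget : Fin D.numVars → Gadget :=
  Fin.addCases (fun _ => free) fun k => D.opGadget (D.op k)

variable {D} in
/-- The gadget of an equality. In place of a trivial equality `x_j = x_j`, `x_j` is paired with the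
frame, since the operands of a gadget have to be different. -/
def eqGadget (p : Fin D.numVars × Fin D.numVars) : Gadget :=
  if p.1 = p.2 then eq (p.1 + 2) 1 else eq (p.1 + 2) (p.2 + 2)

variable {D} in
/-- The gadget of an inequality. -/
def ineqGadget (p : Fin D.numVars × Fin D.numVars) : Gadget := ineq (p.1 + 2) (p.2 + 2)

/-- The number of the lines of the program of a representation. -/
abbrev numLines : ℕ := D.numVars + D.e + D.i + 2

/-- The program of a representation: the pole, the frame, the variables, the equalities and the
inequalities. The line of the variable `x_v` is `v + 2`. Beyond the last inequality, the program is
filled up with free variables, which contribute no elements to the matroid. -/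
noncomputable def program : ℕ → Gadget
  | 0 => pole
  | 1 => frame
  | l + 2 =>
    if h : l < D.numVars then D.varGadget ⟨l, h⟩
    else if h : l - D.numVars < D.e then eqGadget (D.eqs.equivFin.symm ⟨_, h⟩).1
    else if h : l - D.numVars - D.e < D.i then ineqGadget (D.ineqs.equivFin.symm ⟨_, h⟩).1
    else free

lemma program_var (v : Fin D.numVars) : D.program (v + 2) = D.varGadget v := by
  simp [program]

lemma program_eq (q : Fin D.e) :
    D.program (D.numVars + q + 2) = eqGadget (D.eqs.equivFin.symm q).1 := by
  simp [program]
  rfl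

lemma program_ineq (q : Fin D.i) :
    D.program (D.numVars + D.e + q + 2) = ineqGadget (D.ineqs.equivFin.symm q).1 := by
  have h : ¬ D.numVars + D.e + q < D.numVars := by omega
  have h1 : D.numVars + D.e + q - D.numVars = D.e + q := by omega
  simp [program, h, h1]
  rfl

lemma program_free {l : ℕ} (hl : D.numLines ≤ l) : D.program l = free := by
  have : D.numLines = D.numVars + D.e + D.i + 2 := rfl
  obtain ⟨l, rfl⟩ : ∃ m, l = m + 2 := ⟨l - 2, by omega⟩
  rw [program, dif_neg (by omega), dif_neg (by omega), dif_neg (by omega)]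

/-- Case distinction on the lines of the program of a representation. -/
theorem program_induction {P : ℕ → Gadget → Prop} (pole : P 0 pole) (frame : P 1 frame)
    (free : ∀ i : Fin (D.n + 1), P (i + 2) free)
    (op : ∀ k : Fin D.r, P (D.n + 1 + k + 2) (D.opGadget (D.op k)))
    (eq : ∀ p ∈ D.eqs, ∀ l, D.numVars + 2 ≤ l → P l (eqGadget p))
    (ineq : ∀ p ∈ D.ineqs, ∀ l, D.numVars + 2 ≤ l → P l (ineqGadget p))
    (rest : ∀ l, D.numLines ≤ l → P l Gadget.free) : ∀ l, P l (D.program l)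
  | 0 => pole
  | 1 => frame
  | l + 2 => by
    have hv : D.numVars = D.n + 1 + D.r := rfl
    have hL : D.numLines = D.numVars + D.e + D.i + 2 := rfl
    by_cases h1 : l < D.numVars
    · have := D.program_var ⟨l, h1⟩
      simp only at this
      rw [this]
      by_cases h2 : l < D.n + 1
      · have : (⟨l, h1⟩ : Fin D.numVars) = Fin.castAdd D.r ⟨l, h2⟩ := rfl
        rw [this, varGadget, Fin.addCases_left]
        exact free ⟨l, h2⟩
      · obtain ⟨k, rfl⟩ : ∃ k, l = D.n + 1 + k := ⟨l - (D.n + 1), by omega⟩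
        have : (⟨D.n + 1 + k, h1⟩ : Fin D.numVars) =
          Fin.natAdd (D.n + 1) ⟨k, by omega⟩ := rfl
        rw [this, varGadget, Fin.addCases_right]
        exact op ⟨k, by omega⟩
    by_cases h2 : l - D.numVars < D.e
    · rw [program, dif_neg h1, dif_pos h2]
      exact eq _ (Subtype.prop _) _ (by omega)
    by_cases h3 : l - D.numVars - D.e < D.i
    · rw [program, dif_neg h1, dif_neg h2, dif_pos h3]
      exact ineq _ (Subtype.prop _) _ (by omega)
    · have : D.numLines ≤ l + 2 := by omega
      rw [D.program_free this]
      exact rest _ this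

lemma isNonconst_opGadget (o : Operation (Fin D.numVars)) : (D.opGadget o).IsNonconst := by
  rcases o with ⟨j, k⟩ | ⟨j, k⟩ | j <;> simp only [opGadget]
  · split_ifs <;> trivial
  · trivial
  · trivial

lemma isNonconst_program (v : Fin D.numVars) : (D.program (v + 2)).IsNonconst := by
  rw [D.program_var]
  induction v using Fin.addCases with
  | left i => rw [varGadget, Fin.addCases_left]; trivial
  | right k => rw [varGadget, Fin.addCases_right]; exact D.isNonconst_opGadget _

theorem wellFormed (hD : ∀ p ∈ D.ineqs, p.1 ≠ p.2) : WellFormed D.program where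
  pole_iff := by
    have hL : D.numLines = D.numVars + D.e + D.i + 2 := rfl
    refine D.program_induction (P := fun l g => g = .pole ↔ l = 0) (by simp) (by simp) (by simp)
      (fun (k : Fin D.r) => ?_) (fun p _ l hl => ?_) (fun p _ l hl => ?_) (fun l hl => ?_)
    · have := D.isNonconst_opGadget (D.op k)
      simp only [show D.n + 1 + k + 2 ≠ 0 by omega, iff_false]
      intro h
      rw [h] at this
      exact this
    · simp only [eqGadget]
      split_ifs <;> simp <;> omega
    · simp [ineqGadget]; omega
    · simp; omega
  frame_iff := by
    have hL : D.numLines = D.numVars + D.e + D.i + 2 := rfl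
    refine D.program_induction (P := fun l g => g = .frame ↔ l = 1) (by simp) (by simp) (by simp)
      (fun (k : Fin D.r) => ?_) (fun p _ l hl => ?_) (fun p _ l hl => ?_) (fun l hl => ?_)
    · have := D.isNonconst_opGadget (D.op k)
      simp only [show D.n + 1 + k + 2 ≠ 1 by omega, iff_false]
      intro h
      rw [h] at this
      exact this
    · simp only [eqGadget]
      split_ifs <;> simp <;> omega
    · simp [ineqGadget]; omega
    · simp; omega
  add := by
    refine D.program_induction (P := fun l g => ∀ j k, g = .add j k → j < l ∧ k < l ∧ j ≠ k ∧
      (D.program j).IsVal ∧ (D.program k).IsNonconst) (by simp) (by simp) (by simp)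
      (fun (k : Fin D.r) => ?_) (fun p _ l hl => ?_) (fun p _ l hl => ?_) (fun l hl => by simp)
    · intro j' k' h
      have hb := D.op_below k
      have hm := D.monic k
      have hx := D.x_op k
      rw [hx] at hm
      rcases hk : D.op k with ⟨i, j⟩ | ⟨i, j⟩ | j <;> rw [hk] at hb h hm <;>
        simp only [opGadget, Operation.result, Operation.UsesOnlyBelow, Fin.lt_def,
          Fin.val_natAdd] at hb h hm
      · have hij : (i : ℕ) ≠ j := fun h => D.natDegree_ne hm (by rw [Fin.ext h])
        split_ifs at h <;> simp only [Gadget.add.injEq] at h <;> obtain ⟨rfl, rfl⟩ := h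
        · exact ⟨by omega, by omega, by omega, IsNonconst.isVal (D.isNonconst_program _),
            D.isNonconst_program _⟩
        · exact ⟨by omega, by omega, by omega, IsNonconst.isVal (D.isNonconst_program _),
            D.isNonconst_program _⟩
      · simp at h
      · simp only [Gadget.add.injEq] at h
        obtain ⟨rfl, rfl⟩ := h
        exact ⟨by omega, by omega, by omega, trivial, D.isNonconst_program _⟩
    · simp only [eqGadget]
      split_ifs <;> simp
    · simp [ineqGadget]
  mul := by
    refine D.program_induction (P := fun l g => ∀ j k, g = .mul j k → j < l ∧ k < l ∧
      (D.program j).IsNonconst ∧ (D.program k).IsNonconst) (by simp) (by simp) (by simp)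
      (fun (k : Fin D.r) => ?_) (fun p _ l hl => ?_) (fun p _ l hl => ?_) (fun l hl => by simp)
    · intro j' k' h
      have hb := D.op_below k
      rcases hk : D.op k with ⟨i, j⟩ | ⟨i, j⟩ | j <;> rw [hk] at hb h <;>
        simp only [opGadget, Operation.UsesOnlyBelow, Fin.lt_def, Fin.val_natAdd] at hb h
      · split_ifs at h
      · simp only [Gadget.mul.injEq] at h
        obtain ⟨rfl, rfl⟩ := h
        exact ⟨by omega, by omega, D.isNonconst_program _, D.isNonconst_program _⟩
      · simp at h
    · simp only [eqGadget]
      split_ifs <;> simp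
    · simp [ineqGadget]
  eq := by
    refine D.program_induction (P := fun l g => ∀ j k, g = .eq j k → j < l ∧ k < l ∧ j ≠ k ∧
      (D.program j).IsNonconst ∧ (D.program k).IsVal) (by simp) (by simp) (by simp)
      (fun (k : Fin D.r) => ?_) (fun p _ l hl => ?_) (fun p _ l hl => ?_) (fun l hl => by simp)
    · intro j' k' h
      have := D.isNonconst_opGadget (D.op k)
      rw [h] at this
      exact this.elim
    · intro j k h
      simp only [eqGadget] at h
      split_ifs at h with hp <;> simp only [Gadget.eq.injEq] at h <;> obtain ⟨rfl, rfl⟩ := h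
      · exact ⟨by omega, by omega, by omega, D.isNonconst_program _, trivial⟩
      · rw [Fin.ext_iff] at hp
        exact ⟨by omega, by omega, by omega, D.isNonconst_program _,
          IsNonconst.isVal (D.isNonconst_program _)⟩
    · simp [ineqGadget]
  ineq := by
    refine D.program_induction (P := fun l g => ∀ j k, g = .ineq j k → j < l ∧ k < l ∧ j ≠ k ∧
      (D.program j).IsNonconst ∧ (D.program k).IsNonconst) (by simp) (by simp) (by simp)
      (fun (k : Fin D.r) => ?_) (fun p _ l hl => ?_) (fun p hpD l hl => ?_) (fun l hl => by simp)
    · intro j' k' h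
      have := D.isNonconst_opGadget (D.op k)
      rw [h] at this
      exact this.elim
    · simp only [eqGadget]
      split_ifs <;> simp
    · intro j k h
      have hp := hD p hpD
      rw [Ne, Fin.ext_iff] at hp
      simp only [ineqGadget, Gadget.ineq.injEq] at h
      obtain ⟨rfl, rfl⟩ := h
      exact ⟨by omega, by omega, by omega, D.isNonconst_program _, D.isNonconst_program _⟩

section Count

lemma size_opGadget (o : Operation (Fin D.numVars)) : (D.opGadget o).size =
    7 * (if o.isAddition then 1 else 0) + 6 * (if o.isMultiplication then 1 else 0) +
      7 * (if o.isIncrement then 1 else 0) := by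
  rcases o with ⟨j, k⟩ | ⟨j, k⟩ | j <;> simp only [opGadget]
  · split_ifs <;> simp_all [size, Operation.isAddition, Operation.isMultiplication,
      Operation.isIncrement]
  · simp [size, Operation.isAddition, Operation.isMultiplication, Operation.isIncrement]
  · simp [size, Operation.isAddition, Operation.isMultiplication, Operation.isIncrement]

lemma r_eq : D.r = D.a + D.m + D.o := by
  rw [a, m, o, Finset.card_filter, Finset.card_filter, Finset.card_filter,
    ← Finset.sum_add_distrib, ← Finset.sum_add_distrib]
  have : ∀ k : Fin D.r, ((if (D.op k).isAddition then 1 else 0) +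
      if (D.op k).isMultiplication then 1 else 0) +
        (if (D.op k).isIncrement then 1 else 0) = 1 := by
    intro k
    rcases D.op k with ⟨i, j⟩ | ⟨i, j⟩ | j <;>
      simp [Operation.isAddition, Operation.isMultiplication, Operation.isIncrement]
  simp [this]

lemma sum_size : ∑ l ∈ Finset.range D.numLines, (D.program l).size =
    3 * D.n + 7 * D.a + 7 * D.o + 6 * D.m + 5 * D.e + 6 * D.i + 6 := by
  have h1 : ∑ k, (D.opGadget (D.op k)).size = 7 * D.a + 6 * D.m + 7 * D.o := by
    simp only [size_opGadget, Finset.sum_add_distrib, ← Finset.mul_sum]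
    rw [a, m, o, Finset.card_filter, Finset.card_filter, Finset.card_filter]
  have h2 : ∑ v ∈ Finset.range D.numVars, (D.program (v + 2)).size =
      3 * (D.n + 1) + (7 * D.a + 6 * D.m + 7 * D.o) := by
    rw [← h1, Finset.sum_range (n := D.numVars), Fin.sum_univ_add]
    simp only [D.program_var, varGadget, Fin.addCases_left, Fin.addCases_right]
    simp [size]; ring
  have h3 : ∑ q ∈ Finset.range D.e, (D.program (D.numVars + q + 2)).size = 5 * D.e := by
    rw [Finset.sum_range]
    have : ∀ q : Fin D.e, (D.program (D.numVars + q + 2)).size = 5 := fun q => by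
      rw [D.program_eq, eqGadget]
      split_ifs <;> rfl
    simp [this, mul_comm]
  have h4 : ∑ q ∈ Finset.range D.i, (D.program (D.numVars + D.e + q + 2)).size = 6 * D.i := by
    rw [Finset.sum_range]
    have : ∀ q : Fin D.i, (D.program (D.numVars + D.e + q + 2)).size = 6 := fun q => by
      rw [D.program_ineq]
      rfl
    simp [this, mul_comm]
  rw [Finset.sum_range_succ', Finset.sum_range_succ', Finset.sum_range_add, Finset.sum_range_add,
    h2, h3, h4]
  simp only [program, size]
  ring

end Count

/-- The elements of the first `L` blocks are indexed by their number `K`. -/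
lemma exists_enumeration {G : ℕ → Gadget} {L K : ℕ}
    (hK : ∑ l ∈ Finset.range L, (G l).size = K) :
    ∃ ε : Fin K → ℕ × ℕ, Function.Injective ε ∧ ∀ e, InRange G L e ↔ ∃ a, ε a = e := by
  have hc : Fintype.card (Fin K) = Fintype.card (Σ l : Fin L, Fin (G l).size) := by
    simp [← hK, Finset.sum_range]
  let φ := Fintype.equivOfCardEq hc
  let f : (Σ l : Fin L, Fin (G l).size) → ℕ × ℕ := fun s => (s.1, s.2)
  have hf : Function.Injective f := by
    rintro ⟨l, i⟩ ⟨l', i'⟩ h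
    simp only [f, Prod.mk.injEq] at h
    obtain rfl := Fin.ext h.1
    rw [Fin.ext h.2]
  refine ⟨f ∘ φ, hf.comp φ.injective, fun e => ⟨fun he => ?_, ?_⟩⟩
  · exact ⟨φ.symm ⟨⟨e.1, he.1⟩, ⟨e.2, he.2⟩⟩, congrArg f (φ.apply_symm_apply _)⟩
  · rintro ⟨a, rfl⟩
    exact ⟨(φ a).1.2, (φ a).2.2⟩

lemma nonempty_labels {N L : ℕ} (h : N = 3 * (L - 3) + 1) : Nonempty (Labels.{u} N L) :=
  ⟨Fintype.equivOfCardEq (by simp [h, mul_comm])⟩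

end ElementaryMonicRep

/-! ### The ring presented by the program of a representation -/

namespace ElementaryMonicRep
variable (D : ElementaryMonicRep)

/-- The structure homomorphism of the algebra with the representation `D`. -/
noncomputable def toAlgebra : D.Base →+* D.algebra :=
  (Ideal.Quotient.mk D.eqsIdeal).comp (algebraMap D.Base D.Localized)

lemma toAlgebra_eqs {p : Fin D.numVars × Fin D.numVars} (hp : p ∈ D.eqs) :
    D.toAlgebra (D.diff p) = 0 :=
  Ideal.Quotient.eq_zero_iff_mem.2 (Ideal.subset_span ⟨p, hp, rfl⟩)

lemma isUnit_toAlgebra_ineqs {p : Fin D.numVars × Fin D.numVars} (hp : p ∈ D.ineqs) :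
    IsUnit (D.toAlgebra (D.diff p)) :=
  (IsLocalization.map_units D.Localized
    (⟨_, Submonoid.subset_closure ⟨p, hp, rfl⟩⟩ :
      Submonoid.closure (D.diff '' (D.ineqs : Set _)))).map
      (Ideal.Quotient.mk D.eqsIdeal)

/-- The universal property of the algebra of a representation. -/
lemma exists_lift {A : Type*} [CommRing A] (g : D.Base →+* A)
    (he : ∀ p ∈ D.eqs, g (D.diff p) = 0) (hi : ∀ p ∈ D.ineqs, IsUnit (g (D.diff p))) :
    ∃ f : D.algebra →+* A, f.comp D.toAlgebra = g := by
  have hu : ∀ y : Submonoid.closure (D.diff '' (D.ineqs : Set _)), IsUnit (g y) := by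
    intro y
    have : Submonoid.closure (D.diff '' (D.ineqs : Set _)) ≤
        (IsUnit.submonoid A).comap (g : D.Base →* A) := by
      rw [Submonoid.closure_le]
      rintro _ ⟨p, hp, rfl⟩
      exact hi p hp
    exact this y.2
  refine ⟨Ideal.Quotient.lift _ (IsLocalization.lift hu) fun z hz => ?_, ?_⟩
  · have : D.eqsIdeal ≤ RingHom.ker (IsLocalization.lift (S := D.Localized) hu) := by
      rw [eqsIdeal, Ideal.span_le]
      rintro _ ⟨p, hp, rfl⟩
      rw [SetLike.mem_coe, RingHom.mem_ker, IsLocalization.lift_eq]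
      exact he p hp
    exact this hz
  · refine RingHom.ext fun z => ?_
    exact IsLocalization.lift_eq hu z

lemma toAlgebra_ext {A : Type*} [CommRing A] {f f' : D.algebra →+* A}
    (h : f.comp D.toAlgebra = f'.comp D.toAlgebra) : f = f' :=
  Ideal.Quotient.ringHom_ext (IsLocalization.ringHom_ext
    (Submonoid.closure (D.diff '' (D.ineqs : Set _))) h)

lemma x_sub_eqs {p : Fin D.numVars × Fin D.numVars} (hp : p ∈ D.eqs) :
    D.x p.1 - D.x p.2 = C (D.diff p) := by
  obtain ⟨c, hc⟩ := D.eqs_const p hp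
  rw [diff, hc, coeff_C_zero]

lemma x_sub_ineqs {p : Fin D.numVars × Fin D.numVars} (hp : p ∈ D.ineqs) :
    D.x p.1 - D.x p.2 = C (D.diff p) := by
  obtain ⟨c, hc⟩ := D.ineqs_const p hp
  rw [diff, hc, coeff_C_zero]

/-- Without equalities and inequalities, the algebra of a representation is a polynomial ring. -/
lemma nontrivial_algebra (he : D.e = 0) (hi : D.i = 0) : Nontrivial D.algebra := by
  rw [e, Finset.card_eq_zero] at he
  rw [i, Finset.card_eq_zero] at hi
  obtain ⟨f, -⟩ := D.exists_lift (A := ℤ) (MvPolynomial.eval₂Hom (Int.castRingHom ℤ) 0)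
    (by simp [he]) (by simp [hi])
  exact f.domain_nontrivial

/-- The polynomials on the lines of the program: the variables of the representation, and `1` for
the frame. The free variables which fill up the program get the admissible value `X`; the values on
the other lines are irrelevant. -/
noncomputable def lineVal (l : ℕ) : D.Base[X] :=
  if l = 1 then 1 else if h : l - 2 < D.numVars then D.x ⟨l - 2, h⟩ else X

lemma lineVal_one : D.lineVal 1 = 1 := by simp [lineVal]

lemma lineVal_var (v : Fin D.numVars) : D.lineVal (v + 2) = D.x v := by simp [lineVal]

lemma eq_of_program_eq {l j k : ℕ} (h : D.program l = .eq j k) (hk : k ≠ 1) :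
    ∃ p ∈ D.eqs, j = p.1 + 2 ∧ k = p.2 + 2 := by
  revert j k
  refine D.program_induction (P := fun l g => ∀ {j k}, g = .eq j k → k ≠ 1 →
    ∃ p ∈ D.eqs, j = p.1 + 2 ∧ k = p.2 + 2) (by simp) (by simp) (by simp)
    (fun (k : Fin D.r) => ?_) (fun p hp l hl => ?_) (fun p _ l hl => ?_) (fun l hl => by simp) l
  · intro j' k' h
    have := D.isNonconst_opGadget (D.op k)
    rw [h] at this
    exact this.elim
  · intro j k h hk
    simp only [eqGadget] at h
    split_ifs at h with hp' <;> simp only [Gadget.eq.injEq] at h <;> obtain ⟨rfl, rfl⟩ := h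
    · exact (hk rfl).elim
    · exact ⟨p, hp, rfl, rfl⟩
  · simp [ineqGadget]

lemma eq_of_program_ineq {l j k : ℕ} (h : D.program l = .ineq j k) :
    ∃ p ∈ D.ineqs, j = p.1 + 2 ∧ k = p.2 + 2 := by
  revert j k
  refine D.program_induction (P := fun l g => ∀ {j k}, g = .ineq j k →
    ∃ p ∈ D.ineqs, j = p.1 + 2 ∧ k = p.2 + 2) (by simp) (by simp) (by simp)
    (fun (k : Fin D.r) => ?_) (fun p hp l hl => ?_) (fun p hp l hl => ?_) (fun l hl => by simp) l
  · intro j' k' h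
    have := D.isNonconst_opGadget (D.op k)
    rw [h] at this
    exact this.elim
  · simp only [eqGadget]
    split_ifs <;> simp
  · intro j k h
    simp only [ineqGadget, Gadget.ineq.injEq] at h
    exact ⟨p, hp, h.1.symm, h.2.symm⟩

lemma exists_program_eq {p : Fin D.numVars × Fin D.numVars} (hp : p ∈ D.eqs) :
    ∃ l, D.program l = eqGadget p :=
  ⟨_, (D.program_eq (D.eqs.equivFin ⟨p, hp⟩)).trans (by simp)⟩

lemma exists_program_ineq {p : Fin D.numVars × Fin D.numVars} (hp : p ∈ D.ineqs) :
    ∃ l, D.program l = ineqGadget p :=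
  ⟨_, (D.program_ineq (D.ineqs.equivFin ⟨p, hp⟩)).trans (by simp)⟩

lemma computes_lineVal : Computes D.program D.lineVal := by
  have h1 := D.lineVal_one
  have h : ∀ k : Fin D.r, D.lineVal (D.n + 1 + k + 2) =
      (D.op k).result fun v : Fin D.numVars => D.lineVal (v + 2) := fun k => by
    have h2 := D.lineVal_var (Fin.natAdd (D.n + 1) k)
    rw [Fin.val_natAdd] at h2
    simp only [D.lineVal_var]
    rw [h2, D.x_op]
  refine ⟨h1, ?_, ?_⟩
  · refine D.program_induction
      (P := fun l g => ∀ j k, g = .add j k → D.lineVal l = D.lineVal j + D.lineVal k)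
      (by simp) (by simp) (by simp) (fun (k : Fin D.r) => ?_) (fun p _ l hl => ?_)
      (fun p _ l hl => ?_) (fun l hl => by simp)
    · intro j' k' hp
      rw [h]
      rcases hk : D.op k with ⟨i, j⟩ | ⟨i, j⟩ | j <;> rw [hk] at hp <;>
        simp only [opGadget, Operation.result] at hp ⊢
      · split_ifs at hp <;> simp only [Gadget.add.injEq] at hp <;> obtain ⟨rfl, rfl⟩ := hp
        · rfl
        · rw [add_comm]
      · simp at hp
      · simp only [Gadget.add.injEq] at hp
        obtain ⟨rfl, rfl⟩ := hp
        rw [h1, add_comm]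
    · simp only [eqGadget]
      split_ifs <;> simp
    · simp [ineqGadget]
  · refine D.program_induction
      (P := fun l g => ∀ j k, g = .mul j k → D.lineVal l = D.lineVal j * D.lineVal k)
      (by simp) (by simp) (by simp) (fun (k : Fin D.r) => ?_) (fun p _ l hl => ?_)
      (fun p _ l hl => ?_) (fun l hl => by simp)
    · intro j' k' hp
      rw [h]
      rcases hk : D.op k with ⟨i, j⟩ | ⟨i, j⟩ | j <;> rw [hk] at hp <;>
        simp only [opGadget, Operation.result] at hp ⊢
      · split_ifs at hp
      · simp only [Gadget.mul.injEq] at hp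
        obtain ⟨rfl, rfl⟩ := hp
        rfl
      · simp at hp
    · simp only [eqGadget]
      split_ifs <;> simp
    · simp [ineqGadget]

/-- A solution of the equations of the program is a specialization of the variables. -/
lemma eq_eval₂_x {A : Type*} [CommRing A] {x : ℕ → A} (hx : Computes D.program x)
    (v : Fin D.numVars) : x (v + 2) = (D.x v).eval₂
      (MvPolynomial.eval₂Hom (Int.castRingHom A) fun i : Fin D.n => x (i + 3) - x 2) (x 2) := by
  induction v using D.var_induction with
  | free i =>
    induction i using Fin.cases with
    | zero => rw [D.x_zero, eval₂_X]; rfl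
    | succ i =>
      rw [D.x_free, eval₂_add, eval₂_C, eval₂_X, MvPolynomial.coe_eval₂Hom, MvPolynomial.eval₂_X,
        sub_add_cancel]
      rfl
  | op k ih =>
    have hb := D.op_below k
    have hp := D.program_var (Fin.natAdd (D.n + 1) k)
    rw [varGadget, Fin.addCases_right] at hp
    rw [D.x_op]
    rcases hk : D.op k with ⟨i, j⟩ | ⟨i, j⟩ | j <;> rw [hk] at hb hp <;>
      simp only [opGadget, Operation.result, Operation.UsesOnlyBelow] at hb hp ⊢
    · rw [eval₂_add, ← ih _ hb.1, ← ih _ hb.2]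
      split_ifs at hp
      · exact hx.add _ _ _ hp
      · rw [hx.add _ _ _ hp, add_comm]
    · rw [eval₂_mul, ← ih _ hb.1, ← ih _ hb.2, hx.mul _ _ _ hp]
    · rw [eval₂_add, ← ih _ hb, eval₂_one, hx.add _ _ _ hp, hx.one, add_comm]

section Presentation
variable {R : Type u} [CommRing R] (φ : R ≃+* D.algebra)

lemma isNonconst_cases {l : ℕ} (hl : (D.program l).IsNonconst) :
    (∃ v : Fin D.numVars, l = v + 2) ∨ D.numLines ≤ l := by
  revert hl
  refine D.program_induction (P := fun l g => g.IsNonconst →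
    (∃ v : Fin D.numVars, l = v + 2) ∨ D.numLines ≤ l) False.elim False.elim (fun i _ => ?_)
    (fun (k : Fin D.r) _ => ?_) (fun p hp l hl h => ?_) (fun p hp l hl => False.elim)
    (fun l hl _ => Or.inr hl) l
  · exact Or.inl ⟨Fin.castAdd D.r i, rfl⟩
  · exact Or.inl ⟨Fin.natAdd (D.n + 1) k, rfl⟩
  · simp only [eqGadget] at h
    split_ifs at h <;> exact h.elim

lemma lineVal_of_isNonconst {l : ℕ} (hl : (D.program l).IsNonconst) :
    (D.lineVal l).Monic ∧ 1 ≤ (D.lineVal l).natDegree := by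
  rcases D.isNonconst_cases hl with ⟨v, rfl⟩ | h
  · rw [D.lineVal_var]
    exact ⟨D.monic_x v, D.one_le_natDegree v⟩
  · have : D.numLines = D.numVars + D.e + D.i + 2 := rfl
    rw [lineVal, if_neg (by omega), dif_neg (by omega)]
    exact ⟨monic_X, natDegree_X.ge⟩

lemma natDegree_lineVal_lt {l j k : ℕ} (h : D.program l = .add j k) :
    (D.lineVal j).natDegree < (D.lineVal k).natDegree := by
  revert j k
  refine D.program_induction (P := fun l g => ∀ {j k}, g = .add j k →
    (D.lineVal j).natDegree < (D.lineVal k).natDegree)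
    (by simp) (by simp) (by simp) (fun (k : Fin D.r) => ?_) (fun p _ l hl => ?_)
    (fun p _ l hl => ?_) (fun l hl => by simp) l
  · intro j' k' hp
    have hm := D.monic k
    rw [D.x_op] at hm
    rcases hk : D.op k with ⟨i, j⟩ | ⟨i, j⟩ | j <;> rw [hk] at hp hm <;>
      simp only [opGadget, Operation.result] at hp hm
    · have hij := D.natDegree_ne hm
      split_ifs at hp <;> simp only [Gadget.add.injEq] at hp <;> obtain ⟨rfl, rfl⟩ := hp <;>
        rw [D.lineVal_var, D.lineVal_var] <;> omega
    · simp at hp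
    · simp only [Gadget.add.injEq] at hp
      obtain ⟨rfl, rfl⟩ := hp
      rw [D.lineVal_one, D.lineVal_var, natDegree_one]
      exact D.one_le_natDegree j
  · simp only [eqGadget]
    split_ifs <;> simp
  · simp [ineqGadget]

lemma natDegree_eq_of_sub {j k : Fin D.numVars} {c : D.Base} (h : D.x j - D.x k = C c) :
    (D.x j).natDegree = (D.x k).natDegree := by
  rw [sub_eq_iff_eq_add'.1 h, natDegree_add_C]

lemma ne_of_mem_ineqs [Nontrivial D.algebra] {p : Fin D.numVars × Fin D.numVars}
    (hp : p ∈ D.ineqs) : p.1 ≠ p.2 := by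
  intro h
  have h1 := D.isUnit_toAlgebra_ineqs hp
  rw [diff, h, sub_self, coeff_zero, map_zero] at h1
  exact not_isUnit_zero h1

/-- Over each field, the variables of a representation have admissible values: the degrees of monic
polynomials do not change under specialization. -/
lemma admissible (F : Type*) [Field F] (f : D.algebra →+* F) :
    Admissible D.program fun l => (D.lineVal l).map (f.comp D.toAlgebra) where
  toComputes := D.computes_lineVal.map (mapRingHom (f.comp D.toAlgebra))
  eq l j k h hk := by
    obtain ⟨p, hp, rfl, rfl⟩ := D.eq_of_program_eq h hk
    rw [D.lineVal_var, D.lineVal_var, ← sub_eq_zero, ← Polynomial.map_sub, D.x_sub_eqs hp, map_C,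
      RingHom.comp_apply, D.toAlgebra_eqs hp, map_zero, C_0]
  monic l h := (D.lineVal_of_isNonconst h).1.map _
  one_le l h := by
    rw [(D.lineVal_of_isNonconst h).1.natDegree_map]
    exact (D.lineVal_of_isNonconst h).2
  add_lt l j k h := by
    have := f.domain_nontrivial
    have w := D.wellFormed fun p => D.ne_of_mem_ineqs
    have nk := (D.lineVal_of_isNonconst (w.add _ _ _ h).2.2.2.2).1
    rw [nk.natDegree_map]
    exact (natDegree_map_le).trans_lt (D.natDegree_lineVal_lt h)
  ineq_deg l j k h := by
    obtain ⟨p, hp, rfl, rfl⟩ := D.eq_of_program_ineq h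
    rw [D.lineVal_var, D.lineVal_var, (D.monic_x _).natDegree_map, (D.monic_x _).natDegree_map]
    exact D.natDegree_eq_of_sub (D.x_sub_ineqs hp)
  ineq_ne l j k h := by
    obtain ⟨p, hp, rfl, rfl⟩ := D.eq_of_program_ineq h
    rw [D.lineVal_var, D.lineVal_var, ← sub_ne_zero, ← Polynomial.map_sub, D.x_sub_ineqs hp, map_C,
      C_ne_zero]
    exact ((D.isUnit_toAlgebra_ineqs hp).map f).ne_zero

/-- The values of the variables, as polynomials over `R`. -/
noncomputable def ringVal (l : ℕ) : R[X] :=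
  (D.lineVal l).map ((φ.symm : D.algebra →+* R).comp D.toAlgebra)

lemma eval₂_ringVal {A : Type*} [CommRing A] (f : R →+* A) (t : A) (l : ℕ) :
    (D.ringVal φ l).eval₂ f t =
      (D.lineVal l).eval₂ ((f.comp (φ.symm : D.algebra →+* R)).comp D.toAlgebra) t := by
  rw [ringVal, eval₂_map, RingHom.comp_assoc]

/-- A ring with an elementary monic representation has a presentation by the associated program. -/
lemma isPresentation : IsPresentation D.program D.numLines (D.ringVal φ) where
  satisfiesEqs :=
    { toComputes := D.computes_lineVal.map
        (mapRingHom ((φ.symm : D.algebra →+* R).comp D.toAlgebra))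
      eq := fun l j k h hk => by
        obtain ⟨p, hp, rfl, rfl⟩ := D.eq_of_program_eq h hk
        rw [ringVal, ringVal, D.lineVal_var, D.lineVal_var, ← sub_eq_zero, ← Polynomial.map_sub,
          D.x_sub_eqs hp, map_C, RingHom.comp_apply, D.toAlgebra_eqs hp, map_zero, C_0] }
  admissible F _ f := by
    have := D.admissible F (f.comp (φ.symm : D.algebra →+* R))
    simpa only [ringVal, Polynomial.map_map, ← RingHom.comp_assoc] using this
  exists_hom A _ x hx hi := by
    have hv := fun v => D.eq_eval₂_x hx.toComputes v
    set g := (MvPolynomial.eval₂Hom (Int.castRingHom A) fun i : Fin D.n => x (i + 3) - x 2)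
    have hd : ∀ p : Fin D.numVars × Fin D.numVars, D.x p.1 - D.x p.2 = C (D.diff p) →
        g (D.diff p) = x (p.1 + 2) - x (p.2 + 2) := fun p hp => by
      rw [hv, hv, ← eval₂_sub, hp, eval₂_C]
    obtain ⟨f, hf⟩ := D.exists_lift g
      (fun p hp => by
        rw [hd p (D.x_sub_eqs hp), sub_eq_zero]
        obtain ⟨l, hl⟩ := D.exists_program_eq hp
        by_cases h12 : p.1 = p.2
        · rw [h12]
        · rw [eqGadget, if_neg h12] at hl
          exact hx.eq _ _ _ hl (by simp))
      (fun p hp => by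
        rw [hd p (D.x_sub_ineqs hp)]
        obtain ⟨l, hl⟩ := D.exists_program_ineq hp
        exact hi _ _ _ hl)
    refine ⟨f.comp (φ : R →+* D.algebra), x 2, fun l hl hn => ?_⟩
    obtain ⟨v, rfl⟩ := (D.isNonconst_cases hn).resolve_right hl.not_ge
    have : (f.comp (φ : R →+* D.algebra)).comp (φ.symm : D.algebra →+* R) = f := by
      ext z; simp
    rw [eval₂_ringVal, this, hf, D.lineVal_var, hv]
  hom_ext A _ f f' t t' h := by
    simp only [eval₂_ringVal] at h
    have hv : ∀ v, _ := fun v : Fin D.numVars => h (v + 2)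
      (by have : D.numLines = D.numVars + D.e + D.i + 2 := rfl
          omega) (D.isNonconst_program v)
    simp only [D.lineVal_var] at hv
    have ht : t = t' := by simpa [D.x_zero] using hv (Fin.castAdd D.r 0)
    subst ht
    have h1 : (f.comp (φ.symm : D.algebra →+* R)).comp D.toAlgebra =
        (f'.comp (φ.symm : D.algebra →+* R)).comp D.toAlgebra := by
      refine MvPolynomial.ringHom_ext (fun r => by simp) fun i => ?_
      have := hv (Fin.castAdd D.r i.succ)
      rw [D.x_free, eval₂_add, eval₂_add, eval₂_C, eval₂_C, eval₂_X, eval₂_X] at this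
      exact add_right_cancel this
    refine ⟨RingHom.ext fun r => ?_, rfl⟩
    have := congrArg (fun f => f (φ r)) (D.toAlgebra_ext h1)
    simpa using this

/-- A ring with an elementary monic representation `D` is, up to an affine space, the realization
space of a matroid whose number of elements is the sum of the sizes of the gadgets. If the ring is
zero, then `D` has an equality or an inequality, and hence there are enough elements for a
non-Pappus configuration. -/
theorem exists_matroid (φ : R ≃+* D.algebra) :
    ∃ M : Matroid (Fin (3 * D.n + 7 * D.a + 7 * D.o + 6 * D.m + 5 * D.e + 6 * D.i + 6)),
      IsSimpleRankThree M ∧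
        HasOpenRealizationSpace M (3 * (D.n + D.a + D.o + D.m + D.e + D.i) + 1) R := by
  rcases subsingleton_or_nontrivial R with hR | hR
  · refine hasOpenRealizationSpace_of_subsingleton ?_ _
    by_contra! h
    have := D.nontrivial_algebra (by omega) (by omega)
    exact not_subsingleton D.algebra φ.symm.toEquiv.subsingleton
  · have := φ.symm.toEquiv.nontrivial
    have hr := D.r_eq
    have hL : D.numLines = D.n + 1 + D.r + D.e + D.i + 2 := rfl
    obtain ⟨ε, hε, hε'⟩ := exists_enumeration D.sum_size
    obtain ⟨τ⟩ := nonempty_labels.{u} (L := D.numLines)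
      (N := 3 * (D.n + D.a + D.o + D.m + D.e + D.i) + 1) (by omega)
    exact (D.isPresentation φ).hasOpenRealizationSpace τ (D.wellFormed fun _ => D.ne_of_mem_ineqs)
      (by omega) (fun l => D.program_free) hε hε'

end Presentation
end ElementaryMonicRep

/-! ### Existence of elementary monic representations -/

section Existence

/-- The polynomials which may occur as variables of an elementary monic representation. -/
inductive IsAccessible (n : ℕ) : (MvPolynomial (Fin n) ℤ)[X] → Prop
  | var : IsAccessible n X
  | free (i : Fin n) : IsAccessible n (C (MvPolynomial.X i) + X)
  | add {p q} : IsAccessible n p → IsAccessible n q → (p + q).Monic → IsAccessible n (p + q)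
  | mul {p q} : IsAccessible n p → IsAccessible n q → (p * q).Monic → IsAccessible n (p * q)
  | increment {p} : IsAccessible n p → (p + 1).Monic → IsAccessible n (p + 1)

namespace IsAccessible
variable {n : ℕ} {p q p' q' : (MvPolynomial (Fin n) ℤ)[X]}

lemma monic (h : IsAccessible n p) : p.Monic := by
  rcases h with _ | i | ⟨-, -, h⟩ | ⟨-, -, h⟩ | ⟨-, h⟩
  · exact monic_X
  · rw [add_comm]; exact monic_X_add_C _
  all_goals exact h

lemma mul' (hp : IsAccessible n p) (hq : IsAccessible n q) : IsAccessible n (p * q) :=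
  hp.mul hq (hp.monic.mul hq.monic)

lemma pow (N : ℕ) : IsAccessible n (X ^ (N + 1)) := by
  induction N with
  | zero => simpa using var
  | succ N ih => rw [pow_succ]; exact ih.mul' var

/-- Sums of two accessible polynomials become accessible after adding a power of `t` of high
degree. -/
lemma add_add_pow (hp : IsAccessible n p) (hq : IsAccessible n q) {N : ℕ}
    (hpN : p.natDegree ≤ N) (hqN : q.natDegree ≤ N) :
    IsAccessible n (p + (q + X ^ (N + 1))) := by
  have h1 : q.degree < (X ^ (N + 1) : (MvPolynomial (Fin n) ℤ)[X]).degree := by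
    rw [degree_X_pow]
    exact degree_le_natDegree.trans_lt (by exact_mod_cast Nat.lt_succ_of_le hqN)
  have hm : (q + X ^ (N + 1)).Monic := (monic_X_pow _).add_of_right h1
  refine hp.add (hq.add (pow N) hm) (hm.add_of_right ?_)
  rw [degree_add_eq_right_of_degree_lt h1, degree_X_pow]
  exact degree_le_natDegree.trans_lt (by exact_mod_cast Nat.lt_succ_of_le hpN)

/-- The differences of accessible polynomials which are constant form a ring. -/
def differences (n : ℕ) : Subring (MvPolynomial (Fin n) ℤ) where
  carrier := {f | ∃ p q, IsAccessible n p ∧ IsAccessible n q ∧ p - q = C f}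
  zero_mem' := ⟨X, X, var, var, by simp⟩
  one_mem' := ⟨X + 1, X, var.increment (monic_X_add_C 1), var, by simp⟩
  neg_mem' := by
    rintro f ⟨p, q, hp, hq, h⟩
    exact ⟨q, p, hq, hp, by rw [C_neg, ← h, neg_sub]⟩
  add_mem' := by
    rintro f f' ⟨p, q, hp, hq, h⟩ ⟨p', q', hp', hq', h'⟩
    obtain ⟨N, hN⟩ : ∃ N, N = p.natDegree + p'.natDegree + q.natDegree + q'.natDegree := ⟨_, rfl⟩
    refine ⟨_, _, hp.add_add_pow hp' (N := N) (by omega) (by omega),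
      hq.add_add_pow hq' (N := N) (by omega) (by omega), ?_⟩
    rw [C_add, ← h, ← h']
    ring
  mul_mem' := by
    rintro f f' ⟨p, q, hp, hq, h⟩ ⟨p', q', hp', hq', h'⟩
    obtain ⟨N, hN⟩ : ∃ N, N = (p * p').natDegree + (q * q').natDegree + (p * q').natDegree +
      (q * p').natDegree := ⟨_, rfl⟩
    refine ⟨_, _, (hp.mul' hp').add_add_pow (hq.mul' hq') (N := N) (by omega) (by omega),
      (hp.mul' hq').add_add_pow (hq.mul' hp') (N := N) (by omega) (by omega), ?_⟩
    rw [C_mul, ← h, ← h']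
    ring

lemma exists_sub_eq (f : MvPolynomial (Fin n) ℤ) :
    ∃ p q, IsAccessible n p ∧ IsAccessible n q ∧ p - q = C f := by
  change f ∈ differences n
  induction f using MvPolynomial.induction_on with
  | C a =>
    rw [show (MvPolynomial.C a : MvPolynomial (Fin n) ℤ) = (a : MvPolynomial (Fin n) ℤ) by simp]
    exact intCast_mem _ a
  | add p q hp hq => exact add_mem hp hq
  | mul_X p i hp => exact mul_mem hp ⟨_, _, free i, var, by simp⟩

end IsAccessible

/-- The operation in terms of other names of the variables. -/
def Operation.map {ι κ : Type} (f : ι → κ) : Operation ι → Operation κ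
  | addition j k => addition (f j) (f k)
  | multiplication j k => multiplication (f j) (f k)
  | increment j => increment (f j)

lemma Operation.result_map {ι κ P : Type} [CommRing P] (f : ι → κ) (x : κ → P)
    (o : Operation ι) : (o.map f).result x = o.result (x ∘ f) := by
  cases o <;> rfl

/-- An elementary monic representation without equalities and inequalities. -/
structure Chain (n : ℕ) where
  r : ℕ
  x : Fin (n + 1 + r) → (MvPolynomial (Fin n) ℤ)[X]
  op : Fin r → Operation (Fin (n + 1 + r))
  x_zero : x (Fin.castAdd r 0) = X
  x_free : ∀ i : Fin n, x (Fin.castAdd r i.succ) = C (MvPolynomial.X i) + X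
  op_below : ∀ k : Fin r, (op k).UsesOnlyBelow (Fin.natAdd (n + 1) k)
  x_op : ∀ k : Fin r, x (Fin.natAdd (n + 1) k) = (op k).result x
  monic : ∀ k : Fin r, (x (Fin.natAdd (n + 1) k)).Monic

namespace Chain
variable {n : ℕ}

/-- Add a variable to a chain. -/
noncomputable def snoc (D : Chain n) (o : Operation (Fin (n + 1 + D.r)))
    (ho : (o.result D.x).Monic) : Chain n where
  r := D.r + 1
  x := Fin.snoc (α := fun _ => (MvPolynomial (Fin n) ℤ)[X]) D.x (o.result D.x)
  op := Fin.snoc (α := fun _ => Operation (Fin (n + 1 + D.r + 1)))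
    (fun k => (D.op k).map Fin.castSucc) (o.map Fin.castSucc)
  x_zero := (Fin.snoc_castSucc (α := fun _ => (MvPolynomial (Fin n) ℤ)[X]) _ _ _).trans D.x_zero
  x_free i :=
    (Fin.snoc_castSucc (α := fun _ => (MvPolynomial (Fin n) ℤ)[X]) _ _ _).trans (D.x_free i)
  op_below k := by
    induction k using Fin.lastCases with
    | last =>
      rw [Fin.snoc_last]
      cases o <;> simp [Operation.map, Operation.UsesOnlyBelow, Fin.lt_def]
    | cast k =>
      rw [Fin.snoc_castSucc]
      have := D.op_below k
      cases h : D.op k <;> rw [h] at this <;>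
        simpa [Operation.map, Operation.UsesOnlyBelow, Fin.lt_def] using this
  x_op k := by
    have h : (Fin.snoc (α := fun _ => (MvPolynomial (Fin n) ℤ)[X]) D.x (o.result D.x)) ∘
        Fin.castSucc = D.x :=
      funext fun v => Fin.snoc_castSucc (α := fun _ => (MvPolynomial (Fin n) ℤ)[X]) _ _ _
    induction k using Fin.lastCases with
    | last =>
      rw [Fin.snoc_last]
      refine (Fin.snoc_last (α := fun _ => (MvPolynomial (Fin n) ℤ)[X]) _ _).trans ?_
      rw [Operation.result_map, h]
    | cast k =>
      rw [Fin.snoc_castSucc]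
      refine (Fin.snoc_castSucc (α := fun _ => (MvPolynomial (Fin n) ℤ)[X]) _ _
        (Fin.natAdd (n + 1) k)).trans ?_
      rw [Operation.result_map, h, D.x_op]
  monic k := by
    induction k using Fin.lastCases with
    | last =>
      have := Fin.snoc_last (α := fun _ => (MvPolynomial (Fin n) ℤ)[X]) (o.result D.x) D.x
      exact this.symm ▸ ho
    | cast k =>
      have := Fin.snoc_castSucc (α := fun _ => (MvPolynomial (Fin n) ℤ)[X]) (o.result D.x) D.x
        (Fin.natAdd (n + 1) k)
      exact this.symm ▸ D.monic k

lemma range_subset_snoc (D : Chain n) (o : Operation (Fin (n + 1 + D.r)))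
    (ho : (o.result D.x).Monic) : Set.range D.x ⊆ Set.range (D.snoc o ho).x := by
  rintro _ ⟨v, rfl⟩
  exact ⟨Fin.castSucc v, Fin.snoc_castSucc (α := fun _ => (MvPolynomial (Fin n) ℤ)[X]) _ _ _⟩

lemma result_mem_snoc (D : Chain n) (o : Operation (Fin (n + 1 + D.r)))
    (ho : (o.result D.x).Monic) : o.result D.x ∈ Set.range (D.snoc o ho).x :=
  ⟨Fin.last _, Fin.snoc_last (α := fun _ => (MvPolynomial (Fin n) ℤ)[X]) _ _⟩

/-- The chain without operations. -/
noncomputable def free (n : ℕ) : Chain n where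
  r := 0
  x := Fin.cases X fun i => C (MvPolynomial.X i) + X
  op := Fin.elim0
  x_zero := rfl
  x_free _ := rfl
  op_below k := k.elim0
  x_op k := k.elim0
  monic k := k.elim0

/-- Each accessible polynomial occurs in an extension of a given chain. -/
lemma exists_extension {p : (MvPolynomial (Fin n) ℤ)[X]} (hp : IsAccessible n p) (D : Chain n) :
    ∃ D' : Chain n, Set.range D.x ⊆ Set.range D'.x ∧ p ∈ Set.range D'.x := by
  induction hp generalizing D with
  | var => exact ⟨D, subset_rfl, _, D.x_zero⟩
  | free => exact ⟨D, subset_rfl, _, D.x_free _⟩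
  | add hp hq hm ihp ihq =>
    obtain ⟨D₁, h₁, hp₁⟩ := ihp D
    obtain ⟨D₂, h₂, j, rfl⟩ := ihq D₁
    obtain ⟨i, rfl⟩ := h₂ hp₁
    exact ⟨D₂.snoc (.addition i j) hm, (h₁.trans h₂).trans (D₂.range_subset_snoc _ _),
      D₂.result_mem_snoc _ _⟩
  | mul hp hq hm ihp ihq =>
    obtain ⟨D₁, h₁, hp₁⟩ := ihp D
    obtain ⟨D₂, h₂, j, rfl⟩ := ihq D₁
    obtain ⟨i, rfl⟩ := h₂ hp₁
    exact ⟨D₂.snoc (.multiplication i j) hm, (h₁.trans h₂).trans (D₂.range_subset_snoc _ _),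
      D₂.result_mem_snoc _ _⟩
  | increment hp hm ihp =>
    obtain ⟨D₁, h₁, j, rfl⟩ := ihp D
    exact ⟨D₁.snoc (.increment j) hm, h₁.trans (D₁.range_subset_snoc _ _),
      D₁.result_mem_snoc _ _⟩

/-- Each finite set of constants occurs among the differences of the variables of a chain. -/
lemma exists_contains (T : Finset (MvPolynomial (Fin n) ℤ)) :
    ∃ D : Chain n, ∀ f ∈ T, ∃ j k, D.x j - D.x k = C f := by
  classical
  induction T using Finset.induction_on with
  | empty => exact ⟨free n, by simp⟩
  | insert f T hf ih =>
    obtain ⟨D, hD⟩ := ih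
    obtain ⟨p, q, hp, hq, hpq⟩ := IsAccessible.exists_sub_eq f
    obtain ⟨D₁, h₁, hp₁⟩ := exists_extension hp D
    obtain ⟨D₂, h₂, k, rfl⟩ := exists_extension hq D₁
    obtain ⟨j, rfl⟩ := h₂ hp₁
    refine ⟨D₂, fun g hg => ?_⟩
    rcases Finset.mem_insert.1 hg with rfl | hg
    · exact ⟨j, k, hpq⟩
    · obtain ⟨j', k', h⟩ := hD g hg
      obtain ⟨j'', hj⟩ := h₂ (h₁ ⟨j', rfl⟩)
      obtain ⟨k'', hk⟩ := h₂ (h₁ ⟨k', rfl⟩)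
      exact ⟨j'', k'', by rw [hj, hk, h]⟩

/-- A chain together with equalities is an elementary monic representation. -/
noncomputable def toRep (D : Chain n) (eqs : Finset (Fin (n + 1 + D.r) × Fin (n + 1 + D.r)))
    (h : ∀ p ∈ eqs, ∃ c, D.x p.1 - D.x p.2 = C c) : ElementaryMonicRep :=
  { D with n := n, eqs := eqs, ineqs := ∅, eqs_const := h, ineqs_const := by simp }

end Chain

/-- Without inequalities, the algebra of a representation is a quotient of a polynomial ring. -/
lemma ElementaryMonicRep.nonempty_ringEquiv (D : ElementaryMonicRep) (hi : D.ineqs = ∅)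
    {R : Type u} [CommRing R] (π : D.Base →+* R) (hπ : Function.Surjective π)
    (hI : RingHom.ker π = Ideal.span (D.diff '' (D.eqs : Set _))) :
    Nonempty (R ≃+* D.algebra) := by
  have h : ∀ f ∈ RingHom.ker π, D.toAlgebra f = 0 := by
    change RingHom.ker π ≤ RingHom.ker D.toAlgebra
    rw [hI, Ideal.span_le]
    rintro _ ⟨p, hp, rfl⟩
    exact D.toAlgebra_eqs hp
  obtain ⟨g, hg⟩ := D.exists_lift (Ideal.Quotient.mk (RingHom.ker π))
    (fun p hp => Ideal.Quotient.eq_zero_iff_mem.2 (hI ▸ Ideal.subset_span ⟨p, hp, rfl⟩))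
    (by simp [hi])
  have e : (D.Base ⧸ RingHom.ker π) ≃+* D.algebra :=
    RingEquiv.ofRingHom (Ideal.Quotient.lift _ D.toAlgebra h) g
      (D.toAlgebra_ext (by
        rw [RingHom.comp_assoc, hg, Ideal.Quotient.lift_comp_mk, RingHom.id_comp]))
      (Ideal.Quotient.ringHom_ext (by
        rw [RingHom.comp_assoc, Ideal.Quotient.lift_comp_mk, hg, RingHom.id_comp]))
  exact ⟨(RingHom.quotientKerEquivOfSurjective hπ).symm.trans e⟩

/-- Every algebra of finite type has an elementary monic representation. -/
theorem exists_elementaryMonicRep (R : Type u) [CommRing R] (hR : Algebra.FiniteType ℤ R) :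
    ∃ D : ElementaryMonicRep, Nonempty (R ≃+* D.algebra) := by
  classical
  obtain ⟨n, π, hπ⟩ := Algebra.FiniteType.iff_quotient_mvPolynomial''.1 hR
  obtain ⟨T, hT⟩ := (isNoetherianRing_iff_ideal_fg _).1
    (inferInstance : IsNoetherianRing (MvPolynomial (Fin n) ℤ)) (RingHom.ker (π : _ →+* R))
  obtain ⟨c, hc⟩ := Chain.exists_contains T
  choose! j k hjk using hc
  have hconst : ∀ p ∈ T.image fun f => (j f, k f), ∃ f, c.x p.1 - c.x p.2 = C f := by
    intro p hp
    obtain ⟨f, hf, rfl⟩ := Finset.mem_image.1 hp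
    exact ⟨f, hjk f hf⟩
  have hdiff : ∀ f ∈ T, (c.toRep _ hconst).diff (j f, k f) = f := fun f hf =>
    (congrArg (fun q => coeff q 0) (hjk f hf)).trans coeff_C_zero
  refine ⟨c.toRep _ hconst, ElementaryMonicRep.nonempty_ringEquiv _ rfl
    (π : MvPolynomial (Fin n) ℤ →+* R) hπ (hT.symm.trans (congrArg Ideal.span ?_))⟩
  ext f
  constructor
  · exact fun hf => ⟨_, Finset.mem_image_of_mem _ hf, hdiff f hf⟩
  · rintro ⟨p, hp, rfl⟩
    obtain ⟨f, hf, rfl⟩ := Finset.mem_image.1 hp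
    exact (congrArg (· ∈ T) (hdiff f hf)).mpr hf

end Existence

end

end Mnev

theorem theorem5p3 (R : Type u) [CommRing R] (hR : Algebra.FiniteType ℤ R) :
    (∃ (K N : ℕ) (M : Matroid (Fin K)),
      Mnev.IsSimpleRankThree M ∧ Mnev.HasOpenRealizationSpace M N R) ∧
    ∀ D : Mnev.ElementaryMonicRep, Nonempty (R ≃+* D.algebra) →
      ∃ M : Matroid (Fin (3 * D.n + 7 * D.a + 7 * D.o + 6 * D.m + 5 * D.e + 6 * D.i + 6)),
        Mnev.IsSimpleRankThree M ∧
        Mnev.HasOpenRealizationSpace M (3 * (D.n + D.a + D.o + D.m + D.e + D.i) + 1) R := by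
  obtain ⟨D, ⟨φ⟩⟩ := Mnev.exists_elementaryMonicRep R hR
  exact ⟨⟨_, _, D.exists_matroid φ⟩, fun D ⟨φ⟩ => D.exists_matroid φ⟩
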